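/- Manifolds are smooth, finite-dimensional, Hausdorff and without boundary. Let $G\rightrightarrows M$ be a Lie groupoid with source $\alpha$, target $\beta$ (both submersions), identity map $1\colon M\to G$, and product $gh$ defined when $\alpha(g)=\beta(h)$. Its Lie algebroid $q\colon AG\to M$ is the vector bundle with fibres $A_mG=\ker T_{1_m}(\alpha)$; let $\iota\colon AG\to TG$ be the inclusion, and let $a=T(\beta)|_{AG}\colon AG\to TM$ be the anchor. Applying the tangent functor to the structure maps gives the tangent groupoid $TG\rightrightarrows TM$; its Lie algebroid $ATG\subseteq T(TG)$ consists of the tangent vectors to $TG$ at points $T(1)(u)$, $u\in TM$, that are annihilated by $T(T(\alpha))$. Let $J_G$ be the canonical involution of $T(TG)$ and $j_G=J_G\circ T(\iota)\colon TAG\to T(TG)$. A multiplicative vector field on $G$ is a pair $(\xi,x)$ of smooth vector fields on $G$ and $M$ such that $\xi\colon G\to TG$ is a morphism of groupoids over $x\colon M\to TM$. For a section $X\in\Gamma AG$ the right-invariant vector field is $\vec X(g)=T(R_g)(X(\beta g))$, where $R_g\colon\alpha^{-1}(\beta g)\to\alpha^{-1}(\alpha g)$, $h\mapsto hg$. A linear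 vector field on a vector bundle $A\to M$ is a pair $(\eta,x)$ of smooth vector fields on $A$ and $M$ such that $\eta\colon A\to TA$ is a morphism of vector bundles from $A\to M$ to $TA\to TM$ over $x$. A covariant differential operator over $x$ is an $\mathbb{R}$-linear map $D\colon\Gamma A\to\Gamma A$ with $D(fX)=fD(X)+x(f)X$ for $f\in C^\infty(M)$. The one corresponding to a linear vector field $(\eta,x)$ is the operator $D_\eta$ on $\Gamma A$ determined by $$\langle\varphi,D_\eta(X)\rangle=x(\langle\varphi,X\rangle)-\eta(\ell_\varphi)\circ X\qquad(\varphi\in\Gamma A^*,\ X\in\Gamma A),$$ where $\ell_\varphi\colon A\to\mathbb{R}$ is the fibrewise linear function defined by $\varphi$. **Theorem.** (1) The map $j_G$ is a bijection of $TAG$ onto $ATG$. Let $(\xi,x)$ be a multiplicative vector field on $G$, and let $A(\xi)=T(\xi)\circ\iota$. Then $A(\xi)$ takes values in $ATG$, and $\tilde\xi=j_G^{-1}\circ A(\xi)$ is a smooth vector field on $AG$ such that $(\tilde\xi,x)$ is linear. There is a unique operator $D_\xi\colon\Gamma AG\to\Gamma AG$ with $\overrightarrow{D_\xi(X)}=[\xi,\vec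 X]$ for all $X\in\Gamma AG$, and there is a unique operator $D_{\tilde\xi}\colon\Gamma AG\to\Gamma AG$ corresponding to $(\tilde\xi,x)$; it is a covariant differential operator over $x$, and $$D_{\tilde\xi}=D_\xi .$$ (2) Let $x$ be a smooth vector field on $M$, and let $M\times M\rightrightarrows M$ be the pair groupoid, with source the second projection and target the first. Then $(x\times x,x)$ is a multiplicative vector field on it. The anchor $a\colon A(M\times M)\to TM$ is a diffeomorphism, and it carries $\widetilde{x\times x}$ to a complete lift $\tilde x$ of $x$, that is, to a smooth vector field $\tilde x$ on $TM$ with $\tilde x(df)=d(x(f))$ for all $f\in C^\infty(M)$, where differentials are regarded as functions on $TM$. The pair $(\tilde x,x)$ is a linear vector field on $TM$, and the operator corresponding to it is the Lie derivative $y\mapsto[x,y]$. Moreover $a(D_{x\times x}(X))=[x,a(X)]$ for all $X\in\Gamma A(M\times M)$. -/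

import Mathlib

open Bundle Set Function VectorField Topology
open scoped Manifold ContDiff Topology

noncomputable section

/-! ### Vector fields, linear vector fields and covariant differential operators -/

section LinearVectorFields

variable
    {E : Type*} [NormedAddCommGroup E] [NormedSpace ℝ E]
    {H : Type*} [TopologicalSpace H] (I : ModelWithCorners ℝ E H)
    {M : Type*} [TopologicalSpace M] [ChartedSpace H M]

/-- A vector field on a manifold is smooth if it is smooth as a map to the tangent bundle. -/
def IsSmoothVectorField [IsManifold I ∞ M] (x : ∀ m : M, TangentSpace I m) : Prop :=
  ContMDiff I I.tangent ∞ (fun m ↦ (⟨m, x m⟩ : TangentBundle I M))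

/-- The derivative `x(f)` of a real function `f` along a vector field `x`. -/
def derivAlong (x : ∀ m : M, TangentSpace I m) (f : M → ℝ) (m : M) : ℝ :=
  mfderiv I 𝓘(ℝ, ℝ) f m (x m)

/-- The differential of a real function, as a function on the tangent bundle. -/
def differentialFun (f : M → ℝ) (v : TangentBundle I M) : ℝ :=
  mfderiv I 𝓘(ℝ, ℝ) f v.1 v.2

/-- The complete lift of a vector field `x` on `M` to the tangent bundle: the vector field `x'`
on `TM` with `x'(df) = d(x(f))` for all smooth functions `f` on `M`, where the differentials are
regarded as functions on `TM`. -/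
structure IsCompleteLift [IsManifold I ∞ M] (x : ∀ m : M, TangentSpace I m)
    (x' : ∀ v : TangentBundle I M, TangentSpace I.tangent v) : Prop where
  smooth : IsSmoothVectorField I.tangent x'
  lift : ∀ f : M → ℝ, ContMDiff I 𝓘(ℝ, ℝ) ∞ f → ∀ v : TangentBundle I M,
    derivAlong I.tangent x' (differentialFun I f) v = differentialFun I (derivAlong I x f) v

/-- The canonical involution of the double tangent bundle. In the coordinates on `TTM` that are
induced by a chart of `M` it is `(p, v; u, w) ↦ (p, u; v, w)`. A tangent vector of `TM` at
`⟨p, v⟩` is, in Mathlib, a pair `(u, w)` of coordinates with respect to the chart of `TM` induced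
by the preferred chart of `M` at `p`, and `v` is given by its coordinates in that same chart. -/
def canonicalInvolution [IsManifold I ∞ M] (Z : TangentBundle I.tangent (TangentBundle I M)) :
    TangentBundle I.tangent (TangentBundle I M) :=
  ⟨⟨Z.1.1, (show E × E from Z.2).1⟩, ((show E from Z.1.2), (show E × E from Z.2).2)⟩

variable
    {F : Type*} [NormedAddCommGroup F] [NormedSpace ℝ F]
    {V : M → Type*} [∀ m, AddCommGroup (V m)] [∀ m, Module ℝ (V m)]
    [∀ m, TopologicalSpace (V m)] [TopologicalSpace (TotalSpace F V)]
    [FiberBundle F V] [VectorBundle ℝ F V]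

/-- A linear vector field on a vector bundle `V → M`: a pair of smooth vector fields `ξ` on the
total space and `x` on `M` such that `ξ` is a morphism of vector bundles from `V → M` to
`TV → TM` over `x`. The addition of `TV → TM` is the tangent map of the addition
`V ⊕ V → V`, and likewise for scalar multiplication. -/
structure IsLinearVectorField [IsManifold I ∞ M] [ContMDiffVectorBundle ∞ F V I]
    (ξ : ∀ a : TotalSpace F V, TangentSpace (I.prod 𝓘(ℝ, F)) a)
    (x : ∀ m : M, TangentSpace I m) : Prop where
  smooth : IsSmoothVectorField (I.prod 𝓘(ℝ, F)) ξ
  smooth_base : IsSmoothVectorField I x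
  proj : ∀ a : TotalSpace F V, mfderiv (I.prod 𝓘(ℝ, F)) I (π F V) a (ξ a) = x a.proj
  add : ∀ (m : M) (X Y : V m),
    ∃ W : TangentSpace (I.prod 𝓘(ℝ, F × F)) (⟨m, (X, Y)⟩ : TotalSpace (F × F) (V ×ᵇ V)),
      mfderiv (I.prod 𝓘(ℝ, F × F)) (I.prod 𝓘(ℝ, F))
        (fun a : TotalSpace (F × F) (V ×ᵇ V) ↦ (⟨a.1, a.2.1⟩ : TotalSpace F V)) ⟨m, (X, Y)⟩ W =
          ξ ⟨m, X⟩ ∧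
      mfderiv (I.prod 𝓘(ℝ, F × F)) (I.prod 𝓘(ℝ, F))
        (fun a : TotalSpace (F × F) (V ×ᵇ V) ↦ (⟨a.1, a.2.2⟩ : TotalSpace F V)) ⟨m, (X, Y)⟩ W =
          ξ ⟨m, Y⟩ ∧
      mfderiv (I.prod 𝓘(ℝ, F × F)) (I.prod 𝓘(ℝ, F))
        (fun a : TotalSpace (F × F) (V ×ᵇ V) ↦ (⟨a.1, a.2.1 + a.2.2⟩ : TotalSpace F V))
        ⟨m, (X, Y)⟩ W = ξ ⟨m, X + Y⟩
  smul : ∀ (t : ℝ) (m : M) (X : V m),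
    mfderiv (I.prod 𝓘(ℝ, F)) (I.prod 𝓘(ℝ, F))
      (fun a : TotalSpace F V ↦ (⟨a.1, t • a.2⟩ : TotalSpace F V)) ⟨m, X⟩ (ξ ⟨m, X⟩) =
        ξ ⟨m, t • X⟩

/-- A covariant differential operator on `V` over the vector field `x`: an `ℝ`-linear operator on
smooth sections with `D(fX) = f D(X) + x(f) X`. -/
structure IsCovariantDifferentialOperator (x : ∀ m : M, TangentSpace I m)
    (D : Cₛ^∞⟮I; F, V⟯ → Cₛ^∞⟮I; F, V⟯) : Prop where
  add : ∀ X Y, D (X + Y) = D X + D Y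
  smul : ∀ (t : ℝ) X, D (t • X) = t • D X
  leibniz : ∀ f : M → ℝ, ContMDiff I 𝓘(ℝ, ℝ) ∞ f → ∀ X Y : Cₛ^∞⟮I; F, V⟯,
    (∀ m, Y m = f m • X m) → ∀ m, D Y m = f m • D X m + derivAlong I x f m • X m

/-- The fibrewise linear function on the total space determined by a section of the dual. -/
def fibrewiseLinear (φ : ∀ m : M, V m →L[ℝ] Trivial M ℝ m) (a : TotalSpace F V) : ℝ :=
  φ a.1 a.2

/-- `D` is the operator on sections of `V` corresponding to the linear vector field `(ξ, x)`:
`⟨φ, D X⟩ = x⟨φ, X⟩ - ξ(ℓ_φ) ∘ X` for all smooth sections `X` of `V` and `φ` of its dual. -/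
def IsOperatorOf [∀ m, IsTopologicalAddGroup (V m)] [∀ m, ContinuousSMul ℝ (V m)]
    (ξ : ∀ a : TotalSpace F V, TangentSpace (I.prod 𝓘(ℝ, F)) a)
    (x : ∀ m : M, TangentSpace I m) (D : Cₛ^∞⟮I; F, V⟯ → Cₛ^∞⟮I; F, V⟯) : Prop :=
  ∀ (φ : Cₛ^∞⟮I; F →L[ℝ] ℝ, fun m ↦ V m →L[ℝ] Trivial M ℝ m⟯) (X : Cₛ^∞⟮I; F, V⟯) (m : M),
    (φ m (D X m) : ℝ) = derivAlong I x (fun m' ↦ φ m' (X m')) m -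
      derivAlong (I.prod 𝓘(ℝ, F)) ξ (fibrewiseLinear φ) ⟨m, X m⟩

end LinearVectorFields

/-- A Lie groupoid `G ⇉ M`. The product `mul g h` is meaningful only if `src g = tgt h`; its values
on other pairs are arbitrary and play no role. The composable pairs form an embedded submanifold of
`G × G`, and `ContMDiffOn` on that set expresses smoothness of the multiplication on it. -/
structure LieGroupoid
    {EG : Type*} [NormedAddCommGroup EG] [NormedSpace ℝ EG]
    {HG : Type*} [TopologicalSpace HG] (IG : ModelWithCorners ℝ EG HG)
    (G : Type*) [TopologicalSpace G] [ChartedSpace HG G]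
    {EM : Type*} [NormedAddCommGroup EM] [NormedSpace ℝ EM]
    {HM : Type*} [TopologicalSpace HM] (IM : ModelWithCorners ℝ EM HM)
    (M : Type*) [TopologicalSpace M] [ChartedSpace HM M] where
  src : G → M
  tgt : G → M
  one : M → G
  inv : G → G
  mul : G → G → G
  src_one : ∀ m, src (one m) = m
  tgt_one : ∀ m, tgt (one m) = m
  src_mul : ∀ g h, src g = tgt h → src (mul g h) = src h
  tgt_mul : ∀ g h, src g = tgt h → tgt (mul g h) = tgt g
  mul_assoc : ∀ g h k, src g = tgt h → src h = tgt k → mul (mul g h) k = mul g (mul h k)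
  one_mul : ∀ g, mul (one (tgt g)) g = g
  mul_one : ∀ g, mul g (one (src g)) = g
  src_inv : ∀ g, src (inv g) = tgt g
  tgt_inv : ∀ g, tgt (inv g) = src g
  inv_mul : ∀ g, mul (inv g) g = one (src g)
  mul_inv : ∀ g, mul g (inv g) = one (tgt g)
  contMDiff_src : ContMDiff IG IM ∞ src
  contMDiff_tgt : ContMDiff IG IM ∞ tgt
  contMDiff_one : ContMDiff IM IG ∞ one
  contMDiff_inv : ContMDiff IG IG ∞ inv
  src_submersion : ∀ g, Surjective (mfderiv IG IM src g)
  tgt_submersion : ∀ g, Surjective (mfderiv IG IM tgt g)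
  contMDiffOn_mul :
    ContMDiffOn (IG.prod IG) IG ∞ (fun p : G × G ↦ mul p.1 p.2) {p | src p.1 = tgt p.2}


namespace LieGroupoid

/-- A family of linear maps out of a finite-dimensional space is smooth if it is pointwise. -/
theorem contMDiffOn_clm_of_apply
    {E : Type*} [NormedAddCommGroup E] [NormedSpace ℝ E]
    {H : Type*} [TopologicalSpace H] {I : ModelWithCorners ℝ E H}
    {N : Type*} [TopologicalSpace N] [ChartedSpace H N]
    {V : Type*} [NormedAddCommGroup V] [NormedSpace ℝ V] [FiniteDimensional ℝ V]
    {W : Type*} [NormedAddCommGroup W] [NormedSpace ℝ W]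
    {f : N → V →L[ℝ] W} {s : Set N}
    (h : ∀ v, ContMDiffOn I 𝓘(ℝ, W) ∞ (fun x ↦ f x v) s) :
    ContMDiffOn I 𝓘(ℝ, V →L[ℝ] W) ∞ f s := by
  classical
  let b := Module.finBasis ℝ V
  have key : f = fun x ↦ ∑ i, ContinuousLinearMap.smulRightL ℝ V W
      (LinearMap.toContinuousLinearMap (b.coord i)) (f x (b i)) := by
    funext x
    ext v
    conv_lhs => rw [← b.sum_repr v, map_sum]
    simp
  rw [key]
  refine contMDiffOn_finsetSum fun i _ ↦ ?_
  exact (ContinuousLinearMap.contMDiff _).comp_contMDiffOn (h (b i))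

section Algebroid

variable
    {EG : Type*} [NormedAddCommGroup EG] [NormedSpace ℝ EG]
    {HG : Type*} [TopologicalSpace HG] {IG : ModelWithCorners ℝ EG HG}
    {G : Type*} [TopologicalSpace G] [ChartedSpace HG G]
    {EM : Type*} [NormedAddCommGroup EM] [NormedSpace ℝ EM]
    {HM : Type*} [TopologicalSpace HM] {IM : ModelWithCorners ℝ EM HM}
    {M : Type*} [TopologicalSpace M] [ChartedSpace HM M]
    (𝒢 : LieGroupoid IG G IM M)

/-- The fibre over `m` of the Lie algebroid: the tangent space at `1_m` of the source fibre. -/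
def Algebroid (m : M) : Type _ :=
  ↥(LinearMap.ker (mfderiv IG IM 𝒢.src (𝒢.one m)).toLinearMap)

instance (m : M) : AddCommGroup (𝒢.Algebroid m) :=
  inferInstanceAs (AddCommGroup ↥(LinearMap.ker (mfderiv IG IM 𝒢.src (𝒢.one m)).toLinearMap))

instance (m : M) : Module ℝ (𝒢.Algebroid m) :=
  inferInstanceAs (Module ℝ ↥(LinearMap.ker (mfderiv IG IM 𝒢.src (𝒢.one m)).toLinearMap))

instance (m : M) : TopologicalSpace (𝒢.Algebroid m) :=
  inferInstanceAs
    (TopologicalSpace ↥(LinearMap.ker (mfderiv IG IM 𝒢.src (𝒢.one m)).toLinearMap))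

instance (m : M) : IsTopologicalAddGroup (𝒢.Algebroid m) :=
  inferInstanceAs
    (IsTopologicalAddGroup ↥(LinearMap.ker (mfderiv IG IM 𝒢.src (𝒢.one m)).toLinearMap))

instance (m : M) : ContinuousSMul ℝ (𝒢.Algebroid m) :=
  inferInstanceAs
    (ContinuousSMul ℝ ↥(LinearMap.ker (mfderiv IG IM 𝒢.src (𝒢.one m)).toLinearMap))

/-- The inclusion of a fibre of the Lie algebroid into the tangent space of `G`. -/
def incl (m : M) : 𝒢.Algebroid m →L[ℝ] TangentSpace IG (𝒢.one m) :=
  (LinearMap.ker (mfderiv IG IM 𝒢.src (𝒢.one m)).toLinearMap).subtypeL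

theorem incl_injective (m : M) : Injective (𝒢.incl m) := Subtype.val_injective

/-- A tangent vector at `1_m` that is killed by the source derivative, as an element of the Lie
algebroid. -/
def mkAlgebroid (m : M) (v : TangentSpace IG (𝒢.one m))
    (hv : mfderiv IG IM 𝒢.src (𝒢.one m) v = 0) : 𝒢.Algebroid m :=
  Subtype.mk v hv

theorem incl_mkAlgebroid (m : M) (v : TangentSpace IG (𝒢.one m))
    (hv : mfderiv IG IM 𝒢.src (𝒢.one m) v = 0) : 𝒢.incl m (𝒢.mkAlgebroid m v hv) = v := rfl

theorem mfderiv_src_incl (m : M) (a : 𝒢.Algebroid m) :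
    mfderiv IG IM 𝒢.src (𝒢.one m) (𝒢.incl m a) = 0 := a.2

variable (EG EM) in
/-- The model fibre of the Lie algebroid. -/
abbrev AlgebroidModel : Type :=
  Fin (Module.finrank ℝ EG - Module.finrank ℝ EM) → ℝ

variable [IsManifold IG ∞ G] [IsManifold IM ∞ M]
  [FiniteDimensional ℝ EG] [FiniteDimensional ℝ EM]

/-- The tangent map of the source projection along the identities, in the trivializations of the
tangent bundles determined by the point `m₀`. -/
def srcCoord (m₀ m : M) : EG →L[ℝ] EM :=
  ((trivializationAt EM (TangentSpace IM) (𝒢.src (𝒢.one m₀))).continuousLinearMapAt ℝ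
      (𝒢.src (𝒢.one m))) ∘L (mfderiv IG IM 𝒢.src (𝒢.one m)) ∘L
    ((trivializationAt EG (TangentSpace IG) (𝒢.one m₀)).symmL ℝ (𝒢.one m))

/-- The points over which the trivializations in `srcCoord` are defined. -/
def coordDomain (m₀ : M) : Set M :=
  𝒢.one ⁻¹' (trivializationAt EG (TangentSpace IG) (𝒢.one m₀)).baseSet ∩
    (fun m ↦ 𝒢.src (𝒢.one m)) ⁻¹'
      (trivializationAt EM (TangentSpace IM) (𝒢.src (𝒢.one m₀))).baseSet

theorem isOpen_coordDomain (m₀ : M) : IsOpen (𝒢.coordDomain m₀) :=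
  ((trivializationAt EG (TangentSpace IG) (𝒢.one m₀)).open_baseSet.preimage
    𝒢.contMDiff_one.continuous).inter
  ((trivializationAt EM (TangentSpace IM) (𝒢.src (𝒢.one m₀))).open_baseSet.preimage
    (𝒢.contMDiff_src.continuous.comp 𝒢.contMDiff_one.continuous))

theorem mem_coordDomain (m₀ : M) : m₀ ∈ 𝒢.coordDomain m₀ :=
  ⟨mem_baseSet_trivializationAt EG (TangentSpace IG) (𝒢.one m₀),
    mem_baseSet_trivializationAt EM (TangentSpace IM) (𝒢.src (𝒢.one m₀))⟩

theorem contMDiffOn_srcCoord (m₀ : M) :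
    ContMDiffOn IM 𝓘(ℝ, EG →L[ℝ] EM) ∞ (𝒢.srcCoord m₀) (𝒢.coordDomain m₀) := by
  refine contMDiffOn_clm_of_apply fun v ↦ ?_
  set e := trivializationAt EG (TangentSpace IG) (𝒢.one m₀) with he
  set e' := trivializationAt EM (TangentSpace IM) (𝒢.src (𝒢.one m₀)) with he'
  have h1 : ContMDiffOn IM (IG.prod 𝓘(ℝ, EG)) ∞ (fun m ↦ (𝒢.one m, v)) (𝒢.coordDomain m₀) :=
    (𝒢.contMDiff_one.prodMk contMDiff_const).contMDiffOn
  have h2 : ContMDiffOn IM (IG.prod 𝓘(ℝ, EG)) ∞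
      (fun m ↦ e.toOpenPartialHomeomorph.symm (𝒢.one m, v)) (𝒢.coordDomain m₀) := by
    refine (e.contMDiffOn_symm (IB := IG) (n := ∞)).comp h1 ?_
    intro m hm
    exact e.mem_target.2 hm.1
  have h3 := (𝒢.contMDiff_src.contMDiff_tangentMap (m := ∞) (by simp)).comp_contMDiffOn h2
  have h4 := (e'.contMDiffOn (IB := IM) (n := ∞)).comp h3 (by
    intro m hm
    rw [mem_preimage, e'.mem_source]
    have : (e.toOpenPartialHomeomorph.symm (𝒢.one m, v)).proj = 𝒢.one m :=
      e.proj_symm_apply' hm.1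
    change 𝒢.src (e.toOpenPartialHomeomorph.symm (𝒢.one m, v)).proj ∈ _
    rw [this]
    exact hm.2)
  have h5 := contMDiff_snd.comp_contMDiffOn h4
  refine h5.congr fun m hm ↦ ?_
  simp only [srcCoord, comp_apply, ContinuousLinearMap.comp_apply]
  rw [← e.mk_symm hm.1 v]
  rw [Trivialization.symmL_apply (R := ℝ) _ hm.1]
  exact Trivialization.continuousLinearMapAt_apply_of_mem ℝ e' hm.2
    (mfderiv IG IM 𝒢.src (𝒢.one m) (e.symm (𝒢.one m) v))

/-- Linear algebra: a surjection between finite-dimensional spaces can be completed to an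
isomorphism by a map to the model fibre. -/
theorem exists_completion (L : EG →L[ℝ] EM) (hL : Surjective L) :
    ∃ Q : EG →L[ℝ] AlgebroidModel EG EM, (L.prod Q).IsInvertible := by
  obtain ⟨K, hK⟩ := Submodule.exists_isCompl (LinearMap.ker L.toLinearMap)
  have hr : Module.finrank ℝ (LinearMap.ker L.toLinearMap) =
      Module.finrank ℝ (AlgebroidModel EG EM) := by
    have h1 := LinearMap.finrank_range_add_finrank_ker L.toLinearMap
    rw [LinearMap.range_eq_top.2 hL, finrank_top] at h1
    simp only [AlgebroidModel, Module.finrank_fin_fun]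
    omega
  let ε := LinearEquiv.ofFinrankEq _ _ hr
  let q : EG →ₗ[ℝ] AlgebroidModel EG EM :=
    ε.toLinearMap ∘ₗ (LinearMap.ker L.toLinearMap).projectionOnto K hK
  refine ⟨LinearMap.toContinuousLinearMap q, ?_⟩
  set T : EG →L[ℝ] EM × AlgebroidModel EG EM := L.prod (LinearMap.toContinuousLinearMap q) with hT
  have hinj : Injective T := by
    rw [injective_iff_map_eq_zero]
    intro v hv
    have hv1 : L v = 0 := congrArg Prod.fst hv
    have hv2 : ε ((LinearMap.ker L.toLinearMap).projectionOnto K hK v) = 0 := congrArg Prod.snd hv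
    have hv3 := ε.map_eq_zero_iff.1 hv2
    have := Submodule.projectionOnto_apply_left hK (⟨v, hv1⟩ : LinearMap.ker L.toLinearMap)
    rw [hv3] at this
    exact (congrArg Subtype.val this).symm
  have hfr : Module.finrank ℝ EG = Module.finrank ℝ (EM × AlgebroidModel EG EM) := by
    have h1 := LinearMap.finrank_range_add_finrank_ker L.toLinearMap
    rw [LinearMap.range_eq_top.2 hL, finrank_top] at h1
    rw [Module.finrank_prod, ← hr]
    omega
  refine ⟨(LinearEquiv.ofInjectiveOfFinrankEq T.toLinearMap hinj hfr).toContinuousLinearEquiv, ?_⟩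
  ext v <;> rfl

theorem surjective_srcCoord (m₀ : M) : Surjective (𝒢.srcCoord m₀ m₀) := by
  have h := 𝒢.mem_coordDomain m₀
  intro w
  obtain ⟨u, hu⟩ := 𝒢.src_submersion (𝒢.one m₀)
    ((trivializationAt EM (TangentSpace IM) (𝒢.src (𝒢.one m₀))).symmL ℝ (𝒢.src (𝒢.one m₀)) w)
  refine ⟨(trivializationAt EG (TangentSpace IG) (𝒢.one m₀)).continuousLinearMapAt ℝ
    (𝒢.one m₀) u, ?_⟩
  simp only [srcCoord, ContinuousLinearMap.comp_apply]
  rw [Trivialization.symmL_continuousLinearMapAt _ h.1, hu,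
    Trivialization.continuousLinearMapAt_symmL _ h.2]

/-- A chosen complementary coordinate map at `m₀`. -/
def fibreCoord (m₀ : M) : EG →L[ℝ] AlgebroidModel EG EM :=
  Classical.choose (exists_completion _ (𝒢.surjective_srcCoord m₀))

/-- The source derivative together with the fibre coordinate. -/
def frame (m₀ m : M) : EG →L[ℝ] EM × AlgebroidModel EG EM :=
  (𝒢.srcCoord m₀ m).prod (𝒢.fibreCoord m₀)

/-- The domain of the local trivialization of the Lie algebroid around `m₀`. -/
def trivDomain (m₀ : M) : Set M :=
  𝒢.coordDomain m₀ ∩ {m | (𝒢.frame m₀ m).IsInvertible}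

theorem mem_trivDomain (m₀ : M) : m₀ ∈ 𝒢.trivDomain m₀ :=
  ⟨𝒢.mem_coordDomain m₀,
    Classical.choose_spec (exists_completion _ (𝒢.surjective_srcCoord m₀))⟩

theorem contMDiffOn_frame (m₀ : M) :
    ContMDiffOn IM 𝓘(ℝ, EG →L[ℝ] EM × AlgebroidModel EG EM) ∞ (𝒢.frame m₀)
      (𝒢.coordDomain m₀) := by
  refine contMDiffOn_clm_of_apply fun v ↦ ?_
  exact ((𝒢.contMDiffOn_srcCoord m₀).clm_apply contMDiffOn_const).prodMk_space contMDiffOn_const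

theorem isOpen_trivDomain (m₀ : M) : IsOpen (𝒢.trivDomain m₀) := by
  have : 𝒢.trivDomain m₀ = 𝒢.coordDomain m₀ ∩ 𝒢.frame m₀ ⁻¹'
      range ContinuousLinearEquiv.toContinuousLinearMap := rfl
  rw [this]
  exact (𝒢.contMDiffOn_frame m₀).continuousOn.isOpen_inter_preimage
    (𝒢.isOpen_coordDomain m₀) ContinuousLinearEquiv.isOpen

/-- The vector of `T_{1_m}G` with fibre coordinate `f` and source derivative zero. -/
def fromFibreAux (m₀ m : M) (f : AlgebroidModel EG EM) : TangentSpace IG (𝒢.one m) :=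
  (trivializationAt EG (TangentSpace IG) (𝒢.one m₀)).symmL ℝ (𝒢.one m)
    ((𝒢.frame m₀ m).inverse (0, f))

theorem frame_inverse {m₀ m : M} (hm : m ∈ 𝒢.trivDomain m₀)
    (p : EM × AlgebroidModel EG EM) : 𝒢.frame m₀ m ((𝒢.frame m₀ m).inverse p) = p := by
  obtain ⟨T, hT⟩ := hm.2
  rw [← hT]
  simp

theorem inverse_frame {m₀ m : M} (hm : m ∈ 𝒢.trivDomain m₀) (v : EG) :
    (𝒢.frame m₀ m).inverse (𝒢.frame m₀ m v) = v := by
  obtain ⟨T, hT⟩ := hm.2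
  rw [← hT]
  simp

theorem mfderiv_src_fromFibreAux {m₀ m : M} (hm : m ∈ 𝒢.trivDomain m₀)
    (f : AlgebroidModel EG EM) :
    mfderiv IG IM 𝒢.src (𝒢.one m) (𝒢.fromFibreAux m₀ m f) = 0 := by
  have h : 𝒢.srcCoord m₀ m ((𝒢.frame m₀ m).inverse (0, f)) = 0 :=
    congrArg Prod.fst (𝒢.frame_inverse hm (0, f))
  rw [← Trivialization.symmL_continuousLinearMapAt
    (trivializationAt EM (TangentSpace IM) (𝒢.src (𝒢.one m₀))) (R := ℝ) hm.1.2
    (mfderiv IG IM 𝒢.src (𝒢.one m) (𝒢.fromFibreAux m₀ m f))]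
  have h' : (trivializationAt EM (TangentSpace IM) (𝒢.src (𝒢.one m₀))).continuousLinearMapAt ℝ
      (𝒢.src (𝒢.one m)) (mfderiv IG IM 𝒢.src (𝒢.one m) (𝒢.fromFibreAux m₀ m f)) = 0 := h
  rw [h', map_zero]

/-- The fibre coordinate on the Lie algebroid, as a linear map on each fibre. -/
def toFibre (m₀ m : M) : 𝒢.Algebroid m →L[ℝ] AlgebroidModel EG EM :=
  𝒢.fibreCoord m₀ ∘L (trivializationAt EG (TangentSpace IG) (𝒢.one m₀)).continuousLinearMapAt ℝ
    (𝒢.one m) ∘L 𝒢.incl m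

open Classical in
/-- The inverse of `toFibre`. -/
def fromFibre (m₀ m : M) (f : AlgebroidModel EG EM) : 𝒢.Algebroid m :=
  if hm : m ∈ 𝒢.trivDomain m₀ then
    𝒢.mkAlgebroid m (𝒢.fromFibreAux m₀ m f) (𝒢.mfderiv_src_fromFibreAux hm f)
  else 0

theorem incl_fromFibre {m₀ m : M} (hm : m ∈ 𝒢.trivDomain m₀) (f : AlgebroidModel EG EM) :
    𝒢.incl m (𝒢.fromFibre m₀ m f) = 𝒢.fromFibreAux m₀ m f := by
  rw [fromFibre, dif_pos hm]
  rfl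

theorem toFibre_fromFibre {m₀ m : M} (hm : m ∈ 𝒢.trivDomain m₀) (f : AlgebroidModel EG EM) :
    𝒢.toFibre m₀ m (𝒢.fromFibre m₀ m f) = f := by
  simp only [toFibre, ContinuousLinearMap.comp_apply]
  rw [𝒢.incl_fromFibre hm, fromFibreAux, Trivialization.continuousLinearMapAt_symmL _ hm.1.1]
  exact congrArg Prod.snd (𝒢.frame_inverse hm (0, f))

theorem fromFibre_toFibre {m₀ m : M} (hm : m ∈ 𝒢.trivDomain m₀) (a : 𝒢.Algebroid m) :
    𝒢.fromFibre m₀ m (𝒢.toFibre m₀ m a) = a := by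
  apply 𝒢.incl_injective
  rw [𝒢.incl_fromFibre hm, fromFibreAux]
  have h : 𝒢.frame m₀ m ((trivializationAt EG (TangentSpace IG) (𝒢.one m₀)).continuousLinearMapAt ℝ
      (𝒢.one m) (𝒢.incl m a)) = (0, 𝒢.toFibre m₀ m a) := by
    refine Prod.ext ?_ rfl
    change 𝒢.srcCoord m₀ m _ = 0
    simp only [srcCoord, ContinuousLinearMap.comp_apply]
    rw [Trivialization.symmL_continuousLinearMapAt _ hm.1.1, mfderiv_src_incl, map_zero]
  rw [← h, 𝒢.inverse_frame hm, Trivialization.symmL_continuousLinearMapAt _ hm.1.1]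

/-- The local trivialization of the Lie algebroid around `m₀`. -/
def preTriv (m₀ : M) :
    Pretrivialization (AlgebroidModel EG EM) (π (AlgebroidModel EG EM) 𝒢.Algebroid) where
  toFun a := (a.1, 𝒢.toFibre m₀ a.1 a.2)
  invFun p := ⟨p.1, 𝒢.fromFibre m₀ p.1 p.2⟩
  source := π (AlgebroidModel EG EM) 𝒢.Algebroid ⁻¹' 𝒢.trivDomain m₀
  target := 𝒢.trivDomain m₀ ×ˢ univ
  map_source' _ ha := ⟨ha, mem_univ _⟩
  map_target' _ hp := hp.1
  left_inv' a ha := by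
    change (⟨a.1, _⟩ : TotalSpace (AlgebroidModel EG EM) 𝒢.Algebroid) = a
    rw [𝒢.fromFibre_toFibre ha]
  right_inv' p hp := Prod.ext rfl (𝒢.toFibre_fromFibre hp.1 p.2)
  open_target := (𝒢.isOpen_trivDomain m₀).prod isOpen_univ
  baseSet := 𝒢.trivDomain m₀
  open_baseSet := 𝒢.isOpen_trivDomain m₀
  source_eq := rfl
  target_eq := rfl
  proj_toFun _ _ := rfl

theorem preTriv_symm {m₀ m : M} (hm : m ∈ 𝒢.trivDomain m₀) (f : AlgebroidModel EG EM) :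
    (𝒢.preTriv m₀).symm m f = 𝒢.fromFibre m₀ m f :=
  (𝒢.preTriv m₀).symm_apply hm f

theorem exists_coordChange (m₀ m₁ : M) :
    ∃ c : M → AlgebroidModel EG EM →L[ℝ] AlgebroidModel EG EM,
      ContMDiffOn IM 𝓘(ℝ, AlgebroidModel EG EM →L[ℝ] AlgebroidModel EG EM) ∞ c
        (𝒢.trivDomain m₀ ∩ 𝒢.trivDomain m₁) ∧
      ∀ m ∈ 𝒢.trivDomain m₀ ∩ 𝒢.trivDomain m₁, ∀ f,
        c m f = (𝒢.preTriv m₁ ⟨m, (𝒢.preTriv m₀).symm m f⟩).2 := by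
  set e₀ := trivializationAt EG (TangentSpace IG) (𝒢.one m₀)
  set e₁ := trivializationAt EG (TangentSpace IG) (𝒢.one m₁)
  refine ⟨fun m ↦ 𝒢.fibreCoord m₁ ∘L (e₀.coordChangeL ℝ e₁ (𝒢.one m) : EG →L[ℝ] EG) ∘L
    (𝒢.frame m₀ m).inverse ∘L ContinuousLinearMap.inr ℝ EM (AlgebroidModel EG EM), ?_, ?_⟩
  · have h1 : ContMDiffOn IM 𝓘(ℝ, EG →L[ℝ] EG) ∞
        (fun m ↦ (e₀.coordChangeL ℝ e₁ (𝒢.one m) : EG →L[ℝ] EG))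
        (𝒢.trivDomain m₀ ∩ 𝒢.trivDomain m₁) :=
      (contMDiffOn_coordChangeL (IB := IG) (n := ∞) e₀ e₁).comp
        𝒢.contMDiff_one.contMDiffOn fun m hm ↦ ⟨hm.1.1.1, hm.2.1.1⟩
    have h2 : ContMDiffOn IM 𝓘(ℝ, EM × AlgebroidModel EG EM →L[ℝ] EG) ∞
        (fun m ↦ (𝒢.frame m₀ m).inverse) (𝒢.trivDomain m₀ ∩ 𝒢.trivDomain m₁) := by
      intro m hm
      have hi : ContDiffAt ℝ ∞ ContinuousLinearMap.inverse (𝒢.frame m₀ m) :=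
        ContinuousLinearMap.IsInvertible.contDiffAt_map_inverse hm.1.2
      exact hi.contMDiffAt.comp_contMDiffWithinAt m
        (((𝒢.contMDiffOn_frame m₀) m hm.1.1).mono fun x hx ↦ hx.1.1)
    exact contMDiffOn_const.clm_comp (h1.clm_comp (h2.clm_comp contMDiffOn_const))
  · intro m hm f
    rw [𝒢.preTriv_symm hm.1]
    change _ = 𝒢.toFibre m₁ m (𝒢.fromFibre m₀ m f)
    simp only [toFibre, ContinuousLinearMap.comp_apply]
    rw [𝒢.incl_fromFibre hm.1, fromFibreAux]
    rw [Trivialization.symmL_apply (R := ℝ) _ hm.1.1.1,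
      Trivialization.continuousLinearMapAt_apply_of_mem ℝ _ hm.2.1.1]
    congr 1
    exact Trivialization.coordChangeL_apply e₀ e₁ (R := ℝ) ⟨hm.1.1.1, hm.2.1.1⟩ _

/-- The local trivializations assemble to a vector bundle. -/
def preBundle : VectorPrebundle ℝ (AlgebroidModel EG EM) 𝒢.Algebroid where
  pretrivializationAtlas := range 𝒢.preTriv
  pretrivialization_linear' := by
    rintro _ ⟨m₀, rfl⟩
    exact ⟨fun m _ ↦ ⟨fun a b ↦ map_add (𝒢.toFibre m₀ m) a b,
      fun c a ↦ map_smul (𝒢.toFibre m₀ m) c a⟩⟩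
  pretrivializationAt := 𝒢.preTriv
  mem_base_pretrivializationAt := 𝒢.mem_trivDomain
  pretrivialization_mem_atlas m := mem_range_self m
  exists_coordChange := by
    rintro _ ⟨m₀, rfl⟩ _ ⟨m₁, rfl⟩
    obtain ⟨c, hc, h⟩ := 𝒢.exists_coordChange m₀ m₁
    exact ⟨c, hc.continuousOn, h⟩
  totalSpaceMk_isInducing m := by
    have h := 𝒢.mem_trivDomain m
    have hinv : Continuous (𝒢.fromFibre m m) := by
      refine (IsInducing.subtypeVal.continuous_iff (f := 𝒢.fromFibre m m)).2 ?_
      have : Continuous (𝒢.fromFibreAux m m) := by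
        unfold fromFibreAux
        fun_prop
      exact this.congr fun f ↦ (𝒢.incl_fromFibre h f).symm
    let Φ : 𝒢.Algebroid m ≃ₜ AlgebroidModel EG EM :=
      { toFun := 𝒢.toFibre m m
        invFun := 𝒢.fromFibre m m
        left_inv := 𝒢.fromFibre_toFibre h
        right_inv := 𝒢.toFibre_fromFibre h
        continuous_toFun := (𝒢.toFibre m m).continuous
        continuous_invFun := hinv }
    exact (isEmbedding_prodMkRight m).isInducing.comp Φ.isInducing

instance : TopologicalSpace (TotalSpace (AlgebroidModel EG EM) 𝒢.Algebroid) :=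
  𝒢.preBundle.totalSpaceTopology

instance : FiberBundle (AlgebroidModel EG EM) 𝒢.Algebroid := 𝒢.preBundle.toFiberBundle

instance : VectorBundle ℝ (AlgebroidModel EG EM) 𝒢.Algebroid := 𝒢.preBundle.toVectorBundle

instance : 𝒢.preBundle.IsContMDiff IM ∞ where
  exists_contMDiffCoordChange := by
    rintro _ ⟨m₀, rfl⟩ _ ⟨m₁, rfl⟩
    exact 𝒢.exists_coordChange m₀ m₁

instance : ContMDiffVectorBundle ∞ (AlgebroidModel EG EM) 𝒢.Algebroid IM :=
  𝒢.preBundle.contMDiffVectorBundle IM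

/-- The inclusion of the total space of the Lie algebroid into `TG`. -/
def totalIncl (a : TotalSpace (AlgebroidModel EG EM) 𝒢.Algebroid) : TangentBundle IG G :=
  ⟨𝒢.one a.1, 𝒢.incl a.1 a.2⟩

/-- The Lie algebroid of the tangent groupoid `TG ⇉ TM`, as a subset of `TTG`: the tangent
vectors at the identities `T(1)(u)` of `TG` that are killed by the derivative of the source
projection `T(src)` of `TG`. -/
def tangentAlgebroid : Set (TangentBundle IG.tangent (TangentBundle IG G)) :=
  {Z | (∃ u : TangentBundle IM M, Z.1 = tangentMap IM IG 𝒢.one u) ∧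
    mfderiv IG.tangent IM.tangent (tangentMap IG IM 𝒢.src) Z.1 Z.2 = 0}

/-- The canonical map `j` from the tangent bundle of the Lie algebroid `AG` to the Lie algebroid
of `TG`: the restriction of the canonical involution of `TTG`. -/
def jMap (w : TangentBundle (IM.prod 𝓘(ℝ, AlgebroidModel EG EM))
      (TotalSpace (AlgebroidModel EG EM) 𝒢.Algebroid)) :
    TangentBundle IG.tangent (TangentBundle IG G) :=
  canonicalInvolution IG
    (tangentMap (IM.prod 𝓘(ℝ, AlgebroidModel EG EM)) IG.tangent 𝒢.totalIncl w)

/-- A multiplicative vector field `(ξ, x)` on a Lie groupoid: smooth vector fields on `G` and `M`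
such that `ξ : G → TG` is a morphism of groupoids over `x : M → TM`. The structure maps of `TG`
are the tangent maps of those of `G`; the product of `ξ g` and `ξ h` is the derivative of the
multiplication along the tangent vector `(ξ g, ξ h)` of the submanifold of composable pairs. -/
structure IsMultiplicative (ξ : ∀ g : G, TangentSpace IG g) (x : ∀ m : M, TangentSpace IM m) :
    Prop where
  smooth : IsSmoothVectorField IG ξ
  smooth_base : IsSmoothVectorField IM x
  src : ∀ g, mfderiv IG IM 𝒢.src g (ξ g) = x (𝒢.src g)
  tgt : ∀ g, mfderiv IG IM 𝒢.tgt g (ξ g) = x (𝒢.tgt g)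
  one : ∀ m, mfderiv IM IG 𝒢.one m (x m) = ξ (𝒢.one m)
  mul : ∀ g h, 𝒢.src g = 𝒢.tgt h →
    mfderivWithin (IG.prod IG) IG (fun p : G × G ↦ 𝒢.mul p.1 p.2)
      {p | 𝒢.src p.1 = 𝒢.tgt p.2} (g, h) (ξ g, ξ h) = ξ (𝒢.mul g h)

/-- The Lie functor applied to `ξ : G → TG`: the restriction of `T(ξ)` to `AG`. -/
def lieFunctor (ξ : ∀ g : G, TangentSpace IG g)
    (a : TotalSpace (AlgebroidModel EG EM) 𝒢.Algebroid) :
    TangentBundle IG.tangent (TangentBundle IG G) :=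
  tangentMap IG IG.tangent (fun g ↦ (⟨g, ξ g⟩ : TangentBundle IG G)) (𝒢.totalIncl a)

/-- `ξ'` is the vector field `j⁻¹ ∘ A(ξ)` on the Lie algebroid. -/
def IsLieLift (ξ : ∀ g : G, TangentSpace IG g)
    (ξ' : ∀ a : TotalSpace (AlgebroidModel EG EM) 𝒢.Algebroid,
      TangentSpace (IM.prod 𝓘(ℝ, AlgebroidModel EG EM)) a) : Prop :=
  ∀ a, 𝒢.jMap ⟨a, ξ' a⟩ = 𝒢.lieFunctor ξ a

/-- The right-invariant vector field of a section `X` of the Lie algebroid: its value at `g` is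
the image of `X (tgt g)` under the tangent map of the right translation `h ↦ h g`, which is
defined on the source fibre through `1_{tgt g}`. -/
def rightInvariant (X : ∀ m, 𝒢.Algebroid m) (g : G) : TangentSpace IG g :=
  𝒢.one_mul g ▸ mfderivWithin IG IG (fun h ↦ 𝒢.mul h g) {h | 𝒢.src h = 𝒢.tgt g}
    (𝒢.one (𝒢.tgt g)) (𝒢.incl (𝒢.tgt g) (X (𝒢.tgt g)))

/-- `D` is the operator `D_ξ`: the right-invariant vector field of `D X` is the Lie bracket of `ξ`
with the right-invariant vector field of `X`. -/
def IsBracketOperator (ξ : ∀ g : G, TangentSpace IG g)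
    (D : Cₛ^∞⟮IM; AlgebroidModel EG EM, 𝒢.Algebroid⟯ →
      Cₛ^∞⟮IM; AlgebroidModel EG EM, 𝒢.Algebroid⟯) : Prop :=
  ∀ X g, 𝒢.rightInvariant (D X) g = mlieBracket IG ξ (𝒢.rightInvariant X) g

/-- The anchor of the Lie algebroid: the derivative of the target projection. -/
def anchor (m : M) (a : 𝒢.Algebroid m) : TangentSpace IM m :=
  𝒢.tgt_one m ▸ mfderiv IG IM 𝒢.tgt (𝒢.one m) (𝒢.incl m a)

end Algebroid
end LieGroupoid

section PairGroupoid

variable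
    {E : Type*} [NormedAddCommGroup E] [NormedSpace ℝ E]
    {H : Type*} [TopologicalSpace H] (I : ModelWithCorners ℝ E H)
    (M : Type*) [TopologicalSpace M] [ChartedSpace H M]

/-- The pair groupoid `M × M ⇉ M`, with source the second and target the first projection. -/
def pairGroupoid : LieGroupoid (I.prod I) (M × M) I M where
  src := Prod.snd
  tgt := Prod.fst
  one m := (m, m)
  inv p := (p.2, p.1)
  mul p q := (p.1, q.2)
  src_one _ := rfl
  tgt_one _ := rfl
  src_mul _ _ _ := rfl
  tgt_mul _ _ _ := rfl
  mul_assoc _ _ _ _ _ := rfl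
  one_mul _ := rfl
  mul_one _ := rfl
  src_inv _ := rfl
  tgt_inv _ := rfl
  inv_mul _ := rfl
  mul_inv _ := rfl
  contMDiff_src := contMDiff_snd
  contMDiff_tgt := contMDiff_fst
  contMDiff_one := contMDiff_id.prodMk contMDiff_id
  contMDiff_inv := contMDiff_snd.prodMk contMDiff_fst
  src_submersion g := by
    rw [mfderiv_snd]
    exact fun v ↦ ⟨(0, v), rfl⟩
  tgt_submersion g := by
    rw [mfderiv_fst]
    exact fun v ↦ ⟨(v, 0), rfl⟩
  contMDiffOn_mul :=
    ((contMDiff_fst.comp contMDiff_fst).prodMk (contMDiff_snd.comp contMDiff_snd)).contMDiffOn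

variable {M}

/-- The vector field `x × x` on `M × M`. -/
def pairField (x : ∀ m : M, TangentSpace I m) (p : M × M) : TangentSpace (I.prod I) p :=
  (x p.1, x p.2)

end PairGroupoid

end

/-! Everything is tested on differentials of vector-valued functions. A function ψ on G induces a
function dψ on TG. In a chart, the derivative of dψ along the vector (p, v; u, w) of TTG is D²ψ(u,
v) + Dψ(w). The second derivative is symmetric, so the canonical involution does not change this
value (`mfderiv_totalDifferential_canonicalInvolution`). Transported through j, this says that the
lift ξ̃ acts on AG by ξ̃(dψ ∘ ι) = d(ξψ) ∘ ι (`IsLieLift.totalDifferential_eq`).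

The fibre coordinate of AG around m is itself of the form dψ ∘ ι, with ψ = `fibreFun m`
(`trivializationAt_snd`). Hence ξ̃ has the coordinates (x(m), d(ξψ)(X)) at X in the fibre over m.
The second one is linear in X, so ξ̃ is a linear vector field.

For the bracket, dψ([ξ, X⃗]) = ξ(X⃗ψ) - X⃗(ξψ) (`mfderiv_mlieBracket`). At 1_m the field ξ is
T(1)(x), and along the identities X⃗ψ is the coordinate function of X. So the coordinate of D_ξ(X)
at m is the derivative along x of the coordinate of X, minus d(ξψ)(X)
(`IsMultiplicative.trivializationAt_bracketOperator`). Paired with a dual section, this is the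
equation that characterises the operator of (ξ̃, x). That operator is unique because every covector
is a value of a smooth dual section.

D_ξ exists because [ξ, X⃗] is right-invariant. Multiplication relates ξ × ξ to ξ and X⃗ × 0 to X⃗,
hence [ξ, X⃗] × 0 to [ξ, X⃗] (`IsMultiplicative.rightMul_mlieBracket`). Multiplication lives only on
composable pairs, and these are treated without a submanifold structure. Local sections of the
source submersion extend multiplication to an open set (`exists_mul_extension`), and derivatives are
compared along curves that stay in the set (`IsTangentTo.mfderiv_eq`).

For the surjectivity of j, flip an element of ATG and subtract a vector of T(AG) with the same
horizontal part. The remainder is vertical and killed by T(α), so it comes from a fibre of AG.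

On TM the complete lift is J ∘ T(x), and the same invariance gives x̃(dψ) = d(xψ) and the Lie
derivative. The anchor of the pair groupoid relates the two lifts because x × x is related to x by
the target projection. -/

noncomputable section

/-! ### Charts of a total space -/

section FiberBundle

variable
    {E : Type*} [NormedAddCommGroup E] [NormedSpace ℝ E]
    {H : Type*} [TopologicalSpace H] {I : ModelWithCorners ℝ E H}
    {M : Type*} [TopologicalSpace M] [ChartedSpace H M]
    {F : Type*} [NormedAddCommGroup F] [NormedSpace ℝ F]
    {V : M → Type*} [∀ m, TopologicalSpace (V m)] [TopologicalSpace (TotalSpace F V)]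
    [FiberBundle F V]

theorem eventuallyEq_extChartAt_totalSpace (a : TotalSpace F V) :
    extChartAt (I.prod 𝓘(ℝ, F)) a =ᶠ[𝓝 a]
      (fun b ↦ ((extChartAt I a.proj ∘ π F V) b, (trivializationAt F V a.proj b).2)) := by
  have : (trivializationAt F V a.proj).source ∈ 𝓝 a :=
    (trivializationAt F V a.proj).open_source.mem_nhds
      ((trivializationAt F V a.proj).mem_source.2 (mem_baseSet_trivializationAt F V a.proj))
  filter_upwards [this] with b hb
  rw [FiberBundle.extChartAt]
  change (extChartAt I a.proj (trivializationAt F V a.proj b).1, _) = _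
  rw [Trivialization.coe_fst _ hb]
  rfl

end FiberBundle

theorem FiberBundle.eventually_proj_mem {M : Type*} [TopologicalSpace M]
    {F : Type*} [TopologicalSpace F]
    {V : M → Type*} [∀ m, TopologicalSpace (V m)] [TopologicalSpace (TotalSpace F V)]
    [FiberBundle F V] {a : TotalSpace F V} {s : Set M}
    (hs : IsOpen s) (ha : a.proj ∈ s) : ∀ᶠ b : TotalSpace F V in 𝓝 a, b.proj ∈ s :=
  (FiberBundle.continuous_proj F V).continuousAt.eventually (hs.mem_nhds ha)

/-! ### Differentials as functions on the tangent bundle, the involution and the bracket -/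

section Calculus

variable
    {E : Type*} [NormedAddCommGroup E] [NormedSpace ℝ E]
    {H : Type*} [TopologicalSpace H] {I : ModelWithCorners ℝ E H}
    {M : Type*} [TopologicalSpace M] [ChartedSpace H M]
    {E' : Type*} [NormedAddCommGroup E'] [NormedSpace ℝ E']
    {H' : Type*} [TopologicalSpace H'] {I' : ModelWithCorners ℝ E' H'}
    {N : Type*} [TopologicalSpace N] [ChartedSpace H' N]
    {F : Type*} [NormedAddCommGroup F] [NormedSpace ℝ F]
    {V : M → Type*} [∀ m, AddCommGroup (V m)] [∀ m, Module ℝ (V m)]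
    [∀ m, TopologicalSpace (V m)] [TopologicalSpace (TotalSpace F V)]
    [FiberBundle F V] [VectorBundle ℝ F V]

variable (I) in
/-- The differential of a vector-valued function, as a function on the tangent bundle. -/
def totalDifferential (ψ : M → F) (w : TangentBundle I M) : F :=
  mfderiv I 𝓘(ℝ, F) ψ w.1 w.2

theorem contMDiffAt_trivialization_snd [IsManifold I ∞ M] [ContMDiffVectorBundle ∞ F V I]
    {m₀ : M} {a : TotalSpace F V} (ha : a.proj ∈ (trivializationAt F V m₀).baseSet) :
    ContMDiffAt (I.prod 𝓘(ℝ, F)) 𝓘(ℝ, F) ∞ (fun b ↦ (trivializationAt F V m₀ b).2) a := by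
  have h := ((trivializationAt F V m₀).contMDiffOn (IB := I) (n := ∞)) a
    ((trivializationAt F V m₀).mem_source.2 ha)
  have h' := h.contMDiffAt ((trivializationAt F V m₀).open_source.mem_nhds
    ((trivializationAt F V m₀).mem_source.2 ha))
  exact contMDiffAt_snd.comp a h'

theorem hasMFDerivAt_prodMk_space {f : M → F} {g : M → E'} {p : M}
    {f' : TangentSpace I p →L[ℝ] F} {g' : TangentSpace I p →L[ℝ] E'}
    (hf : HasMFDerivAt I 𝓘(ℝ, F) f p f') (hg : HasMFDerivAt I 𝓘(ℝ, E') g p g') :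
    HasMFDerivAt I 𝓘(ℝ, F × E') (fun q ↦ (f q, g q)) p (f'.prod g') :=
  ⟨hf.1.prodMk hg.1, hf.2.prodMk hg.2⟩

/-- The derivative of a preferred chart at its own base point is the identity, and the chart of the
total space consists of the base chart and the fibre coordinate. This gives the two components of a
tangent vector an intrinsic meaning and allows the chain rule to act on each of them. -/
theorem mfderiv_bundleChart [IsManifold I ∞ M] [ContMDiffVectorBundle ∞ F V I]
    (a : TotalSpace F V) (η : TangentSpace (I.prod 𝓘(ℝ, F)) a) :
    mfderiv (I.prod 𝓘(ℝ, F)) I (π F V) a η = (show E × F from η).1 ∧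
    mfderiv (I.prod 𝓘(ℝ, F)) 𝓘(ℝ, F) (fun b ↦ (trivializationAt F V a.proj b).2) a η =
      (show E × F from η).2 := by
  have : IsManifold (I.prod 𝓘(ℝ, F)) ∞ (TotalSpace F V) := inferInstance
  have : IsManifold (I.prod 𝓘(ℝ, F)) 1 (TotalSpace F V) := .of_le (n := ∞) (by simp)
  have : IsManifold I 1 M := .of_le (n := ∞) (by simp)
  have hmem := mem_baseSet_trivializationAt F V a.proj
  have h0 : mfderiv (I.prod 𝓘(ℝ, F)) 𝓘(ℝ, E × F) (extChartAt (I.prod 𝓘(ℝ, F)) a) a η = η := by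
    rw [mfderiv_extChartAt_self]; rfl
  have h1 : MDifferentiableAt (I.prod 𝓘(ℝ, F)) I (π F V) a :=
    (contMDiff_proj V (n := ∞) |>.mdifferentiable (by simp)) a
  have h2 := (contMDiffAt_trivialization_snd (I := I) hmem).mdifferentiableAt (by simp)
  have h3 : MDifferentiableAt I 𝓘(ℝ, E) (extChartAt I a.proj) a.proj :=
    mdifferentiableAt_extChartAt (mem_chart_source H a.proj)
  have h4 := h3.hasMFDerivAt.comp a h1.hasMFDerivAt
  have h5 := hasMFDerivAt_prodMk_space h4 h2.hasMFDerivAt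
  have h6 := eventuallyEq_extChartAt_totalSpace (I := I) a
  rw [h6.mfderiv_eq, h5.mfderiv, mfderiv_extChartAt_self] at h0
  constructor
  · exact congrArg (fun z : E × F ↦ z.1) h0
  · exact congrArg (fun z : E × F ↦ z.2) h0

theorem trivializationAt_tangent_snd [IsManifold I ∞ M] {p : M} {b : TangentBundle I M}
    (hb : b.1 ∈ (chartAt H p).source) :
    (trivializationAt E (TangentSpace I) p b).2 = totalDifferential I (extChartAt I p) b := by
  have h := DFunLike.congr_fun
    (TangentBundle.continuousLinearMapAt_trivializationAt (I := I) (𝕜 := ℝ) hb) b.2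
  rw [Trivialization.continuousLinearMapAt_apply_of_mem ℝ _ (by simpa using hb)] at h
  exact h

theorem totalDifferential_clm_apply {c : N → E →L[ℝ] F} {d : N → E} {b : TangentBundle I' N}
    (hc : MDifferentiableAt I' 𝓘(ℝ, E →L[ℝ] F) c b.1)
    (hd : MDifferentiableAt I' 𝓘(ℝ, E) d b.1) :
    totalDifferential I' (fun k ↦ c k (d k)) b =
      totalDifferential I' c b (d b.1) + c b.1 (totalDifferential I' d b) := by
  have h2 : HasFDerivAt (fun z : (E →L[ℝ] F) × E ↦ z.1 z.2) _ (c b.1, d b.1) :=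
    hasFDerivAt_fst.clm_apply hasFDerivAt_snd
  have h3 := h2.hasMFDerivAt.comp b.1
    (hasMFDerivAt_prodMk_space hc.hasMFDerivAt hd.hasMFDerivAt)
  have h4 : HasMFDerivAt I' 𝓘(ℝ, F) (fun k ↦ c k (d k)) b.1 _ := h3
  rw [totalDifferential, h4.mfderiv]
  change c b.1 (totalDifferential I' d b) + totalDifferential I' c b (d b.1) = _
  rw [add_comm]

theorem mfderiv_fderiv_apply {g : E → F} {c d : N → E} {n : N}
    {c' d' : TangentSpace I' n →L[ℝ] E}
    (hg : ContDiffAt ℝ ∞ g (c n)) (hc : HasMFDerivAt I' 𝓘(ℝ, E) c n c')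
    (hd : HasMFDerivAt I' 𝓘(ℝ, E) d n d') (v : TangentSpace I' n) :
    mfderiv I' 𝓘(ℝ, F) (fun k ↦ fderiv ℝ g (c k) (d k)) n v =
      fderiv ℝ (fderiv ℝ g) (c n) (c' v) (d n) + fderiv ℝ g (c n) (d' v) := by
  have h1 : HasFDerivAt (fderiv ℝ g) (fderiv ℝ (fderiv ℝ g) (c n)) (c n) :=
    ((hg.fderiv_right (m := 1) (by norm_cast)).differentiableAt (by simp)).hasFDerivAt
  have h2 : HasMFDerivAt I' 𝓘(ℝ, E →L[ℝ] F) (fun k ↦ fderiv ℝ g (c k)) n _ :=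
    h1.hasMFDerivAt.comp n hc
  refine (totalDifferential_clm_apply (b := (⟨n, v⟩ : TangentBundle I' N))
    h2.mdifferentiableAt hd.mdifferentiableAt).trans ?_
  simp only [totalDifferential]
  rw [h2.mfderiv, hd.mfderiv]
  rfl

/-- A function read in the preferred chart at `p`. -/
theorem contDiffAt_comp_extChartAt_symm [I.Boundaryless] {ψ : M → F} {p : M}
    (hψ : ContMDiffAt I 𝓘(ℝ, F) ∞ ψ p) :
    ContDiffAt ℝ ∞ (ψ ∘ (extChartAt I p).symm) (extChartAt I p p) := by
  have h := (contMDiffAt_iff.1 hψ).2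
  rw [I.range_eq_univ, contDiffWithinAt_univ] at h
  exact h

/-- The chain rule in one fixed chart, at all points near `p` and not only at `p`, so that the
identity can be differentiated once more. -/
theorem eventually_mfderiv_eq_fderiv [I.Boundaryless] [IsManifold I ∞ M] {ψ : M → F} {p : M}
    (hψ : ContMDiffAt I 𝓘(ℝ, F) ∞ ψ p) :
    ∀ᶠ q in 𝓝 p, ∀ w : TangentSpace I q, mfderiv I 𝓘(ℝ, F) ψ q w =
      fderiv ℝ (ψ ∘ (extChartAt I p).symm) (extChartAt I p q)
        (totalDifferential I (extChartAt I p) ⟨q, w⟩) := by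
  have h1 : ∀ᶠ q in 𝓝 p, q ∈ (chartAt H p).source :=
    (chartAt H p).open_source.mem_nhds (mem_chart_source H p)
  have h2 : ∀ᶠ z in 𝓝 (extChartAt I p p),
      DifferentiableAt ℝ (ψ ∘ (extChartAt I p).symm) z := by
    have := ((contDiffAt_comp_extChartAt_symm hψ).of_le
      (show (1 : WithTop ℕ∞) ≤ ∞ by norm_cast)).eventually (by simp)
    exact this.mono fun z hz ↦ hz.differentiableAt (by simp)
  have h3 := (continuousAt_extChartAt (I := I) p).eventually h2
  filter_upwards [h1, h1.eventually_nhds, h3] with q hq hq' hd w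
  have h4 : ψ =ᶠ[𝓝 q] (ψ ∘ (extChartAt I p).symm) ∘ extChartAt I p := by
    filter_upwards [hq'] with r hr
    have : r ∈ (extChartAt I p).source := by rwa [extChartAt_source]
    change ψ r = ψ ((extChartAt I p).symm (extChartAt I p r))
    rw [(extChartAt I p).left_inv this]
  rw [h4.mfderiv_eq]
  rw [(hd.hasFDerivAt.hasMFDerivAt.comp q
    (mdifferentiableAt_extChartAt (I := I) hq).hasMFDerivAt).mfderiv]
  rfl

theorem contMDiffAt_totalDifferential_extChartAt [IsManifold I ∞ M] (b : TangentBundle I M) :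
    ContMDiffAt I.tangent 𝓘(ℝ, E) ∞ (totalDifferential I (extChartAt I b.1)) b := by
  refine (contMDiffAt_trivialization_snd (I := I) (V := (TangentSpace I : M → Type _))
    (mem_baseSet_trivializationAt E (TangentSpace I) b.1)).congr_of_eventuallyEq ?_
  have : ∀ᶠ c : TangentBundle I M in 𝓝 b, c.1 ∈ (chartAt H b.1).source :=
    (FiberBundle.continuous_proj E (TangentSpace I)).continuousAt.eventually
      ((chartAt H b.1).open_source.mem_nhds (mem_chart_source H b.1))
  filter_upwards [this] with c hc
  exact (trivializationAt_tangent_snd hc).symm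

theorem mfderiv_totalDifferential_extChartAt [IsManifold I ∞ M] (b : TangentBundle I M)
    (Z : TangentSpace I.tangent b) :
    mfderiv I.tangent 𝓘(ℝ, E) (totalDifferential I (extChartAt I b.1)) b Z =
      (show E × E from Z).2 := by
  rw [← (mfderiv_bundleChart (I := I) b Z).2]
  have : totalDifferential I (extChartAt I b.1) =ᶠ[𝓝 b]
      (fun c ↦ (trivializationAt E (TangentSpace I) b.proj c).2) := by
    have : ∀ᶠ c : TangentBundle I M in 𝓝 b, c.1 ∈ (chartAt H b.1).source :=
      (FiberBundle.continuous_proj E (TangentSpace I)).continuousAt.eventually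
        ((chartAt H b.1).open_source.mem_nhds (mem_chart_source H b.1))
    filter_upwards [this] with c hc
    exact (trivializationAt_tangent_snd hc).symm
  rw [this.mfderiv_eq]
  rfl

theorem totalDifferential_extChartAt_self [IsManifold I ∞ M] (b : TangentBundle I M) :
    totalDifferential I (extChartAt I b.1) b = b.2 := by
  rw [totalDifferential, mfderiv_extChartAt_self]
  rfl

theorem eventuallyEq_totalDifferential [I.Boundaryless] [IsManifold I ∞ M] {ψ : M → F}
    {b : TangentBundle I M} (hψ : ContMDiffAt I 𝓘(ℝ, F) ∞ ψ b.1) :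
    totalDifferential I ψ =ᶠ[𝓝 b] fun c ↦ fderiv ℝ (ψ ∘ (extChartAt I b.1).symm)
      (extChartAt I b.1 c.1) (totalDifferential I (extChartAt I b.1) c) := by
  have := (FiberBundle.continuous_proj E (TangentSpace I)).continuousAt.eventually
    (eventually_mfderiv_eq_fderiv hψ)
  filter_upwards [this] with c hc
  exact hc c.2

/-- The second tangent map of a vector-valued function in coordinates. -/
theorem mfderiv_totalDifferential [I.Boundaryless] [IsManifold I ∞ M] {ψ : M → F}
    {b : TangentBundle I M} (hψ : ContMDiffAt I 𝓘(ℝ, F) ∞ ψ b.1) (Z : TangentSpace I.tangent b) :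
    mfderiv I.tangent 𝓘(ℝ, F) (totalDifferential I ψ) b Z =
      fderiv ℝ (fderiv ℝ (ψ ∘ (extChartAt I b.1).symm)) (extChartAt I b.1 b.1)
        (show E × E from Z).1 (show E from b.2) +
      fderiv ℝ (ψ ∘ (extChartAt I b.1).symm) (extChartAt I b.1 b.1) (show E × E from Z).2 := by
  rw [(eventuallyEq_totalDifferential hψ).mfderiv_eq]
  have hπ : MDifferentiableAt I.tangent I (π E (TangentSpace I)) b :=
    (contMDiff_proj (TangentSpace I : M → Type _) (n := ∞) |>.mdifferentiable (by simp)) b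
  have hc := (mdifferentiableAt_extChartAt (I := I) (mem_chart_source H b.1)).hasMFDerivAt.comp b
    hπ.hasMFDerivAt
  have hd := ((contMDiffAt_totalDifferential_extChartAt b).mdifferentiableAt
    (by simp)).hasMFDerivAt
  have key := mfderiv_fderiv_apply
    (c := extChartAt I b.1 ∘ π E (TangentSpace I)) (contDiffAt_comp_extChartAt_symm hψ) hc hd Z
  have e1 : mfderiv I 𝓘(ℝ, E) (extChartAt I b.1) b.1
      (mfderiv I.tangent I (π E (TangentSpace I)) b Z) = (show E × E from Z).1 := by
    rw [mfderiv_extChartAt_self]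
    exact (mfderiv_bundleChart (I := I) b Z).1
  refine key.trans (congrArg₂ (· + ·) ?_ (congrArg _ (mfderiv_totalDifferential_extChartAt b Z)))
  exact congrArg₂ (fun u v : E ↦ fderiv ℝ (fderiv ℝ (ψ ∘ (extChartAt I b.1).symm))
    (extChartAt I b.1 b.1) u v) e1 (totalDifferential_extChartAt_self b)

theorem contMDiffAt_totalDifferential [I.Boundaryless] [IsManifold I ∞ M] {ψ : M → F}
    {b : TangentBundle I M} (hψ : ContMDiffAt I 𝓘(ℝ, F) ∞ ψ b.1) :
    ContMDiffAt I.tangent 𝓘(ℝ, F) ∞ (totalDifferential I ψ) b := by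
  refine ContMDiffAt.congr_of_eventuallyEq ?_ (eventuallyEq_totalDifferential hψ)
  have h1 : ContMDiffAt I.tangent 𝓘(ℝ, E) ∞ (fun c : TangentBundle I M ↦ extChartAt I b.1 c.1) b :=
    (contMDiffAt_extChartAt (I := I) (n := ∞) (x := b.1)).comp b
      (contMDiff_proj (TangentSpace I : M → Type _) b)
  have h2 : ContDiffAt ℝ ∞ (fderiv ℝ (ψ ∘ (extChartAt I b.1).symm)) (extChartAt I b.1 b.1) :=
    (contDiffAt_comp_extChartAt_symm hψ).fderiv_right (by simp)
  exact (h2.contMDiffAt.comp b h1).clm_apply (contMDiffAt_totalDifferential_extChartAt b)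

/-- The one analytic fact behind both the invariance under the involution and the commutator formula
for the bracket. -/
theorem fderiv_fderiv_comm {g : E → F} {z : E} (hg : ContDiffAt ℝ ∞ g z) (u v : E) :
    fderiv ℝ (fderiv ℝ g) z u v = fderiv ℝ (fderiv ℝ g) z v u :=
  (hg.isSymmSndFDerivAt (by simp; norm_cast)) u v

/-- Differentials of functions cannot distinguish a vector of the double tangent bundle from its
image under the canonical involution. -/
theorem mfderiv_totalDifferential_canonicalInvolution [I.Boundaryless] [IsManifold I ∞ M]
    {ψ : M → F} (Z : TangentBundle I.tangent (TangentBundle I M))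
    (hψ : ContMDiffAt I 𝓘(ℝ, F) ∞ ψ Z.1.1) :
    mfderiv I.tangent 𝓘(ℝ, F) (totalDifferential I ψ) (canonicalInvolution I Z).1
      (canonicalInvolution I Z).2 = mfderiv I.tangent 𝓘(ℝ, F) (totalDifferential I ψ) Z.1 Z.2 := by
  have h1 := mfderiv_totalDifferential (b := Z.1) hψ Z.2
  have h2 := mfderiv_totalDifferential (b := (canonicalInvolution I Z).1) hψ
    (canonicalInvolution I Z).2
  refine h2.trans (Eq.trans ?_ h1.symm)
  -- The involution exchanges the two arguments of the second derivative and keeps the last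
  -- coordinate.
  refine congrArg₂ (· + ·) ?_ rfl
  exact fderiv_fderiv_comm (contDiffAt_comp_extChartAt_symm hψ) _ _

/-- A vector field read in the preferred chart at `p`. -/
theorem contMDiffAt_totalDifferential_extChartAt_comp [IsManifold I ∞ M]
    {W : ∀ q : M, TangentSpace I q} {p : M}
    (hW : ContMDiffAt I I.tangent ∞ (fun q ↦ (⟨q, W q⟩ : TangentBundle I M)) p) :
    ContMDiffAt I 𝓘(ℝ, E) ∞ (fun q ↦ totalDifferential I (extChartAt I p) ⟨q, W q⟩) p :=
  (contMDiffAt_totalDifferential_extChartAt (⟨p, W p⟩ : TangentBundle I M)).comp p hW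

theorem totalDifferential_eq_fderiv_of_eventuallyEq [I.Boundaryless] {p : M} {g : M → F} {ĝ : E → F}
    (hg : MDifferentiableAt I 𝓘(ℝ, F) g p)
    (h : g ∘ (extChartAt I p).symm =ᶠ[𝓝 (extChartAt I p p)] ĝ) (v : TangentSpace I p) :
    totalDifferential I g ⟨p, v⟩ = fderiv ℝ ĝ (extChartAt I p p) (show E from v) := by
  have h1 : totalDifferential I g ⟨p, v⟩ =
      fderivWithin ℝ (g ∘ (extChartAt I p).symm) (range I) (extChartAt I p p) (show E from v) :=
    DFunLike.congr_fun hg.mfderiv v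
  rw [h1, ← h.fderiv_eq, I.range_eq_univ, fderivWithin_univ]

/-- The Lie bracket in terms of the components of the vector fields in the chart at `p`. -/
theorem mlieBracket_eq_sub [I.Boundaryless] [IsManifold I ∞ M]
    {V W : ∀ q : M, TangentSpace I q} {p : M}
    (hV : ContMDiffAt I I.tangent ∞ (fun q ↦ (⟨q, V q⟩ : TangentBundle I M)) p)
    (hW : ContMDiffAt I I.tangent ∞ (fun q ↦ (⟨q, W q⟩ : TangentBundle I M)) p) :
    (show E from mlieBracket I V W p) =
      totalDifferential I (fun q ↦ totalDifferential I (extChartAt I p) ⟨q, W q⟩) ⟨p, V p⟩ -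
      totalDifferential I (fun q ↦ totalDifferential I (extChartAt I p) ⟨q, V q⟩) ⟨p, W p⟩ := by
  -- The bracket is defined by pulling the fields back along the inverse chart. The pullbacks are
  -- the chart components of the fields, because the derivative of the chart inverts that of its
  -- inverse.
  have key : ∀ U : (∀ q : M, TangentSpace I q),
      (fun q ↦ totalDifferential I (extChartAt I p) ⟨q, U q⟩) ∘ (extChartAt I p).symm
        =ᶠ[𝓝 (extChartAt I p p)]
      mpullbackWithin 𝓘(ℝ, E) I (extChartAt I p).symm U (range I) := by
    intro U
    filter_upwards [extChartAt_target_mem_nhds (I := I) p] with z hz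
    have h1 := mfderiv_extChartAt_comp_mfderivWithin_extChartAt_symm (I := I) hz
    have h2 := mfderivWithin_extChartAt_symm_comp_mfderiv_extChartAt (I := I) hz
    have h3 := ContinuousLinearMap.inverse_eq h2 h1
    rw [mpullbackWithin_apply, h3]
    rfl
  have hself : ∀ U : (∀ q : M, TangentSpace I q),
      mpullbackWithin 𝓘(ℝ, E) I (extChartAt I p).symm U (range I) (extChartAt I p p) = U p := by
    intro U
    rw [← (key U).eq_of_nhds]
    change totalDifferential I (extChartAt I p)
      ⟨(extChartAt I p).symm (extChartAt I p p), U ((extChartAt I p).symm (extChartAt I p p))⟩ = _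
    rw [extChartAt_to_inv]
    exact totalDifferential_extChartAt_self (⟨p, U p⟩ : TangentBundle I M)
  rw [totalDifferential_eq_fderiv_of_eventuallyEq
      ((contMDiffAt_totalDifferential_extChartAt_comp hW).mdifferentiableAt (by simp)) (key W),
    totalDifferential_eq_fderiv_of_eventuallyEq
      ((contMDiffAt_totalDifferential_extChartAt_comp hV).mdifferentiableAt (by simp)) (key V)]
  have h0 : (show E from mlieBracket I V W p) = lieBracketWithin ℝ
      (mpullbackWithin 𝓘(ℝ, E) I (extChartAt I p).symm V (range I))
      (mpullbackWithin 𝓘(ℝ, E) I (extChartAt I p).symm W (range I))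
      ((extChartAt I p).symm ⁻¹' univ ∩ range I) (extChartAt I p p) := by
    have hinv : ∀ z : E, (ContinuousLinearMap.id ℝ E).inverse z = z := by simp
    rw [← mlieBracketWithin_univ, mlieBracketWithin_apply, mfderiv_extChartAt_self]
    exact hinv _
  have h1 : ∀ A B : E → E, lieBracketWithin ℝ A B ((extChartAt I p).symm ⁻¹' univ ∩ range I)
      (extChartAt I p p) = fderiv ℝ B (extChartAt I p p) (A (extChartAt I p p)) -
        fderiv ℝ A (extChartAt I p p) (B (extChartAt I p p)) := by
    intro A B
    rw [preimage_univ, I.range_eq_univ, univ_inter, lieBracketWithin_univ, lieBracket]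
  exact (h0.trans (h1 _ _)).trans
    (congrArg₂ (· - ·) (congrArg _ (hself V)) (congrArg _ (hself W)))

/-- The Lie bracket as a commutator of derivations, tested on vector-valued local functions. -/
theorem mfderiv_mlieBracket [I.Boundaryless] [IsManifold I ∞ M]
    {V W : ∀ q : M, TangentSpace I q} {p : M} {ψ : M → F}
    (hψ : ContMDiffAt I 𝓘(ℝ, F) ∞ ψ p)
    (hV : ContMDiffAt I I.tangent ∞ (fun q ↦ (⟨q, V q⟩ : TangentBundle I M)) p)
    (hW : ContMDiffAt I I.tangent ∞ (fun q ↦ (⟨q, W q⟩ : TangentBundle I M)) p) :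
    totalDifferential I ψ ⟨p, mlieBracket I V W p⟩ =
      totalDifferential I (fun q ↦ totalDifferential I ψ ⟨q, W q⟩) ⟨p, V p⟩ -
      totalDifferential I (fun q ↦ totalDifferential I ψ ⟨q, V q⟩) ⟨p, W p⟩ := by
  have key : ∀ U U' : (∀ q : M, TangentSpace I q),
      ContMDiffAt I I.tangent ∞ (fun q ↦ (⟨q, U q⟩ : TangentBundle I M)) p →
      totalDifferential I (fun q ↦ totalDifferential I ψ ⟨q, U q⟩) ⟨p, U' p⟩ =
        fderiv ℝ (fderiv ℝ (ψ ∘ (extChartAt I p).symm)) (extChartAt I p p)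
          (show E from U' p) (show E from U p) +
        fderiv ℝ (ψ ∘ (extChartAt I p).symm) (extChartAt I p p)
          (totalDifferential I (fun q ↦ totalDifferential I (extChartAt I p) ⟨q, U q⟩)
            ⟨p, U' p⟩) := by
    intro U U' hU
    have h1 : (fun q ↦ totalDifferential I ψ ⟨q, U q⟩) =ᶠ[𝓝 p] fun q ↦
        fderiv ℝ (ψ ∘ (extChartAt I p).symm) (extChartAt I p q)
          (totalDifferential I (extChartAt I p) ⟨q, U q⟩) := by
      filter_upwards [eventually_mfderiv_eq_fderiv hψ] with q hq
      exact hq (U q)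
    have hc := (mdifferentiableAt_extChartAt (I := I) (mem_chart_source H p)).hasMFDerivAt
    have hd := ((contMDiffAt_totalDifferential_extChartAt_comp hU).mdifferentiableAt
      (by simp)).hasMFDerivAt
    have h2 := mfderiv_fderiv_apply (contDiffAt_comp_extChartAt_symm hψ) hc hd (U' p)
    rw [totalDifferential, h1.mfderiv_eq]
    refine h2.trans (congrArg₂ (· + ·) ?_ rfl)
    refine congrArg₂ (fun u v : E ↦ fderiv ℝ (fderiv ℝ (ψ ∘ (extChartAt I p).symm))
      (extChartAt I p p) u v) ?_ (totalDifferential_extChartAt_self (⟨p, U p⟩ : TangentBundle I M))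
    rw [mfderiv_extChartAt_self]
    rfl
  -- The second-derivative terms agree by symmetry and cancel. What remains is the first derivative
  -- applied to the coordinate expression of the bracket.
  rw [key W V hW, key V W hV,
    fderiv_fderiv_comm (contDiffAt_comp_extChartAt_symm hψ) (show E from W p) (show E from V p),
    add_sub_add_left_eq_sub, ← map_sub]
  have h1 := (eventually_mfderiv_eq_fderiv hψ).self_of_nhds (mlieBracket I V W p)
  refine h1.trans (congrArg _ ?_)
  exact (totalDifferential_extChartAt_self (⟨p, mlieBracket I V W p⟩ : TangentBundle I M)).trans
    (mlieBracket_eq_sub hV hW)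

end Calculus

/-! ### Velocities of curves and vectors tangent to a set -/

section Velocity

variable
    {E : Type*} [NormedAddCommGroup E] [NormedSpace ℝ E]
    {H : Type*} [TopologicalSpace H] {I : ModelWithCorners ℝ E H}
    {M : Type*} [TopologicalSpace M] [ChartedSpace H M]
    {E' : Type*} [NormedAddCommGroup E'] [NormedSpace ℝ E']
    {H' : Type*} [TopologicalSpace H'] {I' : ModelWithCorners ℝ E' H'}
    {N : Type*} [TopologicalSpace N] [ChartedSpace H' N]
    {F : Type*} [NormedAddCommGroup F] [NormedSpace ℝ F]

/-- The curve `c` has velocity `b` at time `0`. -/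
def HasVelocity (c : ℝ → M) (b : TangentBundle I M) : Prop :=
  c 0 = b.1 ∧ ContinuousAt c 0 ∧ HasDerivAt (extChartAt I b.1 ∘ c) (show E from b.2) 0

/-- The tangent vector `b` is the velocity of a curve in `S`. -/
def IsTangentTo (S : Set M) (b : TangentBundle I M) : Prop :=
  ∃ c : ℝ → M, HasVelocity c b ∧ ∀ᶠ t in 𝓝 0, c t ∈ S

/-- The main device for identities between tangent vectors: it is enough to compare germs of curves.
Equality is taken in the total space, so base points that are only propositionally equal need no
transport. -/
theorem HasVelocity.unique {c c' : ℝ → M} {b b' : TangentBundle I M} (h : HasVelocity c b)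
    (h' : HasVelocity c' b') (hc : c =ᶠ[𝓝 0] c') : b = b' := by
  obtain ⟨p, v⟩ := b
  obtain ⟨p', v'⟩ := b'
  obtain rfl : p = p' := by
    have h1 : c 0 = p := h.1
    have h2 : c' 0 = p' := h'.1
    rw [← h1, ← h2, hc.eq_of_nhds]
  have h1 : HasDerivAt (extChartAt I p ∘ c) (show E from v) 0 := h.2.2
  have h2 : HasDerivAt (extChartAt I p ∘ c') (show E from v') 0 := h'.2.2
  have h3 := h1.unique (h2.congr_of_eventuallyEq (hc.fun_comp _))
  exact congrArg (TotalSpace.mk p) h3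

/-- A straight line in the chart. Since there is no boundary, it stays in the target of the chart
for small times. -/
theorem exists_hasVelocity [I.Boundaryless] (b : TangentBundle I M) :
    ∃ c : ℝ → M, HasVelocity c b := by
  obtain ⟨p, v⟩ := b
  have key : ∀ v : E, ∃ c : ℝ → M, c 0 = p ∧ ContinuousAt c 0 ∧
      HasDerivAt (extChartAt I p ∘ c) v 0 := by
    intro v
    have hl : HasDerivAt (fun t : ℝ ↦ extChartAt I p p + t • v) v 0 := by
      have := ((hasDerivAt_id (0 : ℝ)).smul_const v).const_add (extChartAt I p p)
      rwa [one_smul] at this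
    have h0 : extChartAt I p p + (0 : ℝ) • v = extChartAt I p p := by rw [zero_smul, add_zero]
    have hc : Filter.Tendsto (fun t : ℝ ↦ extChartAt I p p + t • v) (𝓝 0)
        (𝓝 (extChartAt I p p)) := by
      have := hl.continuousAt.tendsto
      rwa [h0] at this
    refine ⟨fun t ↦ (extChartAt I p).symm (extChartAt I p p + t • v), ?_, ?_, ?_⟩
    · simp only [h0, extChartAt_to_inv]
    · refine ContinuousAt.comp (g := (extChartAt I p).symm) ?_ hl.continuousAt
      rw [h0]
      exact continuousAt_extChartAt_symm p
    · refine hl.congr_of_eventuallyEq ?_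
      filter_upwards [hc.eventually (extChartAt_target_mem_nhds (I := I) p)] with t ht
      exact (extChartAt I p).right_inv ht
  exact key v

/-- Only the curve inside `S` matters, so `f'` may be any derivative within `S`. It need not be the
only one, which is essential for thin sets such as the composable pairs. -/
theorem HasVelocity.comp_within {c : ℝ → M} {b : TangentBundle I M} (h : HasVelocity c b)
    {S : Set M} (hc : ∀ᶠ t in 𝓝 0, c t ∈ S) {f : M → N}
    {f' : TangentSpace I b.1 →L[ℝ] TangentSpace I' (f b.1)}
    (hf : HasMFDerivWithinAt I I' f S b.1 f') :
    HasVelocity (f ∘ c) (⟨f b.1, f' b.2⟩ : TangentBundle I' N) := by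
  obtain ⟨p, v⟩ := b
  have h0 : c 0 = p := h.1
  have hcS : Filter.Tendsto c (𝓝 0) (𝓝[S] p) :=
    tendsto_nhdsWithin_iff.2 ⟨by have := h.2.1.tendsto; rwa [h0] at this, hc⟩
  refine ⟨congrArg f h0, ?_, ?_⟩
  · have h1 : Filter.Tendsto f (𝓝[S] p) (𝓝 (f p)) := hf.1
    have h2 := h1.comp hcS
    rw [← h0] at h2
    exact h2
  · have hsrc : ∀ᶠ t in 𝓝 0, c t ∈ (extChartAt I p).source := by
      have h1 := h.2.1.tendsto
      rw [h0] at h1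
      exact h1.eventually (extChartAt_source_mem_nhds (I := I) p)
    have hd : HasFDerivWithinAt (writtenInExtChartAt I I' p f) f'
        ((extChartAt I p).symm ⁻¹' S ∩ range I) ((extChartAt I p ∘ c) 0) := by
      have := hf.2
      rw [← h0] at this ⊢
      exact this
    have hm : ∀ᶠ t in 𝓝 (0 : ℝ), (extChartAt I p ∘ c) t ∈
        (extChartAt I p).symm ⁻¹' S ∩ range I := by
      filter_upwards [hsrc, hc] with t h1 h2
      refine ⟨?_, ?_⟩
      · change (extChartAt I p).symm (extChartAt I p (c t)) ∈ S
        rwa [(extChartAt I p).left_inv h1]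
      · exact extChartAt_target_subset_range p ((extChartAt I p).map_source h1)
    have hd' : HasDerivAt (extChartAt I p ∘ c) (show E from v) 0 := h.2.2
    have h3 : HasDerivAt (writtenInExtChartAt I I' p f ∘ (extChartAt I p ∘ c)) (f' v) 0 :=
      HasFDerivWithinAt.comp_hasDerivAt (0 : ℝ) hd hd' hm
    refine h3.congr_of_eventuallyEq ?_
    filter_upwards [hsrc] with t ht
    change _ = extChartAt I' (f p) (f ((extChartAt I p).symm (extChartAt I p (c t))))
    rw [(extChartAt I p).left_inv ht]
    rfl

theorem HasVelocity.comp {c : ℝ → M} {b : TangentBundle I M} (h : HasVelocity c b)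
    {f : M → N} (hf : MDifferentiableAt I I' f b.1) :
    HasVelocity (f ∘ c) (tangentMap I I' f b) :=
  h.comp_within (S := univ) (by simp) hf.hasMFDerivAt.hasMFDerivWithinAt

theorem HasVelocity.prodMk {c : ℝ → M} {d : ℝ → N} {b : TangentBundle I M}
    {b' : TangentBundle I' N} (h : HasVelocity c b) (h' : HasVelocity d b') :
    HasVelocity (fun t ↦ (c t, d t)) ((equivTangentBundleProd I M I' N).symm (b, b')) := by
  refine ⟨Prod.ext h.1 h'.1, h.2.1.prodMk h'.2.1, ?_⟩
  have := h.2.2.prodMk h'.2.2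
  change HasDerivAt (extChartAt (I.prod I') (b.1, b'.1) ∘ (fun t ↦ (c t, d t))) _ 0
  rw [extChartAt_prod]
  exact this

theorem HasVelocity.isTangentTo_univ {c : ℝ → M} {b : TangentBundle I M} (h : HasVelocity c b) :
    IsTangentTo univ b := ⟨c, h, by simp⟩

/-- The derivative within `S` of a map along a vector tangent to `S` is determined by the
restriction of the map to `S`. -/
theorem IsTangentTo.mfderiv_eq {S : Set M} {b : TangentBundle I M} (hb : IsTangentTo S b)
    {S₁ S₂ : Set M} {f₁ f₂ : M → N}
    {f₁' : TangentSpace I b.1 →L[ℝ] TangentSpace I' (f₁ b.1)}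
    {f₂' : TangentSpace I b.1 →L[ℝ] TangentSpace I' (f₂ b.1)}
    (h₁ : HasMFDerivWithinAt I I' f₁ S₁ b.1 f₁') (h₂ : HasMFDerivWithinAt I I' f₂ S₂ b.1 f₂')
    (hS₁ : S ⊆ S₁) (hS₂ : S ⊆ S₂) (h : f₁ =ᶠ[𝓝[S] b.1] f₂) :
    (⟨f₁ b.1, f₁' b.2⟩ : TangentBundle I' N) = ⟨f₂ b.1, f₂' b.2⟩ := by
  obtain ⟨c, hc, hcS⟩ := hb
  refine (hc.comp_within hcS (h₁.mono hS₁)).unique (hc.comp_within hcS (h₂.mono hS₂)) ?_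
  have hcS' : Filter.Tendsto c (𝓝 0) (𝓝[S] b.1) :=
    tendsto_nhdsWithin_iff.2 ⟨by have := hc.2.1.tendsto; rwa [hc.1] at this, hcS⟩
  exact hcS'.eventually h

theorem IsTangentTo.totalDifferential_eq {S : Set M} {b : TangentBundle I M}
    (hb : IsTangentTo S b) {f₁ f₂ : M → F} (h₁ : MDifferentiableAt I 𝓘(ℝ, F) f₁ b.1)
    (h₂ : MDifferentiableAt I 𝓘(ℝ, F) f₂ b.1) (h : f₁ =ᶠ[𝓝[S] b.1] f₂) (hb1 : b.1 ∈ S) :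
    totalDifferential I f₁ b = totalDifferential I f₂ b := by
  have := hb.mfderiv_eq h₁.hasMFDerivAt.hasMFDerivWithinAt h₂.hasMFDerivAt.hasMFDerivWithinAt
    (S₁ := univ) (S₂ := univ) (subset_univ _) (subset_univ _) h
  have h0 : f₁ b.1 = f₂ b.1 := h.eq_of_nhdsWithin hb1
  exact congrArg (fun z : TangentBundle 𝓘(ℝ, F) F ↦ (show F from z.2)) this

theorem totalDifferential_comp {f : M → N} {ψ : N → F} {b : TangentBundle I M}
    (hψ : MDifferentiableAt I' 𝓘(ℝ, F) ψ (f b.1)) (hf : MDifferentiableAt I I' f b.1) :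
    totalDifferential I (ψ ∘ f) b = totalDifferential I' ψ (tangentMap I I' f b) := by
  rw [totalDifferential, mfderiv_comp b.1 hψ hf]
  rfl

theorem eventually_mdifferentiableAt_of_contMDiffAt [IsManifold I ∞ M] [IsManifold I' ∞ N]
    {f : M → N} {p : M} (hf : ContMDiffAt I I' ∞ f p) :
    ∀ᶠ q in 𝓝 p, MDifferentiableAt I I' f q := by
  have h5 : ∀ᶠ q in 𝓝 p, ContMDiffAt I I' 1 f q :=
    (contMDiffAt_iff_contMDiffAt_nhds (by simp)).1
      (hf.of_le (show (1 : WithTop ℕ∞) ≤ ∞ by norm_cast))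
  exact h5.mono fun q hq ↦ hq.mdifferentiableAt (by simp)

/-- Vector fields related by `f` along a set `S` to which they are tangent have related
brackets. -/
theorem mfderiv_mlieBracket_of_related [I.Boundaryless] [IsManifold I ∞ M]
    [I'.Boundaryless] [IsManifold I' ∞ N] {f : M → N} {p : M} {S : Set M}
    {V W : ∀ q : M, TangentSpace I q} {V' W' : ∀ r : N, TangentSpace I' r}
    (hf : ContMDiffAt I I' ∞ f p)
    (hV : ContMDiffAt I I.tangent ∞ (fun q ↦ (⟨q, V q⟩ : TangentBundle I M)) p)
    (hW : ContMDiffAt I I.tangent ∞ (fun q ↦ (⟨q, W q⟩ : TangentBundle I M)) p)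
    (hV' : ContMDiffAt I' I'.tangent ∞ (fun r ↦ (⟨r, V' r⟩ : TangentBundle I' N)) (f p))
    (hW' : ContMDiffAt I' I'.tangent ∞ (fun r ↦ (⟨r, W' r⟩ : TangentBundle I' N)) (f p))
    (hp : p ∈ S) (hVS : IsTangentTo S (⟨p, V p⟩ : TangentBundle I M))
    (hWS : IsTangentTo S (⟨p, W p⟩ : TangentBundle I M))
    (hVV : ∀ᶠ q in 𝓝[S] p, mfderiv I I' f q (V q) = V' (f q))
    (hWW : ∀ᶠ q in 𝓝[S] p, mfderiv I I' f q (W q) = W' (f q)) :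
    mfderiv I I' f p (mlieBracket I V W p) = mlieBracket I' V' W' (f p) := by
  have hχ : ContMDiffAt I' 𝓘(ℝ, E') ∞ (extChartAt I' (f p)) (f p) := contMDiffAt_extChartAt
  have hψ : ContMDiffAt I 𝓘(ℝ, E') ∞ (extChartAt I' (f p) ∘ f) p := hχ.comp p hf
  have hfd := hf.mdifferentiableAt (by simp)
  have key : ∀ (U : ∀ q : M, TangentSpace I q) (U' : ∀ r : N, TangentSpace I' r)
      (X : TangentSpace I p),
      ContMDiffAt I I.tangent ∞ (fun q ↦ (⟨q, U q⟩ : TangentBundle I M)) p →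
      ContMDiffAt I' I'.tangent ∞ (fun r ↦ (⟨r, U' r⟩ : TangentBundle I' N)) (f p) →
      (∀ᶠ q in 𝓝[S] p, mfderiv I I' f q (U q) = U' (f q)) →
      IsTangentTo S (⟨p, X⟩ : TangentBundle I M) →
      totalDifferential I
        (fun q ↦ totalDifferential I (extChartAt I' (f p) ∘ f) ⟨q, U q⟩) ⟨p, X⟩ =
      totalDifferential I' (fun r ↦ totalDifferential I' (extChartAt I' (f p)) ⟨r, U' r⟩)
        ⟨f p, mfderiv I I' f p X⟩ := by
    intro U U' X hU hU' hUU hX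
    have h1 := (contMDiffAt_totalDifferential_extChartAt_comp hU').mdifferentiableAt (by simp)
    have h2 : MDifferentiableAt I 𝓘(ℝ, E')
        (fun q ↦ totalDifferential I (extChartAt I' (f p) ∘ f) ⟨q, U q⟩) p :=
      ((contMDiffAt_totalDifferential (b := (⟨p, U p⟩ : TangentBundle I M)) hψ).comp p
        hU).mdifferentiableAt (by simp)
    have h3 := totalDifferential_comp (b := (⟨p, X⟩ : TangentBundle I M)) h1 hfd
    refine Eq.trans ?_ h3
    -- The derivative of the chart along `U` agrees with the component of `U'` only on `S`. This
    -- suffices, because the outer derivative is taken along a vector tangent to `S`.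
    refine hX.totalDifferential_eq h2 (h1.comp p hfd) ?_ hp
    have h4 : ∀ᶠ q in 𝓝[S] p, MDifferentiableAt I I' f q :=
      nhdsWithin_le_nhds (eventually_mdifferentiableAt_of_contMDiffAt hf)
    have h5 : ∀ᶠ q in 𝓝[S] p, f q ∈ (chartAt H' (f p)).source :=
      nhdsWithin_le_nhds (hf.continuousAt.eventually
        ((chartAt H' (f p)).open_source.mem_nhds (mem_chart_source H' (f p))))
    filter_upwards [hUU, h4, h5] with q hq1 hq2 hq3
    have h6 := totalDifferential_comp (b := (⟨q, U q⟩ : TangentBundle I M))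
      (mdifferentiableAt_extChartAt (I := I') hq3) hq2
    refine h6.trans ?_
    change totalDifferential I' (extChartAt I' (f p)) ⟨f q, mfderiv I I' f q (U q)⟩ = _
    rw [hq1]
    rfl
  have h1 := mfderiv_mlieBracket hψ hV hW
  rw [key W W' (V p) hW hW' hWW hVS, key V V' (W p) hV hV' hVV hWS,
    hVV.self_of_nhdsWithin hp, hWW.self_of_nhdsWithin hp] at h1
  have h2 := mlieBracket_eq_sub hV' hW'
  have h3 := totalDifferential_comp (b := (⟨p, mlieBracket I V W p⟩ : TangentBundle I M))
    (mdifferentiableAt_extChartAt (I := I') (mem_chart_source H' (f p))) hfd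
  have h4 : totalDifferential I' (extChartAt I' (f p))
      (tangentMap I I' f (⟨p, mlieBracket I V W p⟩ : TangentBundle I M)) =
      mfderiv I I' f p (mlieBracket I V W p) :=
    totalDifferential_extChartAt_self
      (tangentMap I I' f (⟨p, mlieBracket I V W p⟩ : TangentBundle I M))
  exact h4.symm.trans (h3.symm.trans (h1.trans h2.symm))

end Velocity

/-! ### Tangent maps of local maps and local sections of submersions -/

section Submersion

variable
    {E : Type*} [NormedAddCommGroup E] [NormedSpace ℝ E]
    {H : Type*} [TopologicalSpace H] {I : ModelWithCorners ℝ E H}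
    {M : Type*} [TopologicalSpace M] [ChartedSpace H M]
    {E' : Type*} [NormedAddCommGroup E'] [NormedSpace ℝ E']
    {H' : Type*} [TopologicalSpace H'] {I' : ModelWithCorners ℝ E' H'}
    {N : Type*} [TopologicalSpace N] [ChartedSpace H' N]

/-- The fibre component of the tangent map is the differential of a chart composed with `f`. The
pointwise form is needed for extensions of the multiplication, which are smooth only near one point.
-/
theorem contMDiffAt_tangentMap [I.Boundaryless] [IsManifold I ∞ M] [IsManifold I' ∞ N]
    {f : M → N} {b : TangentBundle I M} (hf : ContMDiffAt I I' ∞ f b.1) :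
    ContMDiffAt I.tangent I'.tangent ∞ (tangentMap I I' f) b := by
  have hπ := contMDiff_proj (IB := I) (TangentSpace I : M → Type _) (n := ∞) b
  refine (contMDiffAt_totalSpace ..).2 ⟨hf.comp b hπ, ?_⟩
  have hψ : ContMDiffAt I 𝓘(ℝ, E') ∞ (extChartAt I' (f b.1) ∘ f) b.1 :=
    contMDiffAt_extChartAt.comp b.1 hf
  refine (contMDiffAt_totalDifferential (b := b) hψ).congr_of_eventuallyEq ?_
  have h1 : ∀ᶠ c : TangentBundle I M in 𝓝 b, f c.1 ∈ (chartAt H' (f b.1)).source :=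
    (hf.continuousAt.comp hπ.continuousAt).eventually
      ((chartAt H' (f b.1)).open_source.mem_nhds (mem_chart_source H' (f b.1)))
  filter_upwards [h1, hπ.continuousAt.eventually (eventually_mdifferentiableAt_of_contMDiffAt hf)]
    with c hc hd
  rw [totalDifferential_comp (mdifferentiableAt_extChartAt (I := I') hc) hd]
  exact trivializationAt_tangent_snd (b := tangentMap I I' f c) hc

/-- A submersion has a local family of sections through all points of its domain. -/
theorem exists_local_sections [FiniteDimensional ℝ E] [FiniteDimensional ℝ E']
    [I.Boundaryless] [I'.Boundaryless] [IsManifold I ∞ M] [IsManifold I' ∞ N]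
    {f : M → N} {p : M} (hf : ContMDiffAt I I' ∞ f p) (hs : Surjective (mfderiv I I' f p)) :
    ∃ σ : M × N → M, ContMDiffAt (I.prod I') I ∞ σ (p, f p) ∧
      (∀ᶠ z in 𝓝 (p, f p), f (σ z) = z.2) ∧ ∀ᶠ q in 𝓝 p, σ (q, f q) = q := by
  set g : E → E' := extChartAt I' (f p) ∘ f ∘ (extChartAt I p).symm with hgdef
  set z₀ := extChartAt I p p with hz₀
  have hg : ContDiffAt ℝ ∞ g z₀ :=
    contDiffAt_comp_extChartAt_symm (ψ := extChartAt I' (f p) ∘ f)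
      (contMDiffAt_extChartAt.comp p hf)
  have hfd := hf.mdifferentiableAt (by simp : (∞ : WithTop ℕ∞) ≠ 0)
  have hA : Surjective (fderiv ℝ g z₀) := by
    have h1 : (fderivWithin ℝ (writtenInExtChartAt I I' p f) (range I) z₀ : E →L[ℝ] E') =
        mfderiv I I' f p := hfd.mfderiv.symm
    rw [I.range_eq_univ, fderivWithin_univ] at h1
    intro w
    obtain ⟨v, hv⟩ := hs w
    exact ⟨v, (DFunLike.congr_fun h1 v).trans hv⟩
  -- A linear map `Q` completes the derivative to an isomorphism, and the inverse function theorem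
  -- applies to `(g, Q)`.
  obtain ⟨Q, T, hT⟩ := LieGroupoid.exists_completion _ hA
  set Ψ : E → E' × LieGroupoid.AlgebroidModel E E' := fun z ↦ (g z, Q z) with hΨdef
  have hΨ : ContDiffAt ℝ ∞ Ψ z₀ := hg.prodMk Q.contDiff.contDiffAt
  have hΨ' : HasFDerivAt Ψ (T : E →L[ℝ] E' × LieGroupoid.AlgebroidModel E E') z₀ := by
    rw [hT]
    exact (hg.differentiableAt (by simp)).hasFDerivAt.prodMk Q.hasFDerivAt
  have hn : (∞ : WithTop ℕ∞) ≠ 0 := by simp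
  set R := hΨ.localInverse hΨ' hn with hR
  have hRd : ContDiffAt ℝ ∞ R (Ψ z₀) := hΨ.to_localInverse hΨ' hn
  have hstrict := hΨ.hasStrictFDerivAt' hΨ' hn
  have hR1 : ∀ᶠ y in 𝓝 (Ψ z₀), Ψ (R y) = y := hstrict.eventually_right_inverse
  have hR2 : ∀ᶠ z in 𝓝 z₀, R (Ψ z) = z := hstrict.eventually_left_inverse
  have hR0 : R (Ψ z₀) = z₀ := hR2.self_of_nhds
  have hg0 : g z₀ = extChartAt I' (f p) (f p) := by
    simp only [hgdef, comp_apply, hz₀, extChartAt_to_inv]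
  -- The section keeps the `Q`-coordinate of the first argument and prescribes the second argument
  -- as value of `f`. If the value already is `f q`, the point `q` is returned.
  let κ : M × N → E' × LieGroupoid.AlgebroidModel E E' :=
    fun z ↦ (extChartAt I' (f p) z.2, Q (extChartAt I p z.1))
  have hκ0 : κ (p, f p) = Ψ z₀ := Prod.ext hg0.symm rfl
  have hκ : ContMDiffAt (I.prod I') 𝓘(ℝ, E' × LieGroupoid.AlgebroidModel E E') ∞ κ (p, f p) := by
    have h1 : ContMDiffAt (I.prod I') 𝓘(ℝ, E') ∞ (fun z : M × N ↦ extChartAt I' (f p) z.2)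
        (p, f p) := (contMDiffAt_extChartAt (I := I') (x := f p)).comp (p, f p) contMDiffAt_snd
    have h2 : ContMDiffAt (I.prod I') 𝓘(ℝ, E) ∞ (fun z : M × N ↦ extChartAt I p z.1)
        (p, f p) := (contMDiffAt_extChartAt (I := I) (x := p)).comp (p, f p) contMDiffAt_fst
    exact h1.prodMk_space ((Q.contMDiff (n := ∞)).contMDiffAt.comp (p, f p) h2)
  have hRκ : ContMDiffAt (I.prod I') 𝓘(ℝ, E) ∞ (R ∘ κ) (p, f p) :=
    ContMDiffAt.comp (p, f p) (by rw [hκ0]; exact hRd.contMDiffAt) hκ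
  have hRκ0 : (R ∘ κ) (p, f p) = z₀ := by rw [comp_apply, hκ0, hR0]
  have hsymm : ContMDiffAt 𝓘(ℝ, E) I ∞ (extChartAt I p).symm z₀ :=
    (contMDiffOn_extChartAt_symm p).contMDiffAt (extChartAt_target_mem_nhds p)
  have hσ : ContMDiffAt (I.prod I') I ∞ ((extChartAt I p).symm ∘ (R ∘ κ)) (p, f p) :=
    ContMDiffAt.comp (p, f p) (by rw [hRκ0]; exact hsymm) hRκ
  have hσ0 : ((extChartAt I p).symm ∘ (R ∘ κ)) (p, f p) = p := by
    rw [comp_apply, hRκ0, hz₀, extChartAt_to_inv]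
  refine ⟨(extChartAt I p).symm ∘ (R ∘ κ), hσ, ?_, ?_⟩
  · have h1 : ∀ᶠ z in 𝓝 (p, f p), Ψ (R (κ z)) = κ z := by
      have := hκ.continuousAt.tendsto
      rw [hκ0] at this
      exact this.eventually hR1
    have h2 : ∀ᶠ z in 𝓝 (p, f p), f (((extChartAt I p).symm ∘ (R ∘ κ)) z) ∈
        (extChartAt I' (f p)).source := by
      have h3 : ContinuousAt (f ∘ ((extChartAt I p).symm ∘ (R ∘ κ))) (p, f p) :=
        ContinuousAt.comp (by rw [hσ0]; exact hf.continuousAt) hσ.continuousAt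
      refine h3.eventually ?_
      rw [comp_apply, hσ0]
      exact extChartAt_source_mem_nhds (f p)
    have h3 : ∀ᶠ z : M × N in 𝓝 (p, f p), z.2 ∈ (extChartAt I' (f p)).source :=
      continuousAt_snd.eventually (extChartAt_source_mem_nhds (I := I') (f p))
    filter_upwards [h1, h2, h3] with z hz1 hz2 hz3
    exact (extChartAt I' (f p)).injOn hz2 hz3 (congrArg Prod.fst hz1)
  · have h1 : ∀ᶠ q in 𝓝 p, q ∈ (extChartAt I p).source := extChartAt_source_mem_nhds p
    have h2 : ∀ᶠ q in 𝓝 p, R (Ψ (extChartAt I p q)) = extChartAt I p q :=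
      (continuousAt_extChartAt (I := I) p).eventually hR2
    filter_upwards [h1, h2] with q hq1 hq2
    have h3 : κ (q, f q) = Ψ (extChartAt I p q) := by
      refine Prod.ext ?_ rfl
      change _ = extChartAt I' (f p) (f ((extChartAt I p).symm (extChartAt I p q)))
      rw [(extChartAt I p).left_inv hq1]
    rw [comp_apply, comp_apply, h3, hq2, (extChartAt I p).left_inv hq1]

end Submersion

/-! ### Lifting curves along submersions -/

section Lifting

variable
    {E : Type*} [NormedAddCommGroup E] [NormedSpace ℝ E]
    {H : Type*} [TopologicalSpace H] {I : ModelWithCorners ℝ E H}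
    {M : Type*} [TopologicalSpace M] [ChartedSpace H M]
    {E' : Type*} [NormedAddCommGroup E'] [NormedSpace ℝ E']
    {H' : Type*} [TopologicalSpace H'] {I' : ModelWithCorners ℝ E' H'}
    {N : Type*} [TopologicalSpace N] [ChartedSpace H' N]

theorem TangentBundle.snd_eq_of_mk_eq {W : ∀ q : M, TangentSpace I q} {p q : M}
    {v : TangentSpace I p} (h : (⟨p, v⟩ : TangentBundle I M) = ⟨q, W q⟩) : v = W p := by
  obtain rfl : p = q := congrArg TotalSpace.proj h
  simpa using h

theorem hasVelocity_const (p : M) :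
    HasVelocity (fun _ ↦ p) (⟨p, 0⟩ : TangentBundle I M) :=
  ⟨rfl, continuousAt_const, hasDerivAt_const _ _⟩

/-- Curves can be lifted along submersions with a prescribed initial velocity. -/
theorem HasVelocity.exists_lift [FiniteDimensional ℝ E] [FiniteDimensional ℝ E']
    [I.Boundaryless] [I'.Boundaryless] [IsManifold I ∞ M] [IsManifold I' ∞ N]
    {f : M → N} {b : TangentBundle I M} {d : ℝ → N} (hd : HasVelocity d (tangentMap I I' f b))
    (hf : ContMDiffAt I I' ∞ f b.1) (hs : Surjective (mfderiv I I' f b.1)) :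
    ∃ c : ℝ → M, HasVelocity c b ∧ ∀ᶠ t in 𝓝 0, f (c t) = d t := by
  obtain ⟨σ, hσ, hσ1, hσ2⟩ := exists_local_sections hf hs
  obtain ⟨c, hc⟩ := exists_hasVelocity b
  have hσd : MDifferentiableAt (I.prod I') I σ (b.1, f b.1) := hσ.mdifferentiableAt (by simp)
  have hfd : MDifferentiableAt I I' f b.1 := hf.mdifferentiableAt (by simp)
  -- The lift is `σ (c, d)`. Its velocity depends only on those of `c` and `d`, and `d` has the same
  -- velocity as `f ∘ c`. Since `σ (c, f ∘ c) = c` for small times, the velocity is `b`.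
  have h1 := (hc.prodMk hd).comp (f := σ) hσd
  have h2 := (hc.prodMk (hc.comp hfd)).comp (f := σ) hσd
  have hc0 : Filter.Tendsto c (𝓝 0) (𝓝 b.1) := by
    have := hc.2.1.tendsto
    rwa [hc.1] at this
  have hd0 : Filter.Tendsto d (𝓝 0) (𝓝 (f b.1)) := by
    have := hd.2.1.tendsto
    rwa [hd.1] at this
  have h3 := h2.unique hc (hc0.eventually hσ2)
  rw [h3] at h1
  exact ⟨_, h1, (hc0.prodMk_nhds hd0).eventually hσ1⟩

/-- The constant curve at `n` is lifted with initial velocity `b`. -/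
theorem isTangentTo_fibre [FiniteDimensional ℝ E] [FiniteDimensional ℝ E']
    [I.Boundaryless] [I'.Boundaryless] [IsManifold I ∞ M] [IsManifold I' ∞ N]
    {f : M → N} {b : TangentBundle I M}
    (hf : ContMDiffAt I I' ∞ f b.1) (hs : Surjective (mfderiv I I' f b.1))
    (hb : mfderiv I I' f b.1 b.2 = 0) {n : N} (hn : f b.1 = n) :
    IsTangentTo {q | f q = n} b := by
  subst hn
  have hd : HasVelocity (fun _ ↦ f b.1) (tangentMap I I' f b) := by
    rw [tangentMap, hb]
    exact hasVelocity_const _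
  exact hd.exists_lift hf hs

end Lifting

/-! ### Right translation of source-vertical vectors -/

namespace LieGroupoid

variable
    {EG : Type*} [NormedAddCommGroup EG] [NormedSpace ℝ EG]
    {HG : Type*} [TopologicalSpace HG] {IG : ModelWithCorners ℝ EG HG}
    {G : Type*} [TopologicalSpace G] [ChartedSpace HG G]
    {EM : Type*} [NormedAddCommGroup EM] [NormedSpace ℝ EM]
    {HM : Type*} [TopologicalSpace HM] {IM : ModelWithCorners ℝ EM HM}
    {M : Type*} [TopologicalSpace M] [ChartedSpace HM M]
    (𝒢 : LieGroupoid IG G IM M)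

/-- The set of composable pairs. -/
def composable : Set (G × G) := {p | 𝒢.src p.1 = 𝒢.tgt p.2}

/-- The tangent map of the right translation by `g`, defined on source fibres. -/
def rightMul (g : G) (b : TangentBundle IG G) : TangentBundle IG G :=
  ⟨𝒢.mul b.1 g, mfderivWithin IG IG (fun h ↦ 𝒢.mul h g) {h | 𝒢.src h = 𝒢.tgt g} b.1 b.2⟩

theorem mdifferentiable_src : MDifferentiable IG IM 𝒢.src :=
  𝒢.contMDiff_src.mdifferentiable (by simp)

theorem mdifferentiable_tgt : MDifferentiable IG IM 𝒢.tgt :=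
  𝒢.contMDiff_tgt.mdifferentiable (by simp)

theorem mdifferentiable_one : MDifferentiable IM IG 𝒢.one :=
  𝒢.contMDiff_one.mdifferentiable (by simp)

theorem mdifferentiableWithinAt_mul {z : G × G} (hz : z ∈ 𝒢.composable) :
    MDifferentiableWithinAt (IG.prod IG) IG (fun p : G × G ↦ 𝒢.mul p.1 p.2) 𝒢.composable z :=
  (𝒢.contMDiffOn_mul z hz).mdifferentiableWithinAt (by simp)

theorem mdifferentiableWithinAt_rightTranslation {h g : G} (hh : 𝒢.src h = 𝒢.tgt g) :
    MDifferentiableWithinAt IG IG (fun h ↦ 𝒢.mul h g) {h | 𝒢.src h = 𝒢.tgt g} h := by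
  have h1 : ContMDiffWithinAt IG (IG.prod IG) ∞ (fun h ↦ (h, g)) {h | 𝒢.src h = 𝒢.tgt g} h :=
    contMDiffWithinAt_id.prodMk contMDiffWithinAt_const
  exact ((𝒢.contMDiffOn_mul (h, g) hh).comp h h1 fun _ hk ↦ hk).mdifferentiableWithinAt (by simp)

theorem hasVelocity_rightMul {c : ℝ → G} {b : TangentBundle IG G} (hc : HasVelocity c b) {g : G}
    (hb : 𝒢.src b.1 = 𝒢.tgt g) (hcg : ∀ᶠ t in 𝓝 0, 𝒢.src (c t) = 𝒢.tgt g) :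
    HasVelocity (fun t ↦ 𝒢.mul (c t) g) (𝒢.rightMul g b) :=
  hc.comp_within hcg (𝒢.mdifferentiableWithinAt_rightTranslation hb).hasMFDerivWithinAt

/-- The derivative within the composable pairs is not determined on all of the tangent space of `G ×
G`. On vectors tangent to the set it is, and there it agrees with the derivative of any extension.
-/
theorem tangentMap_mul_extension {m : G × G → G} {b : TangentBundle (IG.prod IG) (G × G)}
    (hm : MDifferentiableAt (IG.prod IG) IG m b.1)
    (hm' : ∀ᶠ z in 𝓝 b.1, z ∈ 𝒢.composable → m z = 𝒢.mul z.1 z.2)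
    (hb : b.1 ∈ 𝒢.composable) (ht : IsTangentTo 𝒢.composable b) :
    tangentMap (IG.prod IG) IG m b = ⟨𝒢.mul b.1.1 b.1.2,
      mfderivWithin (IG.prod IG) IG (fun p : G × G ↦ 𝒢.mul p.1 p.2) 𝒢.composable b.1 b.2⟩ :=
  ht.mfderiv_eq (S₁ := univ) (S₂ := 𝒢.composable) hm.hasMFDerivAt.hasMFDerivWithinAt
    (𝒢.mdifferentiableWithinAt_mul hb).hasMFDerivWithinAt (subset_univ _) subset_rfl
    (eventually_nhdsWithin_iff.2 hm')

/-- The right-invariant vector field of a section, as a map to the tangent bundle. -/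
theorem mk_rightInvariant (X : ∀ m, 𝒢.Algebroid m) (g : G) :
    (⟨g, 𝒢.rightInvariant X g⟩ : TangentBundle IG G) =
      𝒢.rightMul g (𝒢.totalIncl ⟨𝒢.tgt g, X (𝒢.tgt g)⟩) := by
  have key : ∀ {g' : G} (h : g' = g) (v : TangentSpace IG g'),
      (⟨g, h ▸ v⟩ : TangentBundle IG G) = ⟨g', v⟩ := by
    rintro _ rfl v
    rfl
  exact key (𝒢.one_mul g) _

theorem src_totalIncl (a : TotalSpace (AlgebroidModel EG EM) 𝒢.Algebroid) :
    𝒢.src (𝒢.totalIncl a).1 = a.1 := 𝒢.src_one a.1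

theorem mfderiv_src_totalIncl (a : TotalSpace (AlgebroidModel EG EM) 𝒢.Algebroid) :
    mfderiv IG IM 𝒢.src (𝒢.totalIncl a).1 (𝒢.totalIncl a).2 = 0 := 𝒢.mfderiv_src_incl a.1 a.2

theorem totalIncl_injective : Injective 𝒢.totalIncl := by
  rintro ⟨m, a⟩ ⟨m', a'⟩ h
  obtain rfl : m = m' := by
    have h1 : 𝒢.one m = 𝒢.one m' := congrArg TotalSpace.proj h
    rw [← 𝒢.src_one m, h1, 𝒢.src_one]
  have h2 : 𝒢.incl m a = 𝒢.incl m a' := by simpa [totalIncl] using h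
  rw [𝒢.incl_injective m h2]

theorem mfderiv_src_mfderiv_one (m : M) (u : TangentSpace IM m) :
    (show EM from mfderiv IG IM 𝒢.src (𝒢.one m) (mfderiv IM IG 𝒢.one m u)) = u := by
  have h := mfderiv_comp m (𝒢.mdifferentiable_src (𝒢.one m)) (𝒢.mdifferentiable_one m)
  have h1 : 𝒢.src ∘ 𝒢.one = id := funext 𝒢.src_one
  have h2 : tangentMap IM IM (𝒢.src ∘ 𝒢.one) ⟨m, u⟩ = ⟨m, u⟩ := by
    rw [h1, tangentMap_id]
    rfl
  rw [tangentMap, h] at h2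
  have h3 := congrArg (fun z : TangentBundle IM M ↦ (show EM from z.2)) h2
  exact h3

theorem mfderiv_one_injective (m : M) : Injective (mfderiv IM IG 𝒢.one m) := by
  intro u u' h
  have h1 := 𝒢.mfderiv_src_mfderiv_one m u
  rw [h] at h1
  exact h1.symm.trans (𝒢.mfderiv_src_mfderiv_one m u')

variable [IsManifold IG ∞ G] [IsManifold IM ∞ M]
  [FiniteDimensional ℝ EG] [FiniteDimensional ℝ EM] [IG.Boundaryless] [IM.Boundaryless]

theorem exists_velocity_in_srcFibre {b : TangentBundle IG G}
    (hb : mfderiv IG IM 𝒢.src b.1 b.2 = 0) {m : M} (hm : 𝒢.src b.1 = m) :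
    ∃ c : ℝ → G, HasVelocity c b ∧ ∀ᶠ t in 𝓝 0, 𝒢.src (c t) = m :=
  isTangentTo_fibre 𝒢.contMDiff_src.contMDiffAt (𝒢.src_submersion b.1) hb hm

/-- Project a curve with velocity `b'` by the target and lift the result along the source submersion
with initial velocity `b`. This replaces the description of the tangent space of the submanifold of
composable pairs. -/
theorem isTangentTo_composable {b b' : TangentBundle IG G}
    (h : tangentMap IG IM 𝒢.src b = tangentMap IG IM 𝒢.tgt b') :
    IsTangentTo 𝒢.composable ((equivTangentBundleProd IG G IG G).symm (b, b')) := by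
  obtain ⟨c', hc'⟩ := exists_hasVelocity b'
  have hd := hc'.comp (𝒢.mdifferentiable_tgt b'.1)
  rw [← h] at hd
  obtain ⟨c, hc, hcs⟩ := hd.exists_lift 𝒢.contMDiff_src.contMDiffAt (𝒢.src_submersion b.1)
  exact ⟨_, hc.prodMk hc', hcs⟩

/-- The multiplication extends locally to a smooth map on `G × G`. -/
theorem exists_mul_extension {h g : G} (hc : 𝒢.src h = 𝒢.tgt g) :
    ∃ m : G × G → G, ContMDiffAt (IG.prod IG) IG ∞ m (h, g) ∧
      ∀ᶠ z in 𝓝 (h, g), z ∈ 𝒢.composable → m z = 𝒢.mul z.1 z.2 := by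
  obtain ⟨σ, hσ, hσ1, hσ2⟩ := exists_local_sections
    (𝒢.contMDiff_src.contMDiffAt (x := h)) (𝒢.src_submersion h)
  have h1 : ContMDiffAt (IG.prod IG) (IG.prod IM) ∞ (fun z : G × G ↦ (z.1, 𝒢.tgt z.2)) (h, g) :=
    contMDiffAt_fst.prodMk (𝒢.contMDiff_tgt.contMDiffAt.comp (h, g) contMDiffAt_snd)
  have h1' : Filter.Tendsto (fun z : G × G ↦ (z.1, 𝒢.tgt z.2)) (𝓝 (h, g))
      (𝓝 (h, 𝒢.src h)) := by
    have := h1.continuousAt.tendsto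
    rwa [← hc] at this
  have h2 : ContMDiffAt (IG.prod IG) IG ∞ (fun z : G × G ↦ σ (z.1, 𝒢.tgt z.2)) (h, g) :=
    hσ.comp_of_eq h1 (by rw [hc])
  have h3 : ContMDiffAt (IG.prod IG) (IG.prod IG) ∞
      (fun z : G × G ↦ (σ (z.1, 𝒢.tgt z.2), z.2)) (h, g) := h2.prodMk contMDiffAt_snd
  have h0 : σ (h, 𝒢.tgt g) = h := by
    rw [← hc]
    exact hσ2.self_of_nhds
  -- The local section moves the first factor into the source fibre over the target of the second
  -- one. A factor that already lies there is not moved.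
  refine ⟨fun z ↦ 𝒢.mul (σ (z.1, 𝒢.tgt z.2)) z.2, ?_, ?_⟩
  · have hS : ∀ᶠ z : G × G in 𝓝 (h, g), (σ (z.1, 𝒢.tgt z.2), z.2) ∈ 𝒢.composable :=
      h1'.eventually hσ1
    set T : Set (G × G) := {z | (σ (z.1, 𝒢.tgt z.2), z.2) ∈ 𝒢.composable} with hT
    have h4 := (𝒢.contMDiffOn_mul (h, g) hc).comp_of_eq (s := T) (x := (h, g))
      (f := fun z : G × G ↦ (σ (z.1, 𝒢.tgt z.2), z.2))
      h3.contMDiffWithinAt (fun z hz ↦ hz) (by rw [h0])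
    exact h4.contMDiffAt hS
  · have h4 : ∀ᶠ z : G × G in 𝓝 (h, g), σ (z.1, 𝒢.src z.1) = z.1 :=
      (continuousAt_fst (p := ((h, g) : G × G))).eventually hσ2
    filter_upwards [h4] with z hz hzS
    have : 𝒢.src z.1 = 𝒢.tgt z.2 := hzS
    rw [← this, hz]

/-- Right translation becomes the derivative of one locally defined map along `(b, 0)`. In this form
it depends smoothly on `g`, and the calculus of related fields applies to it. -/
theorem rightMul_eq_tangentMap {m : G × G → G} {b : TangentBundle IG G} {g : G}
    (hm : MDifferentiableAt (IG.prod IG) IG m (b.1, g))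
    (hm' : ∀ᶠ z in 𝓝 (b.1, g), z ∈ 𝒢.composable → m z = 𝒢.mul z.1 z.2)
    (hb : 𝒢.src b.1 = 𝒢.tgt g) (hb' : mfderiv IG IM 𝒢.src b.1 b.2 = 0) :
    𝒢.rightMul g b = tangentMap (IG.prod IG) IG m
      ((equivTangentBundleProd IG G IG G).symm (b, ⟨g, 0⟩)) := by
  obtain ⟨c, hc, hcs⟩ := 𝒢.exists_velocity_in_srcFibre hb' hb
  refine (𝒢.hasVelocity_rightMul hc hb hcs).unique
    ((hc.prodMk (hasVelocity_const g)).comp (f := m) hm) ?_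
  have h1 : Filter.Tendsto (fun t ↦ (c t, g)) (𝓝 0) (𝓝 (b.1, g)) := by
    have := hc.2.1.tendsto
    rw [hc.1] at this
    exact this.prodMk_nhds tendsto_const_nhds
  filter_upwards [hcs, h1.eventually hm'] with t h2 h3
  exact (h3 h2).symm

/-- Associativity, applied along a curve in a source fibre. The identities below for source, target
and unit are obtained in the same way. -/
theorem rightMul_rightMul {b : TangentBundle IG G} {h g : G} (hb : 𝒢.src b.1 = 𝒢.tgt h)
    (hb' : mfderiv IG IM 𝒢.src b.1 b.2 = 0) (hg : 𝒢.src h = 𝒢.tgt g) :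
    𝒢.rightMul g (𝒢.rightMul h b) = 𝒢.rightMul (𝒢.mul h g) b := by
  obtain ⟨c, hc, hcs⟩ := 𝒢.exists_velocity_in_srcFibre hb' hb
  have hhg := 𝒢.tgt_mul h g hg
  have h1 := 𝒢.hasVelocity_rightMul (g := 𝒢.mul h g) hc (by rw [hb, hhg]) (by rwa [hhg])
  have h2 : ∀ᶠ t in 𝓝 0, 𝒢.src (𝒢.mul (c t) h) = 𝒢.tgt g := by
    filter_upwards [hcs] with t ht
    rw [𝒢.src_mul _ _ ht, hg]
  have h3 := 𝒢.hasVelocity_rightMul (𝒢.hasVelocity_rightMul hc hb hcs) (g := g)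
    (by change 𝒢.src (𝒢.mul b.1 h) = _; rw [𝒢.src_mul _ _ hb, hg]) h2
  refine h3.unique h1 ?_
  filter_upwards [hcs] with t ht
  exact 𝒢.mul_assoc _ _ _ ht hg

theorem tangentMap_src_rightMul {b : TangentBundle IG G} {g : G} (hb : 𝒢.src b.1 = 𝒢.tgt g)
    (hb' : mfderiv IG IM 𝒢.src b.1 b.2 = 0) :
    tangentMap IG IM 𝒢.src (𝒢.rightMul g b) = ⟨𝒢.src g, 0⟩ := by
  obtain ⟨c, hc, hcs⟩ := 𝒢.exists_velocity_in_srcFibre hb' hb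
  refine ((𝒢.hasVelocity_rightMul hc hb hcs).comp (𝒢.mdifferentiable_src _)).unique
    (hasVelocity_const _) ?_
  filter_upwards [hcs] with t ht
  exact 𝒢.src_mul _ _ ht

theorem tangentMap_tgt_rightMul {b : TangentBundle IG G} {g : G} (hb : 𝒢.src b.1 = 𝒢.tgt g)
    (hb' : mfderiv IG IM 𝒢.src b.1 b.2 = 0) :
    tangentMap IG IM 𝒢.tgt (𝒢.rightMul g b) = tangentMap IG IM 𝒢.tgt b := by
  obtain ⟨c, hc, hcs⟩ := 𝒢.exists_velocity_in_srcFibre hb' hb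
  refine ((𝒢.hasVelocity_rightMul hc hb hcs).comp (𝒢.mdifferentiable_tgt _)).unique
    (hc.comp (𝒢.mdifferentiable_tgt _)) ?_
  filter_upwards [hcs] with t ht
  exact 𝒢.tgt_mul _ _ ht

theorem rightMul_one {b : TangentBundle IG G} {m : M} (hb : 𝒢.src b.1 = m)
    (hb' : mfderiv IG IM 𝒢.src b.1 b.2 = 0) : 𝒢.rightMul (𝒢.one m) b = b := by
  have hm : 𝒢.src b.1 = 𝒢.tgt (𝒢.one m) := by rw [hb, 𝒢.tgt_one]
  obtain ⟨c, hc, hcs⟩ := 𝒢.exists_velocity_in_srcFibre hb' hm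
  refine (𝒢.hasVelocity_rightMul hc hm hcs).unique hc ?_
  filter_upwards [hcs] with t ht
  rw [𝒢.tgt_one] at ht
  have := 𝒢.mul_one (c t)
  rwa [ht] at this

theorem mfderiv_src_rightInvariant (X : ∀ m, 𝒢.Algebroid m) (g : G) :
    mfderiv IG IM 𝒢.src g (𝒢.rightInvariant X g) = 0 := by
  have h := 𝒢.tangentMap_src_rightMul (g := g) (𝒢.src_totalIncl _)
    (𝒢.mfderiv_src_totalIncl ⟨𝒢.tgt g, X (𝒢.tgt g)⟩)
  rw [← 𝒢.mk_rightInvariant] at h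
  exact TangentBundle.snd_eq_of_mk_eq (W := fun _ ↦ 0) h

theorem rightInvariant_one (X : ∀ m, 𝒢.Algebroid m) (m : M) :
    𝒢.rightInvariant X (𝒢.one m) = 𝒢.incl m (X m) := by
  have h := 𝒢.mk_rightInvariant X (𝒢.one m)
  rw [𝒢.tgt_one, 𝒢.rightMul_one (𝒢.src_totalIncl ⟨m, X m⟩) (𝒢.mfderiv_src_totalIncl _)] at h
  simpa [totalIncl] using h

theorem rightMul_rightInvariant (X : ∀ m, 𝒢.Algebroid m) {h g : G} (hc : 𝒢.src h = 𝒢.tgt g) :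
    𝒢.rightMul g ⟨h, 𝒢.rightInvariant X h⟩ =
      ⟨𝒢.mul h g, 𝒢.rightInvariant X (𝒢.mul h g)⟩ := by
  rw [𝒢.mk_rightInvariant, 𝒢.mk_rightInvariant,
    𝒢.rightMul_rightMul (𝒢.src_totalIncl _) (𝒢.mfderiv_src_totalIncl _) hc, 𝒢.tgt_mul _ _ hc]

end LieGroupoid

/-! ### Smoothness of the inclusion of AG and of right-invariant fields -/

namespace LieGroupoid

variable
    {EG : Type*} [NormedAddCommGroup EG] [NormedSpace ℝ EG]
    {HG : Type*} [TopologicalSpace HG] {IG : ModelWithCorners ℝ EG HG}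
    {G : Type*} [TopologicalSpace G] [ChartedSpace HG G]
    {EM : Type*} [NormedAddCommGroup EM] [NormedSpace ℝ EM]
    {HM : Type*} [TopologicalSpace HM] {IM : ModelWithCorners ℝ EM HM}
    {M : Type*} [TopologicalSpace M] [ChartedSpace HM M]
    {E : Type*} [NormedAddCommGroup E] [NormedSpace ℝ E]
    {H : Type*} [TopologicalSpace H] {I : ModelWithCorners ℝ E H}
    {N : Type*} [TopologicalSpace N] [ChartedSpace H N]
    (𝒢 : LieGroupoid IG G IM M)
    [IsManifold IG ∞ G] [IsManifold IM ∞ M]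
    [FiniteDimensional ℝ EG] [FiniteDimensional ℝ EM]

/-- A vector-valued function on `G` whose differential gives the fibre coordinate of the local
trivialization of the Lie algebroid around `m₀`. -/
def fibreFun (m₀ : M) : G → AlgebroidModel EG EM :=
  𝒢.fibreCoord m₀ ∘ extChartAt IG (𝒢.one m₀)

theorem contMDiffAt_fibreFun {m₀ : M} {g : G} (hg : g ∈ (chartAt HG (𝒢.one m₀)).source) :
    ContMDiffAt IG 𝓘(ℝ, AlgebroidModel EG EM) ∞ (𝒢.fibreFun m₀) g :=
  ((𝒢.fibreCoord m₀).contMDiff (n := ∞)).contMDiffAt.comp g (contMDiffAt_extChartAt' hg)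

theorem one_mem_chart_source {m₀ m : M} (hm : m ∈ 𝒢.trivDomain m₀) :
    𝒢.one m ∈ (chartAt HG (𝒢.one m₀)).source := by
  have h : 𝒢.one m ∈ (trivializationAt EG (TangentSpace IG) (𝒢.one m₀)).baseSet := hm.1.1
  rwa [TangentBundle.trivializationAt_baseSet] at h

/-- The fibre coordinate is a fixed linear map of the chart coordinates, and a linear map commutes
with differentiation. So the coordinate on AG is the restriction of an exact differential on TG, on
which ξ and the bracket act by derivations. -/
theorem trivializationAt_snd {m₀ : M} {a : TotalSpace (AlgebroidModel EG EM) 𝒢.Algebroid}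
    (ha : a.1 ∈ 𝒢.trivDomain m₀) :
    (trivializationAt (AlgebroidModel EG EM) 𝒢.Algebroid m₀ a).2 =
      totalDifferential IG (𝒢.fibreFun m₀) (𝒢.totalIncl a) := by
  have hg := 𝒢.one_mem_chart_source ha
  have h1 : totalDifferential IG (𝒢.fibreFun m₀) (𝒢.totalIncl a) =
      𝒢.fibreCoord m₀ (totalDifferential IG (extChartAt IG (𝒢.one m₀)) (𝒢.totalIncl a)) := by
    have h := ((𝒢.fibreCoord m₀).hasFDerivAt.hasMFDerivAt.comp (𝒢.one a.1)
      (mdifferentiableAt_extChartAt (I := IG) hg).hasMFDerivAt).mfderiv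
    exact DFunLike.congr_fun h (𝒢.incl a.1 a.2)
  rw [h1]
  refine congrArg (𝒢.fibreCoord m₀) ?_
  exact DFunLike.congr_fun (TangentBundle.continuousLinearMapAt_trivializationAt
    (I := IG) (𝕜 := ℝ) hg) (𝒢.incl a.1 a.2)

theorem contMDiffAt_frame_inverse {m₀ m : M} (hm : m ∈ 𝒢.trivDomain m₀) :
    ContMDiffAt IM 𝓘(ℝ, EM × AlgebroidModel EG EM →L[ℝ] EG) ∞
      (fun m ↦ (𝒢.frame m₀ m).inverse) m := by
  have hi : ContDiffAt ℝ ∞ ContinuousLinearMap.inverse (𝒢.frame m₀ m) :=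
    ContinuousLinearMap.IsInvertible.contDiffAt_map_inverse hm.2
  exact hi.contMDiffAt.comp m
    ((𝒢.contMDiffOn_frame m₀).contMDiffAt ((𝒢.isOpen_coordDomain m₀).mem_nhds hm.1))

/-- The inclusion in coordinates. Its base dependence is confined to the smooth family of inverse
frames, from which both its smoothness and its vertical derivative are read off. -/
theorem trivializationAt_totalIncl_snd {m₀ : M}
    {a : TotalSpace (AlgebroidModel EG EM) 𝒢.Algebroid} (ha : a.1 ∈ 𝒢.trivDomain m₀) :
    (trivializationAt EG (TangentSpace IG) (𝒢.one m₀) (𝒢.totalIncl a)).2 =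
      (𝒢.frame m₀ a.1).inverse
        (0, (trivializationAt (AlgebroidModel EG EM) 𝒢.Algebroid m₀ a).2) := by
  have h1 := 𝒢.incl_fromFibre ha (𝒢.toFibre m₀ a.1 a.2)
  rw [𝒢.fromFibre_toFibre ha, fromFibreAux] at h1
  have h2 := congrArg ((trivializationAt EG (TangentSpace IG) (𝒢.one m₀)).continuousLinearMapAt ℝ
    (𝒢.one a.1)) h1
  rw [Trivialization.continuousLinearMapAt_symmL _ ha.1.1] at h2
  rw [Trivialization.continuousLinearMapAt_apply_of_mem ℝ _ ha.1.1] at h2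
  exact h2

theorem contMDiff_totalIncl :
    ContMDiff (IM.prod 𝓘(ℝ, AlgebroidModel EG EM)) IG.tangent ∞ 𝒢.totalIncl := by
  intro a
  have hπ : ContMDiffAt (IM.prod 𝓘(ℝ, AlgebroidModel EG EM)) IM ∞
      (π (AlgebroidModel EG EM) 𝒢.Algebroid) a := contMDiff_proj 𝒢.Algebroid a
  refine (contMDiffAt_totalSpace ..).2 ⟨𝒢.contMDiff_one.contMDiffAt.comp a hπ, ?_⟩
  have h1 : ContMDiffAt (IM.prod 𝓘(ℝ, AlgebroidModel EG EM)) 𝓘(ℝ, AlgebroidModel EG EM) ∞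
      (fun b ↦ (trivializationAt (AlgebroidModel EG EM) 𝒢.Algebroid a.1 b).2) a :=
    contMDiffAt_trivialization_snd (𝒢.mem_trivDomain a.1)
  have h2 : ContMDiffAt (IM.prod 𝓘(ℝ, AlgebroidModel EG EM)) 𝓘(ℝ, EG) ∞
      (fun b : TotalSpace (AlgebroidModel EG EM) 𝒢.Algebroid ↦ (𝒢.frame a.1 b.1).inverse
        (0, (trivializationAt (AlgebroidModel EG EM) 𝒢.Algebroid a.1 b).2)) a :=
    ((𝒢.contMDiffAt_frame_inverse (𝒢.mem_trivDomain a.1)).comp a hπ).clm_apply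
      (contMDiffAt_const.prodMk_space h1)
  refine h2.congr_of_eventuallyEq ?_
  filter_upwards [hπ.continuousAt.eventually
    ((𝒢.isOpen_trivDomain a.1).mem_nhds (𝒢.mem_trivDomain a.1))] with b hb
  exact 𝒢.trivializationAt_totalIncl_snd hb

/-- Both coordinates of `f` are recovered from the composite by smooth maps: the base point by the
source, and the fibre coordinate by the differential of `fibreFun`. -/
theorem contMDiffAt_of_totalIncl [IG.Boundaryless]
    {f : N → TotalSpace (AlgebroidModel EG EM) 𝒢.Algebroid}
    {n : N} (hf : ContMDiffAt I IG.tangent ∞ (𝒢.totalIncl ∘ f) n) :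
    ContMDiffAt I (IM.prod 𝓘(ℝ, AlgebroidModel EG EM)) ∞ f n := by
  have h1 : ContMDiffAt I IM ∞ (fun k ↦ (f k).1) n := by
    have h2 := (𝒢.contMDiff_src.contMDiffAt.comp _
      (contMDiff_proj (TangentSpace IG : G → Type _) _)).comp n hf
    refine h2.congr_of_eventuallyEq (Filter.Eventually.of_forall fun k ↦ ?_)
    exact (𝒢.src_totalIncl (f k)).symm
  refine (contMDiffAt_totalSpace ..).2 ⟨h1, ?_⟩
  have h2 := (contMDiffAt_totalDifferential (b := 𝒢.totalIncl (f n))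
    (𝒢.contMDiffAt_fibreFun (m₀ := (f n).1) (mem_chart_source HG _))).comp n hf
  refine h2.congr_of_eventuallyEq ?_
  filter_upwards [h1.continuousAt.eventually
    ((𝒢.isOpen_trivDomain (f n).1).mem_nhds (𝒢.mem_trivDomain (f n).1))] with k hk
  exact 𝒢.trivializationAt_snd hk

variable [IG.Boundaryless] [IM.Boundaryless]

/-- Near a given point, X⃗ is the tangent map of a smooth extension of the multiplication, applied
to the smooth pair formed by X at the target and the zero section. -/
theorem contMDiff_rightInvariant (X : Cₛ^∞⟮IM; AlgebroidModel EG EM, 𝒢.Algebroid⟯) :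
    ContMDiff IG IG.tangent ∞
      (fun g ↦ (⟨g, 𝒢.rightInvariant X g⟩ : TangentBundle IG G)) := by
  intro g
  obtain ⟨m, hm, hm'⟩ := 𝒢.exists_mul_extension (h := 𝒢.one (𝒢.tgt g)) (g := g) (𝒢.src_one _)
  let s : G → TangentBundle IG G := fun k ↦ 𝒢.totalIncl ⟨𝒢.tgt k, X (𝒢.tgt k)⟩
  have hs : ContMDiff IG IG.tangent ∞ s :=
    𝒢.contMDiff_totalIncl.comp (X.contMDiff.comp 𝒢.contMDiff_tgt)
  have hz : ContMDiff IG IG.tangent ∞ (fun k ↦ (⟨k, 0⟩ : TangentBundle IG G)) :=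
    contMDiff_zeroSection ℝ (TangentSpace IG : G → Type _)
  have hp : ContMDiff IG (IG.prod IG).tangent ∞
      (fun k ↦ (equivTangentBundleProd IG G IG G).symm (s k, ⟨k, 0⟩)) :=
    contMDiff_equivTangentBundleProd_symm.comp (hs.prodMk hz)
  have h1 : ContMDiffAt IG IG.tangent ∞ (fun k ↦ tangentMap (IG.prod IG) IG m
      ((equivTangentBundleProd IG G IG G).symm (s k, ⟨k, 0⟩))) g :=
    ContMDiffAt.comp g (contMDiffAt_tangentMap
      (b := (equivTangentBundleProd IG G IG G).symm (s g, ⟨g, 0⟩)) hm) hp.contMDiffAt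
  refine h1.congr_of_eventuallyEq ?_
  have hc : ContinuousAt (fun k ↦ (𝒢.one (𝒢.tgt k), k)) g :=
    ((𝒢.contMDiff_one.continuous.comp 𝒢.contMDiff_tgt.continuous).prodMk
      continuous_id).continuousAt
  filter_upwards [hc.eventually (eventually_mdifferentiableAt_of_contMDiffAt hm),
    hc.eventually hm'.eventually_nhds] with k hk hk'
  rw [𝒢.mk_rightInvariant]
  exact 𝒢.rightMul_eq_tangentMap hk hk' (𝒢.src_totalIncl _) (𝒢.mfderiv_src_totalIncl _)

end LieGroupoid

/-! ### The tangent map of the inclusion and the injectivity of j -/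

namespace LieGroupoid

variable
    {EG : Type*} [NormedAddCommGroup EG] [NormedSpace ℝ EG]
    {HG : Type*} [TopologicalSpace HG] {IG : ModelWithCorners ℝ EG HG}
    {G : Type*} [TopologicalSpace G] [ChartedSpace HG G]
    {EM : Type*} [NormedAddCommGroup EM] [NormedSpace ℝ EM]
    {HM : Type*} [TopologicalSpace HM] {IM : ModelWithCorners ℝ EM HM}
    {M : Type*} [TopologicalSpace M] [ChartedSpace HM M]
    {F : Type*} [NormedAddCommGroup F] [NormedSpace ℝ F]
    (𝒢 : LieGroupoid IG G IM M)
    [IsManifold IG ∞ G] [IsManifold IM ∞ M]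
    [FiniteDimensional ℝ EG] [FiniteDimensional ℝ EM]

theorem mdifferentiable_totalIncl :
    MDifferentiable (IM.prod 𝓘(ℝ, AlgebroidModel EG EM)) IG.tangent 𝒢.totalIncl :=
  𝒢.contMDiff_totalIncl.mdifferentiable (by simp)

/-- The horizontal component of the tangent map of the inclusion of `AG` in `TG`. -/
theorem mfderiv_totalIncl_fst {a : TotalSpace (AlgebroidModel EG EM) 𝒢.Algebroid}
    (ζ : TangentSpace (IM.prod 𝓘(ℝ, AlgebroidModel EG EM)) a) :
    (show EG × EG from mfderiv (IM.prod 𝓘(ℝ, AlgebroidModel EG EM)) IG.tangent 𝒢.totalIncl a ζ).1 =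
      mfderiv IM IG 𝒢.one a.1 (show EM × AlgebroidModel EG EM from ζ).1 := by
  have hπ : MDifferentiableAt IG.tangent IG (π EG (TangentSpace IG)) (𝒢.totalIncl a) :=
    (contMDiff_proj (TangentSpace IG : G → Type _) (n := ∞)).mdifferentiable (by simp) _
  have hp : MDifferentiableAt (IM.prod 𝓘(ℝ, AlgebroidModel EG EM)) IM
      (π (AlgebroidModel EG EM) 𝒢.Algebroid) a :=
    (contMDiff_proj 𝒢.Algebroid (n := ∞)).mdifferentiable (by simp) _
  have h1 := DFunLike.congr_fun (mfderiv_comp a hπ (𝒢.mdifferentiable_totalIncl a)) ζ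
  have h2 := DFunLike.congr_fun (mfderiv_comp a (𝒢.mdifferentiable_one a.1) hp) ζ
  have h3 := (mfderiv_bundleChart (I := IM) a ζ).1
  have h4 := (mfderiv_bundleChart (I := IG) (V := (TangentSpace IG : G → Type _)) (𝒢.totalIncl a)
    (mfderiv (IM.prod 𝓘(ℝ, AlgebroidModel EG EM)) IG.tangent 𝒢.totalIncl a ζ)).1
  refine h4.symm.trans (h1.symm.trans (h2.trans ?_))
  exact congrArg (mfderiv IM IG 𝒢.one a.1) h3

/-- The tangent map of the inclusion of `AG` in `TG` on vertical vectors. -/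
theorem mfderiv_totalIncl_vertical (a : TotalSpace (AlgebroidModel EG EM) 𝒢.Algebroid)
    (k : 𝒢.Algebroid a.1) :
    (show EG × EG from mfderiv (IM.prod 𝓘(ℝ, AlgebroidModel EG EM)) IG.tangent 𝒢.totalIncl a
      (show EM × AlgebroidModel EG EM from
        (0, (trivializationAt (AlgebroidModel EG EM) 𝒢.Algebroid a.1 ⟨a.1, k⟩).2))) =
      (0, 𝒢.incl a.1 k) := by
  set e := trivializationAt (AlgebroidModel EG EM) 𝒢.Algebroid a.1 with he
  let ζ : TangentSpace (IM.prod 𝓘(ℝ, AlgebroidModel EG EM)) a :=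
    (show EM × AlgebroidModel EG EM from (0, (e ⟨a.1, k⟩).2))
  have ha := 𝒢.mem_trivDomain a.1
  have hp : ContMDiffAt (IM.prod 𝓘(ℝ, AlgebroidModel EG EM)) IM ∞
      (π (AlgebroidModel EG EM) 𝒢.Algebroid) a := contMDiff_proj 𝒢.Algebroid a
  have hζ1 : mfderiv (IM.prod 𝓘(ℝ, AlgebroidModel EG EM)) IM
      (π (AlgebroidModel EG EM) 𝒢.Algebroid) a ζ = 0 := (mfderiv_bundleChart (I := IM) a ζ).1
  have hζ2 : totalDifferential (IM.prod 𝓘(ℝ, AlgebroidModel EG EM)) (fun b ↦ (e b).2) ⟨a, ζ⟩ =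
    (e ⟨a.1, k⟩).2 := (mfderiv_bundleChart (I := IM) a ζ).2
  refine Prod.ext ?_ ?_
  · refine (𝒢.mfderiv_totalIncl_fst ζ).trans ?_
    exact map_zero (mfderiv IM IG 𝒢.one a.1)
  · have h1 := (mfderiv_bundleChart (I := IG) (V := (TangentSpace IG : G → Type _))
      (𝒢.totalIncl a)
      (mfderiv (IM.prod 𝓘(ℝ, AlgebroidModel EG EM)) IG.tangent 𝒢.totalIncl a ζ)).2
    refine h1.symm.trans ?_
    have h2 := contMDiffAt_trivialization_snd (I := IG) (V := (TangentSpace IG : G → Type _))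
      (a := 𝒢.totalIncl a) (mem_baseSet_trivializationAt EG (TangentSpace IG) (𝒢.totalIncl a).1)
    have h3 := totalDifferential_comp
      (b := (⟨a, ζ⟩ : TangentBundle (IM.prod 𝓘(ℝ, AlgebroidModel EG EM))
        (TotalSpace (AlgebroidModel EG EM) 𝒢.Algebroid)))
      (h2.mdifferentiableAt (by simp)) (𝒢.mdifferentiable_totalIncl a)
    refine h3.symm.trans ?_
    let L : M → EM × AlgebroidModel EG EM →L[ℝ] EG := fun m ↦ (𝒢.frame a.1 m).inverse
    have hL : MDifferentiableAt IM 𝓘(ℝ, EM × AlgebroidModel EG EM →L[ℝ] EG) L a.1 :=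
      (𝒢.contMDiffAt_frame_inverse ha).mdifferentiableAt (by simp)
    have hpd := hp.mdifferentiableAt (by simp : (∞ : WithTop ℕ∞) ≠ 0)
    have hed : MDifferentiableAt (IM.prod 𝓘(ℝ, AlgebroidModel EG EM))
        𝓘(ℝ, AlgebroidModel EG EM) (fun b ↦ (e b).2) a :=
      (contMDiffAt_trivialization_snd (I := IM) ha).mdifferentiableAt (by simp)
    have hed' := hasMFDerivAt_prodMk_space
      (mdifferentiableAt_const (c := (0 : EM))).hasMFDerivAt hed.hasMFDerivAt
    have h4 : ((fun b ↦ (trivializationAt EG (TangentSpace IG) (𝒢.totalIncl a).1 b).2) ∘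
        𝒢.totalIncl) =ᶠ[𝓝 a] fun b ↦ (L ∘ π (AlgebroidModel EG EM) 𝒢.Algebroid) b
          ((0 : EM), (e b).2) := by
      filter_upwards [hp.continuousAt.eventually
        ((𝒢.isOpen_trivDomain a.1).mem_nhds ha)] with b hb
      exact 𝒢.trivializationAt_totalIncl_snd hb
    -- Product rule for the inverse frame applied to the fibre coordinate. The frame depends only on
    -- the base point, so its derivative along a vertical vector vanishes.
    have h5 := totalDifferential_clm_apply
      (b := (⟨a, ζ⟩ : TangentBundle (IM.prod 𝓘(ℝ, AlgebroidModel EG EM))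
        (TotalSpace (AlgebroidModel EG EM) 𝒢.Algebroid)))
      (hL.comp a hpd) hed'.mdifferentiableAt
    have h6 : totalDifferential (IM.prod 𝓘(ℝ, AlgebroidModel EG EM))
        (L ∘ π (AlgebroidModel EG EM) 𝒢.Algebroid) ⟨a, ζ⟩ = 0 := by
      refine (totalDifferential_comp (b := (⟨a, ζ⟩ : TangentBundle
        (IM.prod 𝓘(ℝ, AlgebroidModel EG EM))
        (TotalSpace (AlgebroidModel EG EM) 𝒢.Algebroid))) hL hpd).trans ?_
      rw [tangentMap, hζ1]
      exact map_zero (mfderiv IM 𝓘(ℝ, EM × AlgebroidModel EG EM →L[ℝ] EG) L a.1)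
    have h7 : totalDifferential (IM.prod 𝓘(ℝ, AlgebroidModel EG EM))
        (fun b ↦ ((0 : EM), (e b).2)) ⟨a, ζ⟩ = (0, (e ⟨a.1, k⟩).2) := by
      rw [totalDifferential, hed'.mfderiv]
      refine Prod.ext ?_ hζ2
      change mfderiv _ _ (fun _ ↦ (0 : EM)) a ζ = 0
      rw [mfderiv_const]
      rfl
    rw [totalDifferential, h4.mfderiv_eq]
    refine h5.trans ?_
    rw [h6, h7, zero_apply, zero_add]
    have h8 := 𝒢.trivializationAt_totalIncl_snd (a := ⟨a.1, k⟩) ha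
    refine h8.symm.trans ?_
    rw [trivializationAt_tangent_snd (mem_chart_source HG (𝒢.one a.1))]
    exact totalDifferential_extChartAt_self (𝒢.totalIncl ⟨a.1, k⟩)

theorem eventuallyEq_trivializationAt_snd
    (a : TotalSpace (AlgebroidModel EG EM) 𝒢.Algebroid) {m₀ : M} (ha : a.1 ∈ 𝒢.trivDomain m₀) :
    (fun b ↦ (trivializationAt (AlgebroidModel EG EM) 𝒢.Algebroid m₀ b).2) =ᶠ[𝓝 a]
      totalDifferential IG (𝒢.fibreFun m₀) ∘ 𝒢.totalIncl := by
  filter_upwards [(FiberBundle.continuous_proj (AlgebroidModel EG EM)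
    𝒢.Algebroid).continuousAt.eventually ((𝒢.isOpen_trivDomain m₀).mem_nhds ha)] with b hb
  exact 𝒢.trivializationAt_snd hb

/-- The horizontal coordinate of a tangent vector of `AG` in terms of its image under `j`. -/
theorem mfderiv_one_fst_eq_jMap
    (w : TangentBundle (IM.prod 𝓘(ℝ, AlgebroidModel EG EM))
      (TotalSpace (AlgebroidModel EG EM) 𝒢.Algebroid)) :
    (𝒢.jMap w).1 = ⟨𝒢.one w.1.1,
      mfderiv IM IG 𝒢.one w.1.1 (show EM × AlgebroidModel EG EM from w.2).1⟩ :=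
  congrArg (fun v : TangentSpace IG (𝒢.one w.1.1) ↦ (⟨𝒢.one w.1.1, v⟩ : TangentBundle IG G))
    (𝒢.mfderiv_totalIncl_fst w.2)

variable [IG.Boundaryless]

/-- Differentials of functions on `G`, restricted to `AG`, along `TAG`. -/
theorem totalDifferential_comp_totalIncl {ψ : G → F}
    (w : TangentBundle (IM.prod 𝓘(ℝ, AlgebroidModel EG EM))
      (TotalSpace (AlgebroidModel EG EM) 𝒢.Algebroid))
    (hψ : ContMDiffAt IG 𝓘(ℝ, F) ∞ ψ (𝒢.one w.1.1)) :
    totalDifferential (IM.prod 𝓘(ℝ, AlgebroidModel EG EM))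
      (totalDifferential IG ψ ∘ 𝒢.totalIncl) w =
    totalDifferential IG.tangent (totalDifferential IG ψ) (𝒢.jMap w) := by
  rw [totalDifferential_comp ((contMDiffAt_totalDifferential
    (b := 𝒢.totalIncl w.1) hψ).mdifferentiableAt (by simp)) (𝒢.mdifferentiable_totalIncl w.1)]
  exact (mfderiv_totalDifferential_canonicalInvolution (tangentMap
    (IM.prod 𝓘(ℝ, AlgebroidModel EG EM)) IG.tangent 𝒢.totalIncl w) hψ).symm

/-- The vertical coordinate of a tangent vector of `AG` in terms of its image under `j`. -/
theorem snd_eq_totalDifferential_jMap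
    (w : TangentBundle (IM.prod 𝓘(ℝ, AlgebroidModel EG EM))
      (TotalSpace (AlgebroidModel EG EM) 𝒢.Algebroid)) :
    (show EM × AlgebroidModel EG EM from w.2).2 =
      totalDifferential IG.tangent (totalDifferential IG (𝒢.fibreFun w.1.1)) (𝒢.jMap w) := by
  rw [← 𝒢.totalDifferential_comp_totalIncl w
    (𝒢.contMDiffAt_fibreFun (mem_chart_source HG _)), totalDifferential,
    ← (𝒢.eventuallyEq_trivializationAt_snd w.1 (𝒢.mem_trivDomain w.1.1)).mfderiv_eq]
  exact (mfderiv_bundleChart (I := IM) w.1 w.2).2.symm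

/-- Each coordinate of a tangent vector of AG can be read off from its image: the horizontal one
because T(1) is injective, the vertical one by differentiating d(`fibreFun`). -/
theorem jMap_injective : Injective 𝒢.jMap := by
  intro w w' h
  have h0 : w.1 = w'.1 := by
    apply 𝒢.totalIncl_injective
    -- Flipping back undoes the involution in j and returns the tangent vector of TG, whose base
    -- point is the inclusion of that of `w`.
    have h1 := congrArg (fun Z ↦ (canonicalInvolution IG Z).1) h
    exact h1
  obtain ⟨a, ζ⟩ := w
  obtain ⟨a', ζ'⟩ := w'
  obtain rfl : a = a' := h0
  have h1 := 𝒢.snd_eq_totalDifferential_jMap ⟨a, ζ⟩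
  have h2 := 𝒢.snd_eq_totalDifferential_jMap ⟨a, ζ'⟩
  rw [← h] at h2
  have h3 := 𝒢.mfderiv_one_fst_eq_jMap ⟨a, ζ⟩
  rw [h, 𝒢.mfderiv_one_fst_eq_jMap ⟨a, ζ'⟩] at h3
  have h4 : mfderiv IM IG 𝒢.one a.1 (show EM × AlgebroidModel EG EM from ζ').1 =
      mfderiv IM IG 𝒢.one a.1 (show EM × AlgebroidModel EG EM from ζ).1 := by simpa using h3
  have h5 : (show EM × AlgebroidModel EG EM from ζ) = (show EM × AlgebroidModel EG EM from ζ') :=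
    Prod.ext (𝒢.mfderiv_one_injective a.1 h4).symm (h1.trans h2.symm)
  exact congrArg (TotalSpace.mk a) h5

end LieGroupoid

theorem totalDifferential_congr
    {E : Type*} [NormedAddCommGroup E] [NormedSpace ℝ E]
    {H : Type*} [TopologicalSpace H] {I : ModelWithCorners ℝ E H}
    {M : Type*} [TopologicalSpace M] [ChartedSpace H M]
    {F : Type*} [NormedAddCommGroup F] [NormedSpace ℝ F] {ψ χ : M → F} {w : TangentBundle I M}
    (h : ψ =ᶠ[𝓝 w.1] χ) : totalDifferential I ψ w = totalDifferential I χ w := by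
  rw [totalDifferential, totalDifferential, h.mfderiv_eq]
  rfl

/-! ### The image of j and the values of A(ξ) -/

namespace LieGroupoid

variable
    {EG : Type*} [NormedAddCommGroup EG] [NormedSpace ℝ EG]
    {HG : Type*} [TopologicalSpace HG] {IG : ModelWithCorners ℝ EG HG}
    {G : Type*} [TopologicalSpace G] [ChartedSpace HG G]
    {EM : Type*} [NormedAddCommGroup EM] [NormedSpace ℝ EM]
    {HM : Type*} [TopologicalSpace HM] {IM : ModelWithCorners ℝ EM HM}
    {M : Type*} [TopologicalSpace M] [ChartedSpace HM M]
    {F : Type*} [NormedAddCommGroup F] [NormedSpace ℝ F]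
    (𝒢 : LieGroupoid IG G IM M)
    [IsManifold IG ∞ G] [IsManifold IM ∞ M]

theorem mdifferentiable_tangentMap_src :
    MDifferentiable IG.tangent IM.tangent (tangentMap IG IM 𝒢.src) :=
  (𝒢.contMDiff_src.contMDiff_tangentMap (m := ∞) (by simp)).mdifferentiable (by simp)

/-- The source of `TG` read in a chart of `M`. -/
theorem eventuallyEq_totalDifferential_srcChart (b : TangentBundle IG G) :
    totalDifferential IG (extChartAt IM (𝒢.src b.1) ∘ 𝒢.src) =ᶠ[𝓝 b]
      totalDifferential IM (extChartAt IM (𝒢.src b.1)) ∘ tangentMap IG IM 𝒢.src := by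
  have h : ∀ᶠ c : TangentBundle IG G in 𝓝 b, 𝒢.src c.1 ∈ (chartAt HM (𝒢.src b.1)).source :=
    (𝒢.contMDiff_src.continuous.comp
      (FiberBundle.continuous_proj EG (TangentSpace IG))).continuousAt.eventually
      ((chartAt HM (𝒢.src b.1)).open_source.mem_nhds (mem_chart_source HM (𝒢.src b.1)))
  filter_upwards [h] with c hc
  exact totalDifferential_comp (mdifferentiableAt_extChartAt (I := IM) hc)
    (𝒢.mdifferentiable_src c.1)

/-- A vector of `TTG` killed by the source of the tangent groupoid has source-vertical
projection. -/
theorem mfderiv_src_of_tangentMap_src_eq_zero {b : TangentBundle IG G}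
    {Z : TangentSpace IG.tangent b}
    (hZ : mfderiv IG.tangent IM.tangent (tangentMap IG IM 𝒢.src) b Z = 0) :
    mfderiv IG IM 𝒢.src b.1 (show EG × EG from Z).1 = 0 := by
  have hπ : MDifferentiableAt IM.tangent IM (π EM (TangentSpace IM)) (tangentMap IG IM 𝒢.src b) :=
    (contMDiff_proj (TangentSpace IM : M → Type _) (n := ∞)).mdifferentiable (by simp) _
  have hπ' : MDifferentiableAt IG.tangent IG (π EG (TangentSpace IG)) b :=
    (contMDiff_proj (TangentSpace IG : G → Type _) (n := ∞)).mdifferentiable (by simp) _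
  have h1 := DFunLike.congr_fun (mfderiv_comp b hπ (𝒢.mdifferentiable_tangentMap_src b)) Z
  have h2 := DFunLike.congr_fun (mfderiv_comp b (𝒢.mdifferentiable_src b.1) hπ') Z
  have h3 := (mfderiv_bundleChart (I := IG) b Z).1
  have h4 : mfderiv IM.tangent IM (π EM (TangentSpace IM)) (tangentMap IG IM 𝒢.src b)
      (mfderiv IG.tangent IM.tangent (tangentMap IG IM 𝒢.src) b Z) = 0 := by rw [hZ, map_zero]
  have h5 := h2.symm.trans (h1.trans h4)
  exact (congrArg (mfderiv IG IM 𝒢.src b.1) h3.symm).trans h5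

theorem totalDifferential_srcChart (b : TangentBundle IG G) :
    totalDifferential IG (extChartAt IM (𝒢.src b.1) ∘ 𝒢.src) b = mfderiv IG IM 𝒢.src b.1 b.2 := by
  rw [(𝒢.eventuallyEq_totalDifferential_srcChart b).eq_of_nhds]
  exact totalDifferential_extChartAt_self (tangentMap IG IM 𝒢.src b)

section LieFunctor

variable {𝒢} {ξ : ∀ g : G, TangentSpace IG g} {x : ∀ m : M, TangentSpace IM m}

/-- Differentiate T(α) ∘ ξ = x ∘ α along a vector killed by T(α). -/
theorem lieFunctor_mem_tangentAlgebroid (hξ : 𝒢.IsMultiplicative ξ x)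
    (a : TotalSpace (AlgebroidModel EG EM) 𝒢.Algebroid) :
    𝒢.lieFunctor ξ a ∈ 𝒢.tangentAlgebroid := by
  refine ⟨⟨⟨a.1, x a.1⟩, ?_⟩, ?_⟩
  · rw [tangentMap, hξ.one]
    rfl
  · have hξd := hξ.smooth.mdifferentiable (by simp) (𝒢.one a.1)
    have hxd := hξ.smooth_base.mdifferentiable (by simp) (𝒢.src (𝒢.one a.1))
    have h1 := DFunLike.congr_fun (mfderiv_comp (𝒢.one a.1)
      (𝒢.mdifferentiable_tangentMap_src ⟨𝒢.one a.1, ξ (𝒢.one a.1)⟩) hξd) (𝒢.incl a.1 a.2)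
    have h2 := DFunLike.congr_fun (mfderiv_comp (𝒢.one a.1) hxd
      (𝒢.mdifferentiable_src (𝒢.one a.1))) (𝒢.incl a.1 a.2)
    have h3 : tangentMap IG IM 𝒢.src ∘ (fun g ↦ (⟨g, ξ g⟩ : TangentBundle IG G)) =
        (fun m ↦ (⟨m, x m⟩ : TangentBundle IM M)) ∘ 𝒢.src := by
      funext g
      exact congrArg (TotalSpace.mk (𝒢.src g)) (hξ.src g)
    have h4 : ∀ f : G → TangentBundle IM M,
        f = (fun m ↦ (⟨m, x m⟩ : TangentBundle IM M)) ∘ 𝒢.src →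
        mfderiv IG IM.tangent f (𝒢.one a.1) (𝒢.incl a.1 a.2) = 0 := by
      rintro f rfl
      refine h2.trans ?_
      exact (congrArg (mfderiv IM IM.tangent (fun m ↦ (⟨m, x m⟩ : TangentBundle IM M)) _)
        (𝒢.mfderiv_src_incl a.1 a.2)).trans (map_zero (mfderiv IM IM.tangent
          (fun m ↦ (⟨m, x m⟩ : TangentBundle IM M)) (𝒢.src (𝒢.one a.1))))
    exact h1.symm.trans (h4 _ h3)

end LieFunctor

variable [FiniteDimensional ℝ EG] [FiniteDimensional ℝ EM]

/-- The differential of the source vanishes identically on AG, hence so does its derivative in every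
direction tangent to AG. -/
theorem totalDifferential_srcChart_comp_totalIncl
    (w : TangentBundle (IM.prod 𝓘(ℝ, AlgebroidModel EG EM))
      (TotalSpace (AlgebroidModel EG EM) 𝒢.Algebroid)) :
    totalDifferential (IM.prod 𝓘(ℝ, AlgebroidModel EG EM))
      (totalDifferential IG (extChartAt IM (𝒢.src (𝒢.one w.1.1)) ∘ 𝒢.src) ∘ 𝒢.totalIncl) w =
      0 := by
  have h : totalDifferential IG (extChartAt IM (𝒢.src (𝒢.one w.1.1)) ∘ 𝒢.src) ∘ 𝒢.totalIncl
      =ᶠ[𝓝 w.1] fun _ ↦ (0 : EM) := by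
    filter_upwards [𝒢.mdifferentiable_totalIncl.continuous.continuousAt.eventually
      (𝒢.eventuallyEq_totalDifferential_srcChart (𝒢.totalIncl w.1))] with c hc
    refine hc.trans ?_
    change mfderiv IM 𝓘(ℝ, EM) (extChartAt IM (𝒢.src (𝒢.one w.1.1))) (𝒢.src (𝒢.one c.1))
      (mfderiv IG IM 𝒢.src (𝒢.one c.1) (𝒢.incl c.1 c.2)) = _
    rw [𝒢.mfderiv_src_incl, map_zero]
    rfl
  rw [totalDifferential, h.mfderiv_eq, mfderiv_const]
  rfl

section Base

variable {𝒢} {ξ : ∀ g : G, TangentSpace IG g} {x : ∀ m : M, TangentSpace IM m}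
  {ξ' : ∀ a : TotalSpace (AlgebroidModel EG EM) 𝒢.Algebroid,
  TangentSpace (IM.prod 𝓘(ℝ, AlgebroidModel EG EM)) a}

/-- Compare base points in TG. On the side of A(ξ) it is ξ(1_m) = T(1)(x(m)), on the side of j it is
T(1) of the horizontal part, and T(1) is injective. -/
theorem IsLieLift.fst_eq (h : 𝒢.IsLieLift ξ ξ') (hξ : 𝒢.IsMultiplicative ξ x)
    (a : TotalSpace (AlgebroidModel EG EM) 𝒢.Algebroid) :
    (show EM × AlgebroidModel EG EM from ξ' a).1 = x a.1 := by
  apply 𝒢.mfderiv_one_injective a.1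
  have h1 := 𝒢.mfderiv_one_fst_eq_jMap ⟨a, ξ' a⟩
  rw [h a] at h1
  have h2 := TangentBundle.snd_eq_of_mk_eq (W := ξ) h1.symm
  exact h2.trans (hξ.one a.1).symm

end Base

variable [IG.Boundaryless]

/-- By injectivity of the involution it suffices that the flip `Y` of `Z` is tangent to AG. Start
from any tangent vector of AG with the right horizontal part and correct it by a vertical one. -/
theorem tangentAlgebroid_subset_range_jMap : 𝒢.tangentAlgebroid ⊆ range 𝒢.jMap := by
  rintro ⟨b, Z⟩ ⟨⟨u, hu⟩, hZ⟩
  obtain rfl : b = tangentMap IM IG 𝒢.one u := hu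
  have hZ' : mfderiv IG.tangent IM.tangent (tangentMap IG IM 𝒢.src)
    (tangentMap IM IG 𝒢.one u) Z = 0 := hZ
  have hv : mfderiv IG IM 𝒢.src (𝒢.one u.1) (show EG × EG from Z).1 = 0 :=
    𝒢.mfderiv_src_of_tangentMap_src_eq_zero hZ'
  let a : TotalSpace (AlgebroidModel EG EM) 𝒢.Algebroid :=
    ⟨u.1, 𝒢.mkAlgebroid u.1 (show EG × EG from Z).1 hv⟩
  let Y : TangentSpace IG.tangent (𝒢.totalIncl a) :=
    (canonicalInvolution IG ⟨tangentMap IM IG 𝒢.one u, Z⟩).2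
  -- The flip turns the base direction T(1)(u) into the horizontal part, so `u` is the horizontal
  -- coordinate. The vertical coordinate is arbitrary and is set to zero.
  let ζ₀ : TangentSpace (IM.prod 𝓘(ℝ, AlgebroidModel EG EM)) a :=
    (show EM × AlgebroidModel EG EM from ((show EM from u.2), 0))
  let Y₀ : TangentSpace IG.tangent (𝒢.totalIncl a) :=
    mfderiv (IM.prod 𝓘(ℝ, AlgebroidModel EG EM)) IG.tangent 𝒢.totalIncl a ζ₀
  have hY1 : (show EG × EG from Y).1 = (show EG × EG from Y₀).1 :=
    (𝒢.mfderiv_totalIncl_fst ζ₀).symm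
  have hχ : ContMDiffAt IG 𝓘(ℝ, EM) ∞ (extChartAt IM (𝒢.src (𝒢.one u.1)) ∘ 𝒢.src) (𝒢.one u.1) :=
    contMDiffAt_extChartAt.comp _ 𝒢.contMDiff_src.contMDiffAt
  set dχ := totalDifferential IG (extChartAt IM (𝒢.src (𝒢.one u.1)) ∘ 𝒢.src) with hdχ
  have hY : mfderiv IG.tangent 𝓘(ℝ, EM) dχ (𝒢.totalIncl a) Y = 0 := by
    have h1 := mfderiv_totalDifferential_canonicalInvolution
      (⟨tangentMap IM IG 𝒢.one u, Z⟩ : TangentBundle IG.tangent (TangentBundle IG G)) hχ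
    refine h1.trans ?_
    have h2 := 𝒢.eventuallyEq_totalDifferential_srcChart (tangentMap IM IG 𝒢.one u)
    refine (DFunLike.congr_fun h2.mfderiv_eq Z).trans ?_
    have h3 := (contMDiffAt_totalDifferential_extChartAt (I := IM)
      (tangentMap IG IM 𝒢.src (tangentMap IM IG 𝒢.one u))).mdifferentiableAt
        (by simp : (∞ : WithTop ℕ∞) ≠ 0)
    have h4 := DFunLike.congr_fun (mfderiv_comp (tangentMap IM IG 𝒢.one u) h3
      (𝒢.mdifferentiable_tangentMap_src (tangentMap IM IG 𝒢.one u))) Z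
    refine h4.trans ?_
    exact (congrArg (mfderiv IM.tangent 𝓘(ℝ, EM)
      (totalDifferential IM (extChartAt IM (𝒢.src (𝒢.one u.1)))) _) hZ').trans
      (map_zero (mfderiv IM.tangent 𝓘(ℝ, EM)
        (totalDifferential IM (extChartAt IM (𝒢.src (𝒢.one u.1)))) _))
  have hY₀ : mfderiv IG.tangent 𝓘(ℝ, EM) dχ (𝒢.totalIncl a) Y₀ = 0 := by
    have h3 := (contMDiffAt_totalDifferential (b := 𝒢.totalIncl a) hχ).mdifferentiableAt
        (by simp : (∞ : WithTop ℕ∞) ≠ 0)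
    have h4 := DFunLike.congr_fun (mfderiv_comp a h3 (𝒢.mdifferentiable_totalIncl a)) ζ₀
    refine h4.symm.trans ?_
    exact 𝒢.totalDifferential_srcChart_comp_totalIncl ⟨a, ζ₀⟩
  have hD := mfderiv_totalDifferential (b := 𝒢.totalIncl a) hχ Y
  have hD₀ := mfderiv_totalDifferential (b := 𝒢.totalIncl a) hχ Y₀
  have hD' := (hD.symm.trans (hY.trans hY₀.symm)).trans hD₀
  rw [hY1] at hD'
  replace hD' := add_left_cancel (G := EM) hD'
  -- `Y` and `Y₀` both annihilate the differential of the source and have equal horizontal parts.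
  -- Their second-derivative terms therefore agree, and the difference of the vertical parts is
  -- killed by T(α).
  have hk : mfderiv IG IM 𝒢.src (𝒢.one u.1)
      ((show EG × EG from Y).2 - (show EG × EG from Y₀).2) = 0 := by
    have h1 := 𝒢.totalDifferential_srcChart
      ⟨𝒢.one u.1, (show EG × EG from Y).2 - (show EG × EG from Y₀).2⟩
    refine h1.symm.trans ?_
    have h2 := (eventually_mfderiv_eq_fderiv hχ).self_of_nhds
      ((show EG × EG from Y).2 - (show EG × EG from Y₀).2)
    refine h2.trans ?_
    refine (congrArg _ (totalDifferential_extChartAt_self (I := IG) ⟨𝒢.one u.1,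
      (show EG × EG from Y).2 - (show EG × EG from Y₀).2⟩)).trans ?_
    refine (map_sub _ (show EG × EG from Y).2 (show EG × EG from Y₀).2).trans ?_
    exact sub_eq_zero.2 hD'
  let k := 𝒢.mkAlgebroid u.1 _ hk
  let ζ₁ : TangentSpace (IM.prod 𝓘(ℝ, AlgebroidModel EG EM)) a :=
    (show EM × AlgebroidModel EG EM from
      (0, (trivializationAt (AlgebroidModel EG EM) 𝒢.Algebroid a.1 ⟨a.1, k⟩).2))
  have hζ₁ := 𝒢.mfderiv_totalIncl_vertical a k
  have hsum : mfderiv (IM.prod 𝓘(ℝ, AlgebroidModel EG EM)) IG.tangent 𝒢.totalIncl a (ζ₀ + ζ₁) =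
      Y := by
    rw [map_add]
    refine Prod.ext (x := (show EG × EG from _)) (y := (show EG × EG from Y)) ?_ ?_
    · refine (congrArg (fun z : EG × EG ↦ (show EG × EG from Y₀).1 + z.1) hζ₁).trans ?_
      exact (add_zero _).trans hY1.symm
    · refine (congrArg (fun z : EG × EG ↦ (show EG × EG from Y₀).2 + z.2) hζ₁).trans ?_
      exact add_sub_cancel (show EG × EG from Y₀).2 (show EG × EG from Y).2
  refine ⟨⟨a, ζ₀ + ζ₁⟩, ?_⟩
  rw [jMap, tangentMap]
  exact congrArg (fun y : TangentSpace IG.tangent (𝒢.totalIncl a) ↦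
    canonicalInvolution IG ⟨𝒢.totalIncl a, y⟩) hsum

/-- The horizontal part of T(T(α))(j w) is T(α) of an element of AG. The vertical part is a
derivative of the differential of the source, which by invariance under the involution may be
computed along `w` itself, where it vanishes. -/
theorem jMap_mem_tangentAlgebroid
    (w : TangentBundle (IM.prod 𝓘(ℝ, AlgebroidModel EG EM))
      (TotalSpace (AlgebroidModel EG EM) 𝒢.Algebroid)) : 𝒢.jMap w ∈ 𝒢.tangentAlgebroid := by
  refine ⟨⟨⟨w.1.1, (show EM × AlgebroidModel EG EM from w.2).1⟩, 𝒢.mfderiv_one_fst_eq_jMap w⟩, ?_⟩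
  set b := (𝒢.jMap w).1 with hb
  let Z : TangentSpace IG.tangent b := (𝒢.jMap w).2
  let Θ := mfderiv IG.tangent IM.tangent (tangentMap IG IM 𝒢.src) b Z
  have hπ : MDifferentiableAt IM.tangent IM (π EM (TangentSpace IM)) (tangentMap IG IM 𝒢.src b) :=
    (contMDiff_proj (TangentSpace IM : M → Type _) (n := ∞)).mdifferentiable (by simp) _
  have hπ' : MDifferentiableAt IG.tangent IG (π EG (TangentSpace IG)) b :=
    (contMDiff_proj (TangentSpace IG : G → Type _) (n := ∞)).mdifferentiable (by simp) _
  have h1 : (show EM × EM from Θ).1 = 0 := by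
    have e1 := DFunLike.congr_fun (mfderiv_comp b hπ (𝒢.mdifferentiable_tangentMap_src b)) Z
    have e2 := DFunLike.congr_fun (mfderiv_comp b (𝒢.mdifferentiable_src b.1) hπ') Z
    have e3 := (mfderiv_bundleChart (I := IG) b Z).1
    have e4 := (mfderiv_bundleChart (I := IM) (tangentMap IG IM 𝒢.src b) Θ).1
    refine e4.symm.trans (e1.symm.trans (e2.trans ?_))
    exact (congrArg (mfderiv IG IM 𝒢.src b.1) e3).trans (𝒢.mfderiv_src_incl w.1.1 w.1.2)
  have hχ : ContMDiffAt IG 𝓘(ℝ, EM) ∞ (extChartAt IM (𝒢.src (𝒢.one w.1.1)) ∘ 𝒢.src)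
      (𝒢.one w.1.1) := contMDiffAt_extChartAt.comp _ 𝒢.contMDiff_src.contMDiffAt
  have h2 : (show EM × EM from Θ).2 = 0 := by
    have e1 := mfderiv_totalDifferential_extChartAt (tangentMap IG IM 𝒢.src b) Θ
    have e2 := (contMDiffAt_totalDifferential_extChartAt (I := IM)
      (tangentMap IG IM 𝒢.src b)).mdifferentiableAt (by simp : (∞ : WithTop ℕ∞) ≠ 0)
    have e3 := DFunLike.congr_fun (mfderiv_comp b e2 (𝒢.mdifferentiable_tangentMap_src b)) Z
    have e4 := totalDifferential_congr (I := IG.tangent) (w := ⟨b, Z⟩)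
      (𝒢.eventuallyEq_totalDifferential_srcChart b)
    refine e1.symm.trans (e3.symm.trans (e4.symm.trans ?_))
    exact (𝒢.totalDifferential_comp_totalIncl w hχ).symm.trans
      (𝒢.totalDifferential_srcChart_comp_totalIncl w)
  exact Prod.ext (x := (show EM × EM from Θ)) h1 h2

theorem bijOn_jMap : BijOn 𝒢.jMap univ 𝒢.tangentAlgebroid :=
  ⟨fun w _ ↦ 𝒢.jMap_mem_tangentAlgebroid w, 𝒢.jMap_injective.injOn, fun Z hZ ↦ by
    obtain ⟨w, hw⟩ := 𝒢.tangentAlgebroid_subset_range_jMap hZ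
    exact ⟨w, mem_univ _, hw⟩⟩

/-! ### The lift of a multiplicative field and its action on differentials -/

section Lift

variable {𝒢} {ξ : ∀ g : G, TangentSpace IG g} {x : ∀ m : M, TangentSpace IM m}

/-- Surjectivity of j gives a preimage of A(ξ)(a); what must be checked is that it is a tangent
vector at `a`. -/
theorem exists_isLieLift (hξ : 𝒢.IsMultiplicative ξ x) :
    ∃ ξ' : ∀ a : TotalSpace (AlgebroidModel EG EM) 𝒢.Algebroid,
      TangentSpace (IM.prod 𝓘(ℝ, AlgebroidModel EG EM)) a, 𝒢.IsLieLift ξ ξ' := by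
  have key : ∀ a : TotalSpace (AlgebroidModel EG EM) 𝒢.Algebroid,
      ∃ ζ : TangentSpace (IM.prod 𝓘(ℝ, AlgebroidModel EG EM)) a,
        𝒢.jMap ⟨a, ζ⟩ = 𝒢.lieFunctor ξ a := by
    intro a
    obtain ⟨⟨a', ζ⟩, hw⟩ := 𝒢.tangentAlgebroid_subset_range_jMap
      (lieFunctor_mem_tangentAlgebroid hξ a)
    have hξd := hξ.smooth.mdifferentiable (by simp) (𝒢.one a.1)
    have hπ : MDifferentiableAt IG.tangent IG (π EG (TangentSpace IG))
        (⟨𝒢.one a.1, ξ (𝒢.one a.1)⟩ : TangentBundle IG G) :=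
      (contMDiff_proj (TangentSpace IG : G → Type _) (n := ∞)).mdifferentiable (by simp) _
    have h1 := DFunLike.congr_fun (mfderiv_comp (𝒢.one a.1) hπ hξd) (𝒢.incl a.1 a.2)
    -- Since ξ is a section of TG, the horizontal part of T(ξ)(v) is v.
    have h2 : mfderiv IG IG (π EG (TangentSpace IG) ∘
        (fun g ↦ (⟨g, ξ g⟩ : TangentBundle IG G))) (𝒢.one a.1) (𝒢.incl a.1 a.2) =
        𝒢.incl a.1 a.2 := DFunLike.congr_fun (mfderiv_id (I := IG) (x := 𝒢.one a.1)) _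
    have h3 := (mfderiv_bundleChart (I := IG) (V := (TangentSpace IG : G → Type _))
      ⟨𝒢.one a.1, ξ (𝒢.one a.1)⟩ (𝒢.lieFunctor ξ a).2).1
    have h4 : (show EG × EG from (𝒢.lieFunctor ξ a).2).1 = 𝒢.incl a.1 a.2 :=
      h3.symm.trans (h1.symm.trans h2)
    have h5 : 𝒢.totalIncl a' = 𝒢.totalIncl a := by
      have h6 := congrArg (fun Z ↦ (canonicalInvolution IG Z).1) hw
      exact h6.trans (congrArg (fun v : TangentSpace IG (𝒢.one a.1) ↦
        (⟨𝒢.one a.1, v⟩ : TangentBundle IG G)) h4)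
    obtain rfl := 𝒢.totalIncl_injective h5
    exact ⟨ζ, hw⟩
  choose ξ' hξ' using key
  exact ⟨ξ', hξ'⟩

variable {ξ' : ∀ a : TotalSpace (AlgebroidModel EG EM) 𝒢.Algebroid,
  TangentSpace (IM.prod 𝓘(ℝ, AlgebroidModel EG EM)) a}

/-- The lift of `ξ` to the Lie algebroid acts on the differential of a function `ψ` on `G` as the
differential of `ξ(ψ)`. -/
theorem IsLieLift.totalDifferential_eq (h : 𝒢.IsLieLift ξ ξ') (hξ : IsSmoothVectorField IG ξ)
    {a : TotalSpace (AlgebroidModel EG EM) 𝒢.Algebroid} {ψ : G → F}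
    (hψ : ContMDiffAt IG 𝓘(ℝ, F) ∞ ψ (𝒢.one a.1)) :
    totalDifferential (IM.prod 𝓘(ℝ, AlgebroidModel EG EM))
      (totalDifferential IG ψ ∘ 𝒢.totalIncl) ⟨a, ξ' a⟩ =
    totalDifferential IG (fun g ↦ totalDifferential IG ψ ⟨g, ξ g⟩) (𝒢.totalIncl a) := by
  rw [𝒢.totalDifferential_comp_totalIncl ⟨a, ξ' a⟩ hψ, h a]
  exact (totalDifferential_comp (b := 𝒢.totalIncl a) ((contMDiffAt_totalDifferential
    (b := ⟨𝒢.one a.1, ξ (𝒢.one a.1)⟩) hψ).mdifferentiableAt (by simp))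
    (hξ.mdifferentiable (by simp) (𝒢.one a.1))).symm

theorem IsLieLift.snd_eq (h : 𝒢.IsLieLift ξ ξ') (hξ : IsSmoothVectorField IG ξ)
    (a : TotalSpace (AlgebroidModel EG EM) 𝒢.Algebroid) :
    (show EM × AlgebroidModel EG EM from ξ' a).2 =
      totalDifferential IG (fun g ↦ totalDifferential IG (𝒢.fibreFun a.1) ⟨g, ξ g⟩)
        (𝒢.totalIncl a) := by
  have hψ := 𝒢.contMDiffAt_fibreFun (m₀ := a.1) (mem_chart_source HG _)
  rw [← h.totalDifferential_eq hξ hψ, 𝒢.totalDifferential_comp_totalIncl ⟨a, ξ' a⟩ hψ]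
  exact 𝒢.snd_eq_totalDifferential_jMap ⟨a, ξ' a⟩

end Lift

end LieGroupoid

/-! ### Brackets of related and of product vector fields -/

section ProductFields

variable
    {E : Type*} [NormedAddCommGroup E] [NormedSpace ℝ E]
    {H : Type*} [TopologicalSpace H] {I : ModelWithCorners ℝ E H}
    {M : Type*} [TopologicalSpace M] [ChartedSpace H M]
    {E' : Type*} [NormedAddCommGroup E'] [NormedSpace ℝ E']
    {H' : Type*} [TopologicalSpace H'] {I' : ModelWithCorners ℝ E' H'}
    {N : Type*} [TopologicalSpace N] [ChartedSpace H' N]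

theorem isTangentTo_univ [I.Boundaryless] (b : TangentBundle I M) : IsTangentTo univ b := by
  obtain ⟨c, hc⟩ := exists_hasVelocity b
  exact hc.isTangentTo_univ

/-- Vector fields related by a smooth map have related brackets. -/
theorem mfderiv_mlieBracket_of_forall_related [I.Boundaryless] [IsManifold I ∞ M]
    [I'.Boundaryless] [IsManifold I' ∞ N] {f : M → N}
    {V W : ∀ q : M, TangentSpace I q} {V' W' : ∀ r : N, TangentSpace I' r}
    (hf : ContMDiff I I' ∞ f) (hV : IsSmoothVectorField I V) (hW : IsSmoothVectorField I W)
    (hV' : IsSmoothVectorField I' V') (hW' : IsSmoothVectorField I' W')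
    (hVV : ∀ q, mfderiv I I' f q (V q) = V' (f q))
    (hWW : ∀ q, mfderiv I I' f q (W q) = W' (f q)) (p : M) :
    mfderiv I I' f p (mlieBracket I V W p) = mlieBracket I' V' W' (f p) :=
  mfderiv_mlieBracket_of_related (S := univ) hf.contMDiffAt hV.contMDiffAt hW.contMDiffAt
    hV'.contMDiffAt hW'.contMDiffAt (mem_univ p) (isTangentTo_univ _) (isTangentTo_univ _)
    (.of_forall hVV) (.of_forall hWW)

variable [IsManifold I ∞ M] [IsManifold I' ∞ N]

theorem isSmoothVectorField_zero : IsSmoothVectorField I (fun q : M ↦ (0 : TangentSpace I q)) :=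
  contMDiff_zeroSection ℝ (TangentSpace I : M → Type _)

theorem isSmoothVectorField_prod {V : ∀ q : M, TangentSpace I q} {W : ∀ r : N, TangentSpace I' r}
    (hV : IsSmoothVectorField I V) (hW : IsSmoothVectorField I' W) :
    IsSmoothVectorField (I.prod I')
      (fun z : M × N ↦ ((V z.1, W z.2) : TangentSpace (I.prod I') z)) := by
  have h : ContMDiff (I.prod I') (I.tangent.prod I'.tangent) ∞
      (fun z : M × N ↦ ((⟨z.1, V z.1⟩ : TangentBundle I M), (⟨z.2, W z.2⟩ : TangentBundle I' N))) :=
    (hV.comp contMDiff_fst).prodMk (hW.comp contMDiff_snd)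
  exact contMDiff_equivTangentBundleProd_symm.comp h

/-- Each projection relates the product fields to their factors. -/
theorem mlieBracket_prod [I.Boundaryless] [I'.Boundaryless]
    {V₁ V₂ : ∀ q : M, TangentSpace I q} {W₁ W₂ : ∀ r : N, TangentSpace I' r}
    (hV₁ : IsSmoothVectorField I V₁) (hV₂ : IsSmoothVectorField I V₂)
    (hW₁ : IsSmoothVectorField I' W₁) (hW₂ : IsSmoothVectorField I' W₂) (z : M × N) :
    mlieBracket (I.prod I')
      (fun z : M × N ↦ ((V₁ z.1, W₁ z.2) : TangentSpace (I.prod I') z))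
      (fun z : M × N ↦ ((V₂ z.1, W₂ z.2) : TangentSpace (I.prod I') z)) z =
    ((mlieBracket I V₁ V₂ z.1, mlieBracket I' W₁ W₂ z.2) : TangentSpace (I.prod I') z) := by
  have h1 := isSmoothVectorField_prod hV₁ hW₁
  have h2 := isSmoothVectorField_prod hV₂ hW₂
  have e1 := mfderiv_mlieBracket_of_forall_related contMDiff_fst h1 h2 hV₁ hV₂
    (fun q ↦ by rw [mfderiv_fst]; rfl) (fun q ↦ by rw [mfderiv_fst]; rfl) z
  have e2 := mfderiv_mlieBracket_of_forall_related contMDiff_snd h1 h2 hW₁ hW₂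
    (fun q ↦ by rw [mfderiv_snd]; rfl) (fun q ↦ by rw [mfderiv_snd]; rfl) z
  rw [mfderiv_fst] at e1
  rw [mfderiv_snd] at e2
  exact Prod.ext (x := (show E × E' from mlieBracket (I.prod I')
      (fun z : M × N ↦ ((V₁ z.1, W₁ z.2) : TangentSpace (I.prod I') z))
      (fun z : M × N ↦ ((V₂ z.1, W₂ z.2) : TangentSpace (I.prod I') z)) z)) e1 e2

theorem isSmoothVectorField_mlieBracket [CompleteSpace E] {V W : ∀ q : M, TangentSpace I q}
    (hV : IsSmoothVectorField I V) (hW : IsSmoothVectorField I W) :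
    IsSmoothVectorField I (mlieBracket I V W) := by
  have : IsManifold I ((⊤ : ℕ∞) + 1) M := inferInstanceAs (IsManifold I ∞ M)
  have : IsManifold I (minSmoothness ℝ 2) M :=
    .of_le (n := ∞) (by rw [minSmoothness_of_isRCLikeNormedField]; norm_cast)
  intro p
  exact ContMDiffAt.mlieBracket_vectorField (m := ⊤) (n := ⊤) hV.contMDiffAt hW.contMDiffAt
    (by simp)

end ProductFields

/-! ### Right-invariance of [ξ, X⃗] and the operator D_ξ -/

namespace LieGroupoid

variable
    {EG : Type*} [NormedAddCommGroup EG] [NormedSpace ℝ EG]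
    {HG : Type*} [TopologicalSpace HG] {IG : ModelWithCorners ℝ EG HG}
    {G : Type*} [TopologicalSpace G] [ChartedSpace HG G]
    {EM : Type*} [NormedAddCommGroup EM] [NormedSpace ℝ EM]
    {HM : Type*} [TopologicalSpace HM] {IM : ModelWithCorners ℝ EM HM}
    {M : Type*} [TopologicalSpace M] [ChartedSpace HM M]
    {𝒢 : LieGroupoid IG G IM M}
    [IsManifold IG ∞ G] [IsManifold IM ∞ M]
    [FiniteDimensional ℝ EG] [FiniteDimensional ℝ EM] [IG.Boundaryless] [IM.Boundaryless]
    {ξ : ∀ g : G, TangentSpace IG g} {x : ∀ m : M, TangentSpace IM m}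

/-- The source relates ξ to x and X⃗ to 0, hence their bracket to [x, 0] = 0. -/
theorem IsMultiplicative.mfderiv_src_mlieBracket (hξ : 𝒢.IsMultiplicative ξ x)
    (X : Cₛ^∞⟮IM; AlgebroidModel EG EM, 𝒢.Algebroid⟯) (g : G) :
    mfderiv IG IM 𝒢.src g (mlieBracket IG ξ (𝒢.rightInvariant X) g) = 0 := by
  refine (mfderiv_mlieBracket_of_forall_related 𝒢.contMDiff_src hξ.smooth
    (𝒢.contMDiff_rightInvariant X) hξ.smooth_base isSmoothVectorField_zero hξ.src
    (𝒢.mfderiv_src_rightInvariant X) g).trans ?_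
  have : mlieBracket IM x (fun m ↦ (0 : TangentSpace IM m)) = 0 := mlieBracket_zero_right
  rw [this]
  rfl

/-- The bracket of a multiplicative and a right-invariant vector field is right-invariant. -/
theorem IsMultiplicative.rightMul_mlieBracket (hξ : 𝒢.IsMultiplicative ξ x)
    (X : Cₛ^∞⟮IM; AlgebroidModel EG EM, 𝒢.Algebroid⟯) (g : G) :
    𝒢.rightMul g ⟨𝒢.one (𝒢.tgt g), mlieBracket IG ξ (𝒢.rightInvariant X) (𝒢.one (𝒢.tgt g))⟩ =
      ⟨g, mlieBracket IG ξ (𝒢.rightInvariant X) g⟩ := by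
  have hc : 𝒢.src (𝒢.one (𝒢.tgt g)) = 𝒢.tgt g := 𝒢.src_one _
  obtain ⟨m, hm, hm'⟩ := 𝒢.exists_mul_extension hc
  have hX : IsSmoothVectorField IG (𝒢.rightInvariant X) := 𝒢.contMDiff_rightInvariant X
  have hV := isSmoothVectorField_prod hξ.smooth hξ.smooth
  have hW := isSmoothVectorField_prod hX (isSmoothVectorField_zero (I := IG) (M := G))
  have hmg : m (𝒢.one (𝒢.tgt g), g) = g := (hm'.self_of_nhds hc).trans (𝒢.one_mul g)
  have hmd := eventually_mdifferentiableAt_of_contMDiffAt hm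
  have ht1 : ∀ z ∈ 𝒢.composable, IsTangentTo 𝒢.composable
      (⟨z, (ξ z.1, ξ z.2)⟩ : TangentBundle (IG.prod IG) (G × G)) := by
    intro z hz
    refine 𝒢.isTangentTo_composable (b := ⟨z.1, ξ z.1⟩) (b' := ⟨z.2, ξ z.2⟩) ?_
    have hz' : 𝒢.src z.1 = 𝒢.tgt z.2 := hz
    rw [tangentMap, tangentMap, hξ.src, hξ.tgt, hz']
  have ht2 : ∀ z ∈ 𝒢.composable, IsTangentTo 𝒢.composable
      (⟨z, (𝒢.rightInvariant X z.1, (0 : TangentSpace IG z.2))⟩ :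
        TangentBundle (IG.prod IG) (G × G)) := by
    intro z hz
    refine 𝒢.isTangentTo_composable (b := ⟨z.1, 𝒢.rightInvariant X z.1⟩) (b' := ⟨z.2, 0⟩) ?_
    have hz' : 𝒢.src z.1 = 𝒢.tgt z.2 := hz
    rw [tangentMap, tangentMap, 𝒢.mfderiv_src_rightInvariant, map_zero, hz']
  have hnear : ∀ᶠ z in 𝓝[𝒢.composable] (𝒢.one (𝒢.tgt g), g),
      z ∈ 𝒢.composable ∧ MDifferentiableAt (IG.prod IG) IG m z ∧
        ∀ᶠ z' in 𝓝 z, z' ∈ 𝒢.composable → m z' = 𝒢.mul z'.1 z'.2 := by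
    filter_upwards [self_mem_nhdsWithin, nhdsWithin_le_nhds hmd,
      nhdsWithin_le_nhds hm'.eventually_nhds] with z h1 h2 h3 using ⟨h1, h2, h3⟩
  -- The extended multiplication relates ξ × ξ to ξ because ξ is multiplicative, and X⃗ × 0 to X⃗
  -- because X⃗ is right-invariant. Both relations hold only on composable pairs, to which both
  -- fields are tangent.
  have key := mfderiv_mlieBracket_of_related (I := IG.prod IG) (I' := IG) (f := m)
    (p := (𝒢.one (𝒢.tgt g), g)) (S := 𝒢.composable) hm hV.contMDiffAt hW.contMDiffAt
    (hξ.smooth.contMDiffAt) (hX.contMDiffAt) hc (ht1 _ hc) (ht2 _ hc)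
    (by
      filter_upwards [hnear] with z ⟨hz, hd, he⟩
      have h1 := 𝒢.tangentMap_mul_extension (b := ⟨z, (ξ z.1, ξ z.2)⟩) hd he hz (ht1 z hz)
      have h2 := hξ.mul z.1 z.2 hz
      have h3 : tangentMap (IG.prod IG) IG m ⟨z, (ξ z.1, ξ z.2)⟩ =
          ⟨𝒢.mul z.1 z.2, ξ (𝒢.mul z.1 z.2)⟩ :=
        h1.trans (congrArg (TotalSpace.mk (𝒢.mul z.1 z.2)) h2)
      exact TangentBundle.snd_eq_of_mk_eq h3)
    (by
      filter_upwards [hnear] with z ⟨hz, hd, he⟩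
      have h1 := 𝒢.rightMul_eq_tangentMap (b := ⟨z.1, 𝒢.rightInvariant X z.1⟩) hd he hz
        (𝒢.mfderiv_src_rightInvariant X z.1)
      have h2 := h1.symm.trans (𝒢.rightMul_rightInvariant X hz)
      exact TangentBundle.snd_eq_of_mk_eq h2)
  rw [𝒢.rightMul_eq_tangentMap (hm.mdifferentiableAt (by simp)) hm' hc
    (hξ.mfderiv_src_mlieBracket X _)]
  have hbr := mlieBracket_prod hξ.smooth hX hξ.smooth
    (isSmoothVectorField_zero (I := IG) (M := G)) (𝒢.one (𝒢.tgt g), g)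
  have h0 : mlieBracket IG ξ (fun k ↦ (0 : TangentSpace IG k)) g = 0 :=
    congrFun (mlieBracket_zero_right (I := IG) (W := ξ)) g
  have h1 : (equivTangentBundleProd IG G IG G).symm
      (⟨𝒢.one (𝒢.tgt g), mlieBracket IG ξ (𝒢.rightInvariant X) (𝒢.one (𝒢.tgt g))⟩, ⟨g, 0⟩) =
      (⟨(𝒢.one (𝒢.tgt g), g), mlieBracket (IG.prod IG)
        (fun z : G × G ↦ ((ξ z.1, ξ z.2) : TangentSpace (IG.prod IG) z))
        (fun z : G × G ↦ ((𝒢.rightInvariant X z.1, 0) : TangentSpace (IG.prod IG) z))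
        (𝒢.one (𝒢.tgt g), g)⟩ : TangentBundle (IG.prod IG) (G × G)) := by
    refine congrArg (TotalSpace.mk (𝒢.one (𝒢.tgt g), g)) (hbr.trans ?_).symm
    exact Prod.ext (x := (_ : EG × EG)) (y := (_ : EG × EG)) rfl h0
  rw [h1]
  -- The bracket is evaluated at the extended product of 1 and `g`, which equals `g` only
  -- propositionally.
  have h2 : ∀ k, k = g → (⟨k, mlieBracket IG ξ (𝒢.rightInvariant X) k⟩ : TangentBundle IG G) =
      ⟨g, mlieBracket IG ξ (𝒢.rightInvariant X) g⟩ := by rintro _ rfl; rfl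
  exact (congrArg (TotalSpace.mk _) key).trans (h2 _ hmg)

/-- The section of the Lie algebroid whose right-invariant vector field is the bracket of the
multiplicative vector field `ξ` with the right-invariant vector field of `X`. -/
def IsMultiplicative.bracketOperator (hξ : 𝒢.IsMultiplicative ξ x)
    (X : Cₛ^∞⟮IM; AlgebroidModel EG EM, 𝒢.Algebroid⟯) :
    Cₛ^∞⟮IM; AlgebroidModel EG EM, 𝒢.Algebroid⟯ where
  toFun m := 𝒢.mkAlgebroid m (mlieBracket IG ξ (𝒢.rightInvariant X) (𝒢.one m))
    (hξ.mfderiv_src_mlieBracket X (𝒢.one m))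
  contMDiff_toFun m := by
    refine 𝒢.contMDiffAt_of_totalIncl ?_
    exact (isSmoothVectorField_mlieBracket hξ.smooth
      (𝒢.contMDiff_rightInvariant X)).contMDiffAt.comp m 𝒢.contMDiff_one.contMDiffAt

theorem IsMultiplicative.incl_bracketOperator (hξ : 𝒢.IsMultiplicative ξ x)
    (X : Cₛ^∞⟮IM; AlgebroidModel EG EM, 𝒢.Algebroid⟯) (m : M) :
    𝒢.incl m (hξ.bracketOperator X m) = mlieBracket IG ξ (𝒢.rightInvariant X) (𝒢.one m) := rfl

theorem IsBracketOperator.incl_eq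
    {D : Cₛ^∞⟮IM; AlgebroidModel EG EM, 𝒢.Algebroid⟯ → Cₛ^∞⟮IM; AlgebroidModel EG EM, 𝒢.Algebroid⟯}
    (hD : 𝒢.IsBracketOperator ξ D) (X : Cₛ^∞⟮IM; AlgebroidModel EG EM, 𝒢.Algebroid⟯) (m : M) :
    𝒢.incl m (D X m) = mlieBracket IG ξ (𝒢.rightInvariant X) (𝒢.one m) :=
  (𝒢.rightInvariant_one (D X) m).symm.trans (hD X (𝒢.one m))

/-- A section is determined by its right-invariant field at the identities, which gives uniqueness.
Conversely, the equation at the identities spreads to all of G because both sides are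
right-invariant. -/
theorem IsMultiplicative.isBracketOperator_iff (hξ : 𝒢.IsMultiplicative ξ x)
    (D : Cₛ^∞⟮IM; AlgebroidModel EG EM, 𝒢.Algebroid⟯ →
      Cₛ^∞⟮IM; AlgebroidModel EG EM, 𝒢.Algebroid⟯) :
    𝒢.IsBracketOperator ξ D ↔ D = hξ.bracketOperator := by
  constructor
  · intro hD
    funext X
    ext m
    exact 𝒢.incl_injective m ((hD.incl_eq X m).trans (hξ.incl_bracketOperator X m).symm)
  · rintro rfl X g
    have h := (𝒢.mk_rightInvariant (hξ.bracketOperator X) g).trans (hξ.rightMul_mlieBracket X g)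
    exact TangentBundle.snd_eq_of_mk_eq h

end LieGroupoid

/-! ### Linear vector fields in fibre coordinates -/

section LinearFields

variable
    {E : Type*} [NormedAddCommGroup E] [NormedSpace ℝ E]
    {H : Type*} [TopologicalSpace H] {I : ModelWithCorners ℝ E H}
    {M : Type*} [TopologicalSpace M] [ChartedSpace H M] [IsManifold I ∞ M]
    {F : Type*} [NormedAddCommGroup F] [NormedSpace ℝ F]
    {V : M → Type*} [∀ m, AddCommGroup (V m)] [∀ m, Module ℝ (V m)]
    [∀ m, TopologicalSpace (V m)] [TopologicalSpace (TotalSpace F V)]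
    [FiberBundle F V] [VectorBundle ℝ F V] [ContMDiffVectorBundle ∞ F V I]
    {F₂ : Type*} [NormedAddCommGroup F₂] [NormedSpace ℝ F₂]
    {V₂ : M → Type*} [∀ m, AddCommGroup (V₂ m)] [∀ m, Module ℝ (V₂ m)]
    [∀ m, TopologicalSpace (V₂ m)] [TopologicalSpace (TotalSpace F₂ V₂)]
    [FiberBundle F₂ V₂] [VectorBundle ℝ F₂ V₂] [ContMDiffVectorBundle ∞ F₂ V₂ I]

/-- The tangent map of a fibrewise map that is constant in the preferred trivializations. -/
theorem mfderiv_fibrewise {P : ∀ m, V m → V₂ m} {L : F →L[ℝ] F₂} {a : TotalSpace F V}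
    (h : ∀ b : TotalSpace F V, b.proj ∈ (trivializationAt F V a.proj).baseSet →
      b.proj ∈ (trivializationAt F₂ V₂ a.proj).baseSet →
      (trivializationAt F₂ V₂ a.proj ⟨b.1, P b.1 b.2⟩).2 = L (trivializationAt F V a.proj b).2)
    (W : TangentSpace (I.prod 𝓘(ℝ, F)) a) :
    mfderiv (I.prod 𝓘(ℝ, F)) (I.prod 𝓘(ℝ, F₂))
      (fun b : TotalSpace F V ↦ (⟨b.1, P b.1 b.2⟩ : TotalSpace F₂ V₂)) a W =
      (((show E × F from W).1, L (show E × F from W).2) : E × F₂) := by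
  set p : TotalSpace F V → TotalSpace F₂ V₂ := fun b ↦ ⟨b.1, P b.1 b.2⟩ with hp
  have hπ : ContMDiffAt (I.prod 𝓘(ℝ, F)) I ∞ (π F V) a := contMDiff_proj V a
  have hev : (fun b ↦ (trivializationAt F₂ V₂ a.proj (p b)).2) =ᶠ[𝓝 a]
      fun b ↦ L (trivializationAt F V a.proj b).2 := by
    filter_upwards [FiberBundle.eventually_proj_mem
        (trivializationAt F V a.proj).open_baseSet (mem_baseSet_trivializationAt F V a.proj),
      FiberBundle.eventually_proj_mem
        (trivializationAt F₂ V₂ a.proj).open_baseSet (mem_baseSet_trivializationAt F₂ V₂ a.proj)]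
      with b h1 h2 using h b h1 h2
  have ht := contMDiffAt_trivialization_snd (I := I) (mem_baseSet_trivializationAt F V a.proj)
  have hps : ContMDiffAt (I.prod 𝓘(ℝ, F)) (I.prod 𝓘(ℝ, F₂)) ∞ p a :=
    (contMDiffAt_totalSpace ..).2 ⟨hπ, ((L.contMDiff (n := ∞)).contMDiffAt.comp a
      ht).congr_of_eventuallyEq hev⟩
  have hpd := hps.mdifferentiableAt (by simp : (∞ : WithTop ℕ∞) ≠ 0)
  have ht' := contMDiffAt_trivialization_snd (I := I) (a := p a)
    (mem_baseSet_trivializationAt F₂ V₂ a.proj)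
  have hπ' : ContMDiffAt (I.prod 𝓘(ℝ, F₂)) I ∞ (π F₂ V₂) (p a) := contMDiff_proj V₂ (p a)
  obtain ⟨h1, h2⟩ := mfderiv_bundleChart (I := I) (p a)
    (mfderiv (I.prod 𝓘(ℝ, F)) (I.prod 𝓘(ℝ, F₂)) p a W)
  obtain ⟨h3, h4⟩ := mfderiv_bundleChart (I := I) a W
  have h5 := DFunLike.congr_fun (mfderiv_comp a (hπ'.mdifferentiableAt (by simp)) hpd) W
  have h6 := totalDifferential_comp (b := (⟨a, W⟩ : TangentBundle (I.prod 𝓘(ℝ, F)) _))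
    (ht'.mdifferentiableAt (by simp)) hpd
  have h7 := totalDifferential_comp (ψ := L)
    (b := (⟨a, W⟩ : TangentBundle (I.prod 𝓘(ℝ, F)) _))
    (I' := 𝓘(ℝ, F)) L.mdifferentiableAt (ht.mdifferentiableAt (by simp))
  have h8 := totalDifferential_congr
    (w := (⟨a, W⟩ : TangentBundle (I.prod 𝓘(ℝ, F)) (TotalSpace F V))) hev
  refine Prod.ext (x := (show E × F₂ from _)) (h1.symm.trans (h5.symm.trans h3)) ?_
  refine h2.symm.trans (h6.symm.trans (h8.trans (h7.trans ?_)))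
  refine (DFunLike.congr_fun (L.hasMFDerivAt (x := (trivializationAt F V a.proj a).2)).mfderiv
    _).trans (congrArg L h4)

theorem trivializationAt_add {m₀ m : M} (hm : m ∈ (trivializationAt F V m₀).baseSet)
    (X Y : V m) : (trivializationAt F V m₀ ⟨m, X + Y⟩).2 =
      (trivializationAt F V m₀ ⟨m, X⟩).2 + (trivializationAt F V m₀ ⟨m, Y⟩).2 :=
  ((trivializationAt F V m₀).linear ℝ hm).map_add X Y

theorem trivializationAt_smul {m₀ m : M} (hm : m ∈ (trivializationAt F V m₀).baseSet)
    (t : ℝ) (X : V m) : (trivializationAt F V m₀ ⟨m, t • X⟩).2 =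
      t • (trivializationAt F V m₀ ⟨m, X⟩).2 :=
  ((trivializationAt F V m₀).linear ℝ hm).map_smul t X

theorem eq_of_trivializationAt_snd_eq {m₀ m : M} (hm : m ∈ (trivializationAt F V m₀).baseSet)
    {X Y : V m} (h : (trivializationAt F V m₀ ⟨m, X⟩).2 = (trivializationAt F V m₀ ⟨m, Y⟩).2) :
    X = Y :=
  ((trivializationAt F V m₀).continuousLinearEquivAt ℝ m hm).injective h

variable {η : ∀ a : TotalSpace F V, TangentSpace (I.prod 𝓘(ℝ, F)) a}
  {x : ∀ m : M, TangentSpace I m} {K : ∀ m, V m →ₗ[ℝ] F}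

/-- A vector field on the total space of a vector bundle is smooth if it projects to a smooth
vector field and its action on fibre coordinates is smooth. -/
theorem contMDiffAt_vectorField_totalSpace (hx : IsSmoothVectorField I x)
    (hη : ∀ a, (show E × F from η a).1 = x a.proj) {a : TotalSpace F V}
    (h : ContMDiffAt (I.prod 𝓘(ℝ, F)) 𝓘(ℝ, F) ∞ (fun b ↦ totalDifferential (I.prod 𝓘(ℝ, F))
      (fun c ↦ (trivializationAt F V a.proj c).2) ⟨b, η b⟩) a) :
    ContMDiffAt (I.prod 𝓘(ℝ, F)) (I.prod 𝓘(ℝ, F)).tangent ∞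
      (fun b ↦ (⟨b, η b⟩ : TangentBundle (I.prod 𝓘(ℝ, F)) (TotalSpace F V))) a := by
  refine (contMDiffAt_totalSpace ..).2 ⟨contMDiffAt_id, ?_⟩
  have hπ : ContMDiff (I.prod 𝓘(ℝ, F)) I ∞ (π F V) := contMDiff_proj V
  have h1 : ContMDiffAt (I.prod 𝓘(ℝ, F)) 𝓘(ℝ, E) ∞
      (fun b : TotalSpace F V ↦ totalDifferential I (extChartAt I a.proj) ⟨b.proj, x b.proj⟩) a :=
    (contMDiffAt_totalDifferential_extChartAt_comp (hx a.proj)).comp a hπ.contMDiffAt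
  refine (h1.prodMk_space h).congr_of_eventuallyEq ?_
  have e1 : ∀ᶠ b in 𝓝 a, b ∈ (chartAt (ModelProd H F) a).source :=
    (chartAt (ModelProd H F) a).open_source.mem_nhds (mem_chart_source _ a)
  -- The chart at `a` must have product form near each nearby `b`, not only at `b`, since it is
  -- differentiated there.
  filter_upwards [e1, (eventuallyEq_extChartAt_totalSpace (I := I) a).eventuallyEq_nhds,
    FiberBundle.eventually_proj_mem (chartAt H a.proj).open_source
      (mem_chart_source H a.proj),
    FiberBundle.eventually_proj_mem (trivializationAt F V a.proj).open_baseSet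
      (mem_baseSet_trivializationAt F V a.proj)] with b hb1 hb2 hb3 hb4
  have h2 : MDifferentiableAt (I.prod 𝓘(ℝ, F)) 𝓘(ℝ, E) (extChartAt I a.proj ∘ π F V) b :=
    (mdifferentiableAt_extChartAt (I := I) hb3).comp b (hπ.mdifferentiable (by simp) b)
  have h3 := (contMDiffAt_trivialization_snd (I := I) hb4).mdifferentiableAt
    (by simp : (∞ : WithTop ℕ∞) ≠ 0)
  refine (trivializationAt_tangent_snd (I := I.prod 𝓘(ℝ, F)) (b := ⟨b, η b⟩) hb1).trans ?_
  refine (totalDifferential_congr (I := I.prod 𝓘(ℝ, F)) (w := ⟨b, η b⟩) hb2).trans ?_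
  refine (DFunLike.congr_fun (hasMFDerivAt_prodMk_space h2.hasMFDerivAt
    h3.hasMFDerivAt).mfderiv (η b)).trans ?_
  refine Prod.ext (x := (_ : E × F)) ?_ rfl
  have h4 := totalDifferential_comp (b := (⟨b, η b⟩ : TangentBundle (I.prod 𝓘(ℝ, F)) _))
    (mdifferentiableAt_extChartAt (I := I) hb3) (hπ.mdifferentiable (by simp) b)
  refine h4.trans ?_
  exact congrArg (fun v : TangentSpace I b.proj ↦
    totalDifferential I (extChartAt I a.proj) ⟨b.proj, v⟩)
    ((mfderiv_bundleChart (I := I) b (η b)).1.trans (hη b))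

/-- A smooth vector field whose fibre components are linear is linear. -/
theorem isLinearVectorField_of_linear (hη : IsSmoothVectorField (I.prod 𝓘(ℝ, F)) η)
    (hx : IsSmoothVectorField I x)
    (hηK : ∀ m X, η ⟨m, X⟩ = ((x m, K m X) : E × F)) : IsLinearVectorField I η x where
  smooth := hη
  smooth_base := hx
  proj a := (mfderiv_bundleChart (I := I) a (η a)).1.trans
    (congrArg (fun z : E × F ↦ z.1) (hηK a.1 a.2))
  add m X Y := by
    -- In coordinates the tangent vectors over x(m) add in their fibre components, so this is the
    -- vector of the fibre product with the two given projections.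
    refine ⟨((x m, (K m X, K m Y)) : E × F × F), ?_, ?_, ?_⟩
    · refine (mfderiv_fibrewise (I := I) (V := V ×ᵇ V) (P := fun m (a : V m × V m) ↦ a.1)
        (L := ContinuousLinearMap.fst ℝ F F) (a := ⟨m, (X, Y)⟩) (fun b _ _ ↦ rfl) _).trans ?_
      exact (hηK m X).symm
    · refine (mfderiv_fibrewise (I := I) (V := V ×ᵇ V) (P := fun m (a : V m × V m) ↦ a.2)
        (L := ContinuousLinearMap.snd ℝ F F) (a := ⟨m, (X, Y)⟩) (fun b _ _ ↦ rfl) _).trans ?_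
      exact (hηK m Y).symm
    · refine (mfderiv_fibrewise (I := I) (V := V ×ᵇ V) (P := fun m (a : V m × V m) ↦ a.1 + a.2)
        (L := ContinuousLinearMap.fst ℝ F F + ContinuousLinearMap.snd ℝ F F)
        (a := ⟨m, (X, Y)⟩) (fun b _ hb ↦ trivializationAt_add hb b.2.1 b.2.2) _).trans ?_
      refine Eq.trans ?_ (hηK m (X + Y)).symm
      exact congrArg (fun v : F ↦ ((x m, v) : E × F)) ((K m).map_add X Y).symm
  smul t m X := by
    refine (mfderiv_fibrewise (I := I) (P := fun m (a : V m) ↦ t • a)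
      (L := t • ContinuousLinearMap.id ℝ F) (a := ⟨m, X⟩)
      (fun b _ hb ↦ trivializationAt_smul hb t b.2) _).trans ?_
    refine Eq.trans ?_ (hηK m (t • X)).symm
    have h1 := hηK m X
    have h2 : (show E × F from η ⟨m, X⟩).1 = x m := congrArg (fun z : E × F ↦ z.1) h1
    have h3 : t • (show E × F from η ⟨m, X⟩).2 = K m (t • X) :=
      (congrArg (fun z : E × F ↦ t • z.2) h1).trans ((K m).map_smul t X).symm
    exact Prod.ext (x := (_ : E × F)) h2 h3

end LinearFields

/-! ### Covariant differential operators in fibre coordinates -/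

section Operators

variable
    {E : Type*} [NormedAddCommGroup E] [NormedSpace ℝ E]
    {H : Type*} [TopologicalSpace H] {I : ModelWithCorners ℝ E H}
    {M : Type*} [TopologicalSpace M] [ChartedSpace H M]
    {F : Type*} [NormedAddCommGroup F] [NormedSpace ℝ F]
    {V : M → Type*} [∀ m, AddCommGroup (V m)] [∀ m, Module ℝ (V m)]
    [∀ m, TopologicalSpace (V m)] [TopologicalSpace (TotalSpace F V)]
    [FiberBundle F V] [VectorBundle ℝ F V]

theorem totalDifferential_add {f g : M → F} {w : TangentBundle I M}
    (hf : MDifferentiableAt I 𝓘(ℝ, F) f w.1) (hg : MDifferentiableAt I 𝓘(ℝ, F) g w.1) :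
    totalDifferential I (fun m ↦ f m + g m) w =
      totalDifferential I f w + totalDifferential I g w :=
  DFunLike.congr_fun (hf.hasMFDerivAt.add hg.hasMFDerivAt).mfderiv w.2

theorem totalDifferential_smul {f : M → ℝ} {g : M → F} {w : TangentBundle I M}
    (hf : MDifferentiableAt I 𝓘(ℝ, ℝ) f w.1) (hg : MDifferentiableAt I 𝓘(ℝ, F) g w.1) :
    totalDifferential I (fun m ↦ f m • g m) w =
      f w.1 • totalDifferential I g w + totalDifferential I f w • g w.1 := by
  have h2 : HasFDerivAt (fun z : ℝ × F ↦ z.1 • z.2) _ (f w.1, g w.1) :=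
    (hasFDerivAt_fst (𝕜 := ℝ) (p := (f w.1, g w.1))).smul
      (hasFDerivAt_snd (𝕜 := ℝ) (p := (f w.1, g w.1)))
  have h3 := h2.hasMFDerivAt.comp w.1
    (hasMFDerivAt_prodMk_space hf.hasMFDerivAt hg.hasMFDerivAt)
  have h4 : HasMFDerivAt I 𝓘(ℝ, F) (fun m ↦ f m • g m) w.1 _ := h3
  exact DFunLike.congr_fun h4.mfderiv w.2

/-- A smooth section of the dual bundle in a trivialization of the bundle. -/
theorem exists_dual_coordinates
    (φ : Cₛ^∞⟮I; F →L[ℝ] ℝ, fun m ↦ V m →L[ℝ] Trivial M ℝ m⟯) (m : M) :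
    ∃ φ' : M → F →L[ℝ] ℝ, MDifferentiableAt I 𝓘(ℝ, F →L[ℝ] ℝ) φ' m ∧
      ∀ m' ∈ (trivializationAt F V m).baseSet, ∀ v : V m',
        φ m' v = φ' m' (trivializationAt F V m ⟨m', v⟩).2 := by
  have h := ((contMDiffAt_hom_bundle _).1 (φ.contMDiff m)).2
  refine ⟨_, h.mdifferentiableAt (by simp), fun m' hm' v ↦ ?_⟩
  change φ m' v = ContinuousLinearMap.inCoordinates F V ℝ (Trivial M ℝ) m m' m m' (φ m') _
  rw [ContinuousLinearMap.inCoordinates_eq hm' (by simp)]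
  have := (trivializationAt F V m).continuousLinearEquivAt ℝ m' hm' |>.symm_apply_apply v
  change _ = φ m' (((trivializationAt F V m).continuousLinearEquivAt ℝ m' hm').symm
    (((trivializationAt F V m).continuousLinearEquivAt ℝ m' hm') v))
  rw [this]

variable [IsManifold I ∞ M] [ContMDiffVectorBundle ∞ F V I]
  {η : ∀ a : TotalSpace F V, TangentSpace (I.prod 𝓘(ℝ, F)) a}
  {x : ∀ m : M, TangentSpace I m} {K : ∀ m, V m →ₗ[ℝ] F}
  {D : Cₛ^∞⟮I; F, V⟯ → Cₛ^∞⟮I; F, V⟯}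

/-- Every element of a fibre is the value of a smooth section. -/
theorem exists_section_apply_eq [FiniteDimensional ℝ E] [T2Space M] (m : M) (v : V m) :
    ∃ X : Cₛ^∞⟮I; F, V⟯, X m = v := by
  set e := trivializationAt F V m with he
  have hm : m ∈ e.baseSet := mem_baseSet_trivializationAt F V m
  obtain ⟨ρ, -, hρ⟩ := (SmoothBumpFunction.nhds_basis_tsupport (I := I) m).mem_iff.1
    (e.open_baseSet.mem_nhds hm)
  have hs : ContMDiffOn I (I.prod 𝓘(ℝ, F)) ∞
      (fun m' ↦ (⟨m', e.symm m' (e ⟨m, v⟩).2⟩ : TotalSpace F V)) e.baseSet := by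
    have h1 : ContMDiffOn I (I.prod 𝓘(ℝ, F)) ∞ (fun m' ↦ (m', (e ⟨m, v⟩).2)) e.baseSet :=
      (contMDiff_id.prodMk contMDiff_const).contMDiffOn
    refine ((e.contMDiffOn_symm (IB := I) (n := ∞)).comp h1
      fun m' hm' ↦ e.mem_target.2 hm').congr fun m' hm' ↦ ?_
    exact e.mk_symm hm' _
  refine ⟨⟨_, ContMDiffOn.smul_section_of_tsupport (ψ := ρ) ρ.contMDiff.contMDiffOn
    e.open_baseSet hρ hs⟩, ?_⟩
  change ρ m • e.symm m (e ⟨m, v⟩).2 = v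
  rw [ρ.eq_one, one_smul]
  exact e.symm_apply_apply_mk hm v

theorem mdifferentiableAt_trivializationAt_section (X : Cₛ^∞⟮I; F, V⟯) (m : M) :
    MDifferentiableAt I 𝓘(ℝ, F) (fun m' ↦ (trivializationAt F V m ⟨m', X m'⟩).2) m :=
  ((contMDiffAt_trivialization_snd (I := I) (a := ⟨m, X m⟩)
    (mem_baseSet_trivializationAt F V m)).comp m X.contMDiff.contMDiffAt).mdifferentiableAt
    (by simp)

/-- An operator that differentiates sections componentwise in the preferred trivializations, up
to a linear term, is a covariant differential operator. -/
theorem isCovariantDifferentialOperator_of_coordinates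
    (hD : ∀ X m, (trivializationAt F V m ⟨m, D X m⟩).2 = totalDifferential I
      (fun m' ↦ (trivializationAt F V m ⟨m', X m'⟩).2) ⟨m, x m⟩ - K m (X m)) :
    IsCovariantDifferentialOperator I x D := by
  have hmem : ∀ m : M, m ∈ (trivializationAt F V m).baseSet := mem_baseSet_trivializationAt F V
  have hev : ∀ m : M, ∀ᶠ m' in 𝓝 m, m' ∈ (trivializationAt F V m).baseSet := fun m ↦
    (trivializationAt F V m).open_baseSet.mem_nhds (hmem m)
  have leibniz : ∀ f : M → ℝ, ContMDiff I 𝓘(ℝ, ℝ) ∞ f → ∀ X Y : Cₛ^∞⟮I; F, V⟯,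
      (∀ m, Y m = f m • X m) → ∀ m, D Y m = f m • D X m + derivAlong I x f m • X m := by
    intro f hf X Y hXY m
    have h1 : (fun m' ↦ (trivializationAt F V m ⟨m', Y m'⟩).2) =ᶠ[𝓝 m]
        fun m' ↦ f m' • (trivializationAt F V m ⟨m', X m'⟩).2 := by
      filter_upwards [hev m] with m' hm'
      rw [hXY, trivializationAt_smul hm']
    apply eq_of_trivializationAt_snd_eq (hmem m)
    rw [hD, totalDifferential_congr (w := ⟨m, x m⟩) h1,
      totalDifferential_smul (hf.mdifferentiable (by simp) m)
        (mdifferentiableAt_trivializationAt_section X m), trivializationAt_add (hmem m),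
      trivializationAt_smul (hmem m), trivializationAt_smul (hmem m), hD, hXY m, map_smul,
      smul_sub]
    change _ + totalDifferential I f ⟨m, x m⟩ • _ - _ = _ + totalDifferential I f ⟨m, x m⟩ • _
    abel
  refine ⟨fun X Y ↦ ?_, fun t X ↦ ?_, leibniz⟩
  · ext m
    have h1 : (fun m' ↦ (trivializationAt F V m ⟨m', (X + Y) m'⟩).2) =ᶠ[𝓝 m]
        fun m' ↦ (trivializationAt F V m ⟨m', X m'⟩).2 +
          (trivializationAt F V m ⟨m', Y m'⟩).2 := by
      filter_upwards [hev m] with m' hm'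
      exact trivializationAt_add hm' (X m') (Y m')
    have h2 : (X + Y) m = X m + Y m := rfl
    have h3 : (D X + D Y) m = D X m + D Y m := rfl
    apply eq_of_trivializationAt_snd_eq (hmem m)
    rw [hD, totalDifferential_congr (w := ⟨m, x m⟩) h1,
      totalDifferential_add (mdifferentiableAt_trivializationAt_section X m)
        (mdifferentiableAt_trivializationAt_section Y m), h3, trivializationAt_add (hmem m),
      hD, hD, h2, map_add]
    abel
  · ext m
    -- Homogeneity is the Leibniz rule for a constant function, whose derivative along `x` vanishes.
    rw [leibniz (fun _ ↦ t) contMDiff_const X (t • X) (fun m ↦ rfl) m]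
    have : derivAlong I x (fun _ ↦ t) m = 0 := by
      rw [derivAlong, mfderiv_const]
      rfl
    rw [this, zero_smul, add_zero]
    rfl

variable [∀ m, IsTopologicalAddGroup (V m)] [∀ m, ContinuousSMul ℝ (V m)]

/-- An operator given in the preferred trivializations by the components of a vector field on the
total space corresponds to that vector field. -/
theorem isOperatorOf_of_coordinates
    (hηK : ∀ m X, η ⟨m, X⟩ = ((x m, K m X) : E × F))
    (hD : ∀ X m, (trivializationAt F V m ⟨m, D X m⟩).2 = totalDifferential I
      (fun m' ↦ (trivializationAt F V m ⟨m', X m'⟩).2) ⟨m, x m⟩ - K m (X m)) :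
    IsOperatorOf I η x D := by
  intro φ X m
  obtain ⟨φ', hφ', h⟩ := exists_dual_coordinates φ m
  have hm := mem_baseSet_trivializationAt F V m
  have h1 : (fun m' ↦ (φ m' (X m') : ℝ)) =ᶠ[𝓝 m]
      fun m' ↦ φ' m' (trivializationAt F V m ⟨m', X m'⟩).2 := by
    filter_upwards [(trivializationAt F V m).open_baseSet.mem_nhds hm] with m' hm'
    exact h m' hm' _
  have h2 : fibrewiseLinear φ =ᶠ[𝓝 (⟨m, X m⟩ : TotalSpace F V)]
      fun a ↦ (φ' ∘ π F V) a (trivializationAt F V m a).2 := by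
    filter_upwards [FiberBundle.eventually_proj_mem (a := (⟨m, X m⟩ : TotalSpace F V))
      (trivializationAt F V m).open_baseSet hm] with a ha
    exact h a.1 ha a.2
  have hπ : MDifferentiableAt (I.prod 𝓘(ℝ, F)) I (π F V) ⟨m, X m⟩ :=
    (contMDiff_proj V (n := ∞)).mdifferentiable (by simp) _
  have e1 : derivAlong I x (fun m' ↦ (φ m' (X m') : ℝ)) m =
      totalDifferential I φ' ⟨m, x m⟩ (trivializationAt F V m ⟨m, X m⟩).2 +
        φ' m (totalDifferential I (fun m' ↦ (trivializationAt F V m ⟨m', X m'⟩).2) ⟨m, x m⟩) :=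
    (totalDifferential_congr (w := ⟨m, x m⟩) h1).trans (totalDifferential_clm_apply
      (b := ⟨m, x m⟩) hφ' (mdifferentiableAt_trivializationAt_section X m))
  obtain ⟨h3, h4⟩ := mfderiv_bundleChart (I := I) (⟨m, X m⟩ : TotalSpace F V) (η ⟨m, X m⟩)
  have e2 : derivAlong (I.prod 𝓘(ℝ, F)) η (fibrewiseLinear φ) ⟨m, X m⟩ =
      totalDifferential I φ' ⟨m, x m⟩ (trivializationAt F V m ⟨m, X m⟩).2 + φ' m (K m (X m)) := by
    let w : TangentBundle (I.prod 𝓘(ℝ, F)) (TotalSpace F V) := ⟨⟨m, X m⟩, η ⟨m, X m⟩⟩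
    refine (totalDifferential_congr (w := w) h2).trans ((totalDifferential_clm_apply (b := w)
        (MDifferentiableAt.comp (I' := I) (⟨m, X m⟩ : TotalSpace F V) hφ' hπ)
        ((contMDiffAt_trivialization_snd (I := I) (a := ⟨m, X m⟩) hm).mdifferentiableAt
          (by simp))).trans ?_)
    refine congrArg₂ (· + ·) ?_ ?_
    · refine congrArg (fun L : F →L[ℝ] ℝ ↦ L (trivializationAt F V m ⟨m, X m⟩).2) ?_
      refine (totalDifferential_comp (b := w) hφ' hπ).trans ?_
      exact congrArg (fun v : TangentSpace I m ↦ totalDifferential I φ' ⟨m, v⟩)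
        (h3.trans (congrArg (fun z : E × F ↦ z.1) (hηK m (X m))))
    · exact congrArg (φ' m) (h4.trans (congrArg (fun z : E × F ↦ z.2) (hηK m (X m))))
  -- The derivative of the dual coordinates along `x` occurs in both terms and cancels.
  rw [e1, e2, h m hm, hD, map_sub]
  abel

/-- Every covector at `m` is the value of a smooth dual section, and continuous functionals separate
the points of the fibre. -/
theorem isOperatorOf_unique [FiniteDimensional ℝ E] [T2Space M]
    {D' : Cₛ^∞⟮I; F, V⟯ → Cₛ^∞⟮I; F, V⟯} (hD : IsOperatorOf I η x D)
    (hD' : IsOperatorOf I η x D') : D = D' := by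
  funext X
  ext m
  have hm := mem_baseSet_trivializationAt F V m
  apply eq_of_trivializationAt_snd_eq hm
  refine (SeparatingDual.eq_iff_forall_dual_eq (R := ℝ)).2 fun ℓ ↦ ?_
  let ψ : V m →L[ℝ] Trivial M ℝ m :=
    ℓ ∘L ((trivializationAt F V m).continuousLinearEquivAt ℝ m hm : V m →L[ℝ] F)
  obtain ⟨φ, hφ⟩ := exists_section_apply_eq (I := I) (F := F →L[ℝ] ℝ)
    (V := fun m ↦ V m →L[ℝ] Trivial M ℝ m) m ψ
  have h := (hD φ X m).trans (hD' φ X m).symm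
  rw [hφ] at h
  exact h

end Operators

/-! ### Linearity of the lift and equality of the two operators -/

namespace LieGroupoid

variable
    {EG : Type*} [NormedAddCommGroup EG] [NormedSpace ℝ EG]
    {HG : Type*} [TopologicalSpace HG] {IG : ModelWithCorners ℝ EG HG}
    {G : Type*} [TopologicalSpace G] [ChartedSpace HG G]
    {EM : Type*} [NormedAddCommGroup EM] [NormedSpace ℝ EM]
    {HM : Type*} [TopologicalSpace HM] {IM : ModelWithCorners ℝ EM HM}
    {M : Type*} [TopologicalSpace M] [ChartedSpace HM M]
    {𝒢 : LieGroupoid IG G IM M}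
    [IsManifold IG ∞ G] [IsManifold IM ∞ M]
    [FiniteDimensional ℝ EG] [FiniteDimensional ℝ EM] [IG.Boundaryless]
    {ξ : ∀ g : G, TangentSpace IG g} {x : ∀ m : M, TangentSpace IM m}
    {ξ' : ∀ a : TotalSpace (AlgebroidModel EG EM) 𝒢.Algebroid,
      TangentSpace (IM.prod 𝓘(ℝ, AlgebroidModel EG EM)) a}

variable (𝒢 ξ) in
/-- The fibre component of the lift of `ξ` to the Lie algebroid. -/
def liftComponent (m : M) : 𝒢.Algebroid m →ₗ[ℝ] AlgebroidModel EG EM :=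
  (mfderiv IG 𝓘(ℝ, AlgebroidModel EG EM)
    (fun g ↦ totalDifferential IG (𝒢.fibreFun m) ⟨g, ξ g⟩) (𝒢.one m) ∘L 𝒢.incl m).toLinearMap

theorem contMDiffAt_fibreFun_derivative (hξ : IsSmoothVectorField IG ξ) (m : M) :
    ContMDiffAt IG 𝓘(ℝ, AlgebroidModel EG EM) ∞
      (fun g ↦ totalDifferential IG (𝒢.fibreFun m) ⟨g, ξ g⟩) (𝒢.one m) :=
  (contMDiffAt_totalDifferential (b := ⟨𝒢.one m, ξ (𝒢.one m)⟩)
    (𝒢.contMDiffAt_fibreFun (mem_chart_source HG _))).comp (𝒢.one m) (hξ (𝒢.one m))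

theorem IsLieLift.eq_prodMk [IM.Boundaryless] (h : 𝒢.IsLieLift ξ ξ') (hξ : 𝒢.IsMultiplicative ξ x)
    (m : M) (X : 𝒢.Algebroid m) :
    ξ' ⟨m, X⟩ = ((x m, 𝒢.liftComponent ξ m X) : EM × AlgebroidModel EG EM) :=
  Prod.ext (x := (show EM × AlgebroidModel EG EM from ξ' ⟨m, X⟩)) (h.fst_eq hξ ⟨m, X⟩)
    (h.snd_eq hξ.smooth ⟨m, X⟩)

/-- With ψ the `fibreFun` at the base point of `a`, the formula for the lift on dψ holds at all `b`
near `a`. So the fibre component in one fixed trivialization is d(ξψ) ∘ ι, which is smooth. -/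
theorem IsLieLift.isSmoothVectorField [IM.Boundaryless] (h : 𝒢.IsLieLift ξ ξ')
    (hξ : 𝒢.IsMultiplicative ξ x) :
    IsSmoothVectorField (IM.prod 𝓘(ℝ, AlgebroidModel EG EM)) ξ' := by
  intro a
  refine contMDiffAt_vectorField_totalSpace hξ.smooth_base (fun a ↦ h.fst_eq hξ a) ?_
  have h1 : ContMDiffAt (IM.prod 𝓘(ℝ, AlgebroidModel EG EM)) 𝓘(ℝ, AlgebroidModel EG EM) ∞
      (fun b ↦ totalDifferential IG (fun g ↦ totalDifferential IG (𝒢.fibreFun a.1) ⟨g, ξ g⟩)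
        (𝒢.totalIncl b)) a :=
    (contMDiffAt_totalDifferential (b := 𝒢.totalIncl a)
      (contMDiffAt_fibreFun_derivative hξ.smooth a.1)).comp a 𝒢.contMDiff_totalIncl.contMDiffAt
  refine h1.congr_of_eventuallyEq ?_
  filter_upwards [FiberBundle.eventually_proj_mem
    (trivializationAt (AlgebroidModel EG EM) 𝒢.Algebroid a.1).open_baseSet
    (mem_baseSet_trivializationAt (AlgebroidModel EG EM) 𝒢.Algebroid a.1)] with b hb
  refine (totalDifferential_congr (w := ⟨b, ξ' b⟩)
    (𝒢.eventuallyEq_trivializationAt_snd b hb)).trans ?_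
  exact h.totalDifferential_eq hξ.smooth
    (𝒢.contMDiffAt_fibreFun (𝒢.one_mem_chart_source hb))

theorem IsLieLift.isLinearVectorField [IM.Boundaryless] (h : 𝒢.IsLieLift ξ ξ')
    (hξ : 𝒢.IsMultiplicative ξ x) : IsLinearVectorField IM ξ' x :=
  isLinearVectorField_of_linear (h.isSmoothVectorField hξ) hξ.smooth_base (h.eq_prodMk hξ)

/-- The heart of the equality of operators: the commutator formula for the bracket, applied to the
function whose differential is the fibre coordinate. -/
theorem IsMultiplicative.trivializationAt_bracketOperator [IM.Boundaryless]
    (hξ : 𝒢.IsMultiplicative ξ x)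
    (X : Cₛ^∞⟮IM; AlgebroidModel EG EM, 𝒢.Algebroid⟯) (m : M) :
    (trivializationAt (AlgebroidModel EG EM) 𝒢.Algebroid m ⟨m, hξ.bracketOperator X m⟩).2 =
      totalDifferential IM
        (fun m' ↦ (trivializationAt (AlgebroidModel EG EM) 𝒢.Algebroid m ⟨m', X m'⟩).2)
        ⟨m, x m⟩ - 𝒢.liftComponent ξ m (X m) := by
  have hψ := 𝒢.contMDiffAt_fibreFun (m₀ := m) (mem_chart_source HG (𝒢.one m))
  have hX : IsSmoothVectorField IG (𝒢.rightInvariant X) := 𝒢.contMDiff_rightInvariant X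
  rw [𝒢.trivializationAt_snd (m₀ := m) (a := ⟨m, hξ.bracketOperator X m⟩) (𝒢.mem_trivDomain m)]
  refine (mfderiv_mlieBracket hψ hξ.smooth.contMDiffAt hX.contMDiffAt).trans ?_
  refine congrArg₂ (· - ·) ?_ ?_
  -- At an identity ξ is T(1)(x), so only the restriction of X⃗ψ to the identities is
  -- differentiated, and there it is the coordinate of X.
  · have h1 : MDifferentiableAt IG 𝓘(ℝ, AlgebroidModel EG EM)
        (fun g ↦ totalDifferential IG (𝒢.fibreFun m) ⟨g, 𝒢.rightInvariant X g⟩) (𝒢.one m) :=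
      (contMDiffAt_fibreFun_derivative hX m).mdifferentiableAt (by simp)
    have h2 := totalDifferential_comp (b := (⟨m, x m⟩ : TangentBundle IM M)) h1
      (𝒢.mdifferentiable_one m)
    rw [tangentMap, hξ.one] at h2
    refine h2.symm.trans (totalDifferential_congr (w := (⟨m, x m⟩ : TangentBundle IM M)) ?_)
    filter_upwards [(trivializationAt (AlgebroidModel EG EM) 𝒢.Algebroid m).open_baseSet.mem_nhds
      (mem_baseSet_trivializationAt (AlgebroidModel EG EM) 𝒢.Algebroid m)] with m' hm'
    rw [𝒢.trivializationAt_snd (m₀ := m) (a := ⟨m', X m'⟩) hm', comp_apply,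
      𝒢.rightInvariant_one X m']
    rfl
  -- In the second term X⃗ is only evaluated at 1_m, where it is X. This is the fibre component of
  -- the lift.
  · exact congrArg (fun v : TangentSpace IG (𝒢.one m) ↦ totalDifferential IG
      (fun g ↦ totalDifferential IG (𝒢.fibreFun m) ⟨g, ξ g⟩) ⟨𝒢.one m, v⟩)
      (𝒢.rightInvariant_one X m)

theorem IsLieLift.isOperatorOf_iff [IM.Boundaryless] [T2Space M] (h : 𝒢.IsLieLift ξ ξ')
    (hξ : 𝒢.IsMultiplicative ξ x)
    (D : Cₛ^∞⟮IM; AlgebroidModel EG EM, 𝒢.Algebroid⟯ →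
      Cₛ^∞⟮IM; AlgebroidModel EG EM, 𝒢.Algebroid⟯) :
    IsOperatorOf IM ξ' x D ↔ D = hξ.bracketOperator := by
  have h1 : IsOperatorOf IM ξ' x hξ.bracketOperator :=
    isOperatorOf_of_coordinates (h.eq_prodMk hξ) hξ.trivializationAt_bracketOperator
  exact ⟨fun hD ↦ isOperatorOf_unique hD h1, fun hD ↦ hD ▸ h1⟩

theorem IsMultiplicative.isCovariantDifferentialOperator [IM.Boundaryless]
    (hξ : 𝒢.IsMultiplicative ξ x) : IsCovariantDifferentialOperator IM x hξ.bracketOperator :=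
  isCovariantDifferentialOperator_of_coordinates hξ.trivializationAt_bracketOperator

end LieGroupoid

/-! ### The complete lift and the Lie derivative -/

section CompleteLift

variable
    {E : Type*} [NormedAddCommGroup E] [NormedSpace ℝ E]
    {H : Type*} [TopologicalSpace H] {I : ModelWithCorners ℝ E H}
    {M : Type*} [TopologicalSpace M] [ChartedSpace H M]
    {F : Type*} [NormedAddCommGroup F] [NormedSpace ℝ F]
    {x : ∀ m : M, TangentSpace I m}

/-- The fibre component of the complete lift of a vector field. -/
def completeLiftComponent (x : ∀ m : M, TangentSpace I m) (m : M) : TangentSpace I m →ₗ[ℝ] E :=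
  (mfderiv I 𝓘(ℝ, E) (fun q ↦ totalDifferential I (extChartAt I m) ⟨q, x q⟩) m).toLinearMap

variable [IsManifold I ∞ M]

/-- The complete lift of a vector field to the tangent bundle. -/
def completeLift (x : ∀ m : M, TangentSpace I m) (v : TangentBundle I M) :
    TangentSpace I.tangent v :=
  ((x v.1, completeLiftComponent x v.1 v.2) : E × E)

/-- The counterpart for TM of the defining property of the lift to AG. It makes the invariance of
differentials under the involution available. -/
theorem mk_completeLift (hx : IsSmoothVectorField I x) (v : TangentBundle I M) :
    (⟨v, completeLift x v⟩ : TangentBundle I.tangent (TangentBundle I M)) =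
      canonicalInvolution I
        (tangentMap I I.tangent (fun m ↦ (⟨m, x m⟩ : TangentBundle I M)) v) := by
  have hxd := hx.mdifferentiable (by simp) v.1
  have hπ : MDifferentiableAt I.tangent I (π E (TangentSpace I))
      (⟨v.1, x v.1⟩ : TangentBundle I M) :=
    (contMDiff_proj (TangentSpace I : M → Type _) (n := ∞)).mdifferentiable (by simp) _
  set Z : TangentSpace I.tangent (⟨v.1, x v.1⟩ : TangentBundle I M) :=
    mfderiv I I.tangent (fun m ↦ (⟨m, x m⟩ : TangentBundle I M)) v.1 v.2 with hZ
  have h1 : (show E × E from Z).1 = v.2 := by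
    have e1 := (mfderiv_bundleChart (I := I) (⟨v.1, x v.1⟩ : TangentBundle I M) Z).1
    have e2 := DFunLike.congr_fun (mfderiv_comp v.1 hπ hxd) v.2
    have e3 : mfderiv I I (π E (TangentSpace I) ∘
        (fun m ↦ (⟨m, x m⟩ : TangentBundle I M))) v.1 v.2 = v.2 :=
      DFunLike.congr_fun (mfderiv_id (I := I) (x := v.1)) v.2
    exact e1.symm.trans (e2.symm.trans e3)
  have h2 : (show E × E from Z).2 = completeLiftComponent x v.1 v.2 := by
    have e1 := mfderiv_totalDifferential_extChartAt (⟨v.1, x v.1⟩ : TangentBundle I M) Z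
    have e2 := totalDifferential_comp (b := v) ((contMDiffAt_totalDifferential_extChartAt
      (⟨v.1, x v.1⟩ : TangentBundle I M)).mdifferentiableAt (by simp)) hxd
    exact e1.symm.trans e2.symm
  have h3 : ∀ u w : E, u = v.2 → w = completeLiftComponent x v.1 v.2 →
      (⟨v, completeLift x v⟩ : TangentBundle I.tangent (TangentBundle I M)) =
        ⟨⟨v.1, u⟩, ((x v.1, w) : E × E)⟩ := by
    rintro _ _ rfl rfl
    rfl
  exact h3 _ _ h1 h2

variable [I.Boundaryless]

/-- The complete lift of `x` maps the differential of `ψ` to the differential of `x(ψ)`. -/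
theorem totalDifferential_completeLift (hx : IsSmoothVectorField I x) {ψ : M → F}
    {v : TangentBundle I M} (hψ : ContMDiffAt I 𝓘(ℝ, F) ∞ ψ v.1) :
    totalDifferential I.tangent (totalDifferential I ψ) ⟨v, completeLift x v⟩ =
      totalDifferential I (fun q ↦ totalDifferential I ψ ⟨q, x q⟩) v := by
  rw [mk_completeLift hx]
  have h := mfderiv_totalDifferential_canonicalInvolution (F := F) (ψ := ψ)
    (tangentMap I I.tangent (fun m ↦ (⟨m, x m⟩ : TangentBundle I M)) v) hψ
  exact Eq.trans (α := F) h (totalDifferential_comp (b := v) ((contMDiffAt_totalDifferential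
    (b := (⟨v.1, x v.1⟩ : TangentBundle I M)) hψ).mdifferentiableAt (by simp))
    (hx.mdifferentiable (by simp) v.1)).symm

theorem isSmoothVectorField_completeLift (hx : IsSmoothVectorField I x) :
    IsSmoothVectorField I.tangent (completeLift x) := by
  intro v
  refine contMDiffAt_vectorField_totalSpace (V := (TangentSpace I : M → Type _)) hx
    (fun _ ↦ rfl) ?_
  refine ContMDiffAt.congr_of_eventuallyEq (contMDiffAt_totalDifferential (b := v)
    (contMDiffAt_totalDifferential_extChartAt_comp (hx v.1))) ?_
  filter_upwards [FiberBundle.eventually_proj_mem (a := v) (chartAt H v.1).open_source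
    (mem_chart_source H v.1)] with b hb
  refine Eq.trans (totalDifferential_congr (w := ⟨b, completeLift x b⟩) ?_)
    (totalDifferential_completeLift hx (contMDiffAt_extChartAt' hb))
  filter_upwards [FiberBundle.eventually_proj_mem (a := b) (chartAt H v.1).open_source hb]
    with c hc
  exact trivializationAt_tangent_snd hc

theorem isCompleteLift_completeLift (hx : IsSmoothVectorField I x) :
    IsCompleteLift I x (completeLift x) where
  smooth := isSmoothVectorField_completeLift hx
  lift _ hf _ := totalDifferential_completeLift hx hf.contMDiffAt

theorem isLinearVectorField_completeLift (hx : IsSmoothVectorField I x) :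
    IsLinearVectorField I (completeLift x) x :=
  isLinearVectorField_of_linear (K := completeLiftComponent x)
    (isSmoothVectorField_completeLift hx) hx (fun _ _ ↦ rfl)

/-- The Lie derivative of vector fields, as an operator on sections of the tangent bundle. -/
def lieDerivative [CompleteSpace E] (hx : IsSmoothVectorField I x)
    (y : Cₛ^∞⟮I; E, (TangentSpace I : M → Type _)⟯) :
    Cₛ^∞⟮I; E, (TangentSpace I : M → Type _)⟯ :=
  ⟨mlieBracket I x y, isSmoothVectorField_mlieBracket hx y.contMDiff⟩

/-- The operator corresponding to the complete lift is the Lie derivative. -/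
theorem isOperatorOf_completeLift_iff [FiniteDimensional ℝ E] [T2Space M]
    (hx : IsSmoothVectorField I x)
    (D : Cₛ^∞⟮I; E, (TangentSpace I : M → Type _)⟯ → Cₛ^∞⟮I; E, (TangentSpace I : M → Type _)⟯) :
    IsOperatorOf I (completeLift x) x D ↔ D = lieDerivative hx := by
  have h1 : IsOperatorOf I (completeLift x) x (lieDerivative hx) := by
    refine isOperatorOf_of_coordinates (K := completeLiftComponent x) (fun _ _ ↦ rfl)
      fun y m ↦ ?_
    refine (trivializationAt_tangent_snd (b := ⟨m, mlieBracket I x y m⟩)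
      (mem_chart_source H m)).trans ?_
    refine (totalDifferential_extChartAt_self
      (⟨m, mlieBracket I x y m⟩ : TangentBundle I M)).trans ?_
    refine (mlieBracket_eq_sub (hx m) (y.contMDiff m)).trans ?_
    refine congrArg₂ (· - ·) (totalDifferential_congr (w := (⟨m, x m⟩ : TangentBundle I M)) ?_) rfl
    filter_upwards [(chartAt H m).open_source.mem_nhds (mem_chart_source H m)] with q hq
    exact (trivializationAt_tangent_snd (b := (⟨q, y q⟩ : TangentBundle I M)) hq).symm
  exact ⟨fun hD ↦ isOperatorOf_unique hD h1, fun hD ↦ hD ▸ h1⟩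

end CompleteLift

/-! ### The anchor -/

namespace LieGroupoid

variable
    {EG : Type*} [NormedAddCommGroup EG] [NormedSpace ℝ EG]
    {HG : Type*} [TopologicalSpace HG] {IG : ModelWithCorners ℝ EG HG}
    {G : Type*} [TopologicalSpace G] [ChartedSpace HG G]
    {EM : Type*} [NormedAddCommGroup EM] [NormedSpace ℝ EM]
    {HM : Type*} [TopologicalSpace HM] {IM : ModelWithCorners ℝ EM HM}
    {M : Type*} [TopologicalSpace M] [ChartedSpace HM M]
    (𝒢 : LieGroupoid IG G IM M)

theorem mk_anchor (a : TotalSpace (AlgebroidModel EG EM) 𝒢.Algebroid) :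
    (⟨a.1, 𝒢.anchor a.1 a.2⟩ : TangentBundle IM M) = tangentMap IG IM 𝒢.tgt (𝒢.totalIncl a) := by
  have key : ∀ {m m' : M} (h : m' = m) (v : TangentSpace IM m'),
      (⟨m, h ▸ v⟩ : TangentBundle IM M) = ⟨m', v⟩ := by
    rintro _ _ rfl v
    rfl
  exact key (𝒢.tgt_one a.1) _

variable [IsManifold IG ∞ G] [IsManifold IM ∞ M]
    [FiniteDimensional ℝ EG] [FiniteDimensional ℝ EM]

theorem contMDiff_anchor :
    ContMDiff (IM.prod 𝓘(ℝ, AlgebroidModel EG EM)) IM.tangent ∞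
      (fun a : TotalSpace (AlgebroidModel EG EM) 𝒢.Algebroid ↦
        (⟨a.1, 𝒢.anchor a.1 a.2⟩ : TangentBundle IM M)) := by
  rw [funext 𝒢.mk_anchor]
  exact (𝒢.contMDiff_tgt.contMDiff_tangentMap (m := ∞) (by simp)).comp 𝒢.contMDiff_totalIncl

variable [IG.Boundaryless] [IM.Boundaryless]

/-- Right translation does not change targets, so the target relates X⃗ to the anchor of X. -/
theorem mfderiv_tgt_rightInvariant (X : ∀ m, 𝒢.Algebroid m) (g : G) :
    mfderiv IG IM 𝒢.tgt g (𝒢.rightInvariant X g) = 𝒢.anchor (𝒢.tgt g) (X (𝒢.tgt g)) := by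
  have h := 𝒢.tangentMap_tgt_rightMul (g := g) (𝒢.src_totalIncl _)
    (𝒢.mfderiv_src_totalIncl ⟨𝒢.tgt g, X (𝒢.tgt g)⟩)
  rw [← 𝒢.mk_rightInvariant, ← 𝒢.mk_anchor] at h
  exact TangentBundle.snd_eq_of_mk_eq (W := fun m ↦ 𝒢.anchor m (X m)) h

variable {𝒢} {ξ : ∀ g : G, TangentSpace IG g} {x : ∀ m : M, TangentSpace IM m}

/-- The anchor intertwines the bracket operator of a multiplicative vector field with the Lie
derivative along its base. -/
theorem IsMultiplicative.anchor_bracketOperator (hξ : 𝒢.IsMultiplicative ξ x)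
    {D : Cₛ^∞⟮IM; AlgebroidModel EG EM, 𝒢.Algebroid⟯ →
      Cₛ^∞⟮IM; AlgebroidModel EG EM, 𝒢.Algebroid⟯} (hD : 𝒢.IsBracketOperator ξ D)
    (X : Cₛ^∞⟮IM; AlgebroidModel EG EM, 𝒢.Algebroid⟯) (m : M) :
    𝒢.anchor m (D X m) = mlieBracket IM x (fun m' ↦ 𝒢.anchor m' (X m')) m := by
  have hX : IsSmoothVectorField IM (fun m' ↦ 𝒢.anchor m' (X m')) :=
    𝒢.contMDiff_anchor.comp X.contMDiff
  have h1 := mfderiv_mlieBracket_of_forall_related 𝒢.contMDiff_tgt hξ.smooth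
    (𝒢.contMDiff_rightInvariant X) hξ.smooth_base hX hξ.tgt (𝒢.mfderiv_tgt_rightInvariant X)
    (𝒢.one m)
  rw [← hD.incl_eq] at h1
  have h2 := 𝒢.mk_anchor ⟨m, D X m⟩
  refine TangentBundle.snd_eq_of_mk_eq (q := 𝒢.tgt (𝒢.one m))
    (W := fun m ↦ mlieBracket IM x (fun m' ↦ 𝒢.anchor m' (X m')) m) (h2.trans ?_)
  exact congrArg (TotalSpace.mk (𝒢.tgt (𝒢.one m))) h1

end LieGroupoid

/-! ### The pair groupoid -/

section PairGroupoid

open LieGroupoid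

variable
    {E : Type*} [NormedAddCommGroup E] [NormedSpace ℝ E]
    {H : Type*} [TopologicalSpace H] {I : ModelWithCorners ℝ E H}
    {M : Type*} [TopologicalSpace M] [ChartedSpace H M]

theorem pairGroupoid_anchor (m : M) (a : (pairGroupoid I M).Algebroid m) :
    (pairGroupoid I M).anchor m a = (show E × E from (pairGroupoid I M).incl m a).1 :=
  DFunLike.congr_fun (mfderiv_fst (I := I) (I' := I) (x := (m, m))) ((pairGroupoid I M).incl m a)

theorem pairGroupoid_incl_snd (m : M) (a : (pairGroupoid I M).Algebroid m) :
    (show E × E from (pairGroupoid I M).incl m a).2 = 0 :=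
  (DFunLike.congr_fun (mfderiv_snd (I := I) (I' := I) (x := (m, m)))
    ((pairGroupoid I M).incl m a)).symm.trans ((pairGroupoid I M).mfderiv_src_incl m a)

variable [IsManifold I ∞ M] [FiniteDimensional ℝ E] [I.Boundaryless] {x : ∀ m : M, TangentSpace I m}

theorem isMultiplicative_pairField (hx : IsSmoothVectorField I x) :
    (pairGroupoid I M).IsMultiplicative (pairField I x) x where
  smooth := isSmoothVectorField_prod hx hx
  smooth_base := hx
  src g := DFunLike.congr_fun (mfderiv_snd (I := I) (I' := I) (x := g)) (pairField I x g)
  tgt g := DFunLike.congr_fun (mfderiv_fst (I := I) (I' := I) (x := g)) (pairField I x g)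
  one m := DFunLike.congr_fun
    ((hasMFDerivAt_id (I := I) m).prodMk (hasMFDerivAt_id (I := I) m)).mfderiv (x m)
  mul g h hgh := by
    have h1 : IsTangentTo (pairGroupoid I M).composable
        (⟨(g, h), (pairField I x g, pairField I x h)⟩ :
          TangentBundle ((I.prod I).prod (I.prod I)) ((M × M) × (M × M))) := by
      refine (pairGroupoid I M).isTangentTo_composable (b := ⟨g, pairField I x g⟩)
        (b' := ⟨h, pairField I x h⟩) ?_
      have e1 : tangentMap (I.prod I) I (pairGroupoid I M).src ⟨g, pairField I x g⟩ =
        ⟨g.2, x g.2⟩ := congrArg (TotalSpace.mk g.2)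
          (DFunLike.congr_fun (mfderiv_snd (I := I) (I' := I) (x := g)) (pairField I x g))
      have e2 : tangentMap (I.prod I) I (pairGroupoid I M).tgt ⟨h, pairField I x h⟩ =
        ⟨h.1, x h.1⟩ := congrArg (TotalSpace.mk h.1)
          (DFunLike.congr_fun (mfderiv_fst (I := I) (I' := I) (x := h)) (pairField I x h))
      have e3 : g.2 = h.1 := hgh
      rw [e1, e2, e3]
    -- Here the multiplication formula is smooth on all pairs and serves as its own extension.
    have h2 : HasMFDerivAt ((I.prod I).prod (I.prod I)) (I.prod I)
        (fun p : (M × M) × (M × M) ↦ (p.1.1, p.2.2)) (g, h) _ :=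
      ((hasMFDerivAt_fst (I := I) (I' := I) (x := g)).comp (g, h)
        (hasMFDerivAt_fst (I := I.prod I) (I' := I.prod I) (x := (g, h)))).prodMk
      ((hasMFDerivAt_snd (I := I) (I' := I) (x := h)).comp (g, h)
        (hasMFDerivAt_snd (I := I.prod I) (I' := I.prod I) (x := (g, h))))
    have h3 := (pairGroupoid I M).tangentMap_mul_extension
      (b := ⟨(g, h), (pairField I x g, pairField I x h)⟩) h2.mdifferentiableAt
      (.of_forall fun _ _ ↦ rfl) hgh h1
    refine (TangentBundle.snd_eq_of_mk_eq (W := fun p ↦ pairField I x p)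
      (p := (pairGroupoid I M).mul g h) (q := (g.1, h.2)) (h3.symm.trans ?_))
    exact congrArg (TotalSpace.mk (g.1, h.2))
      (DFunLike.congr_fun h2.mfderiv (pairField I x g, pairField I x h))

/-- The inverse of the anchor of the pair groupoid. -/
def pairAnchorInv (v : TangentBundle I M) :
    TotalSpace (AlgebroidModel (E × E) E) (pairGroupoid I M).Algebroid :=
  ⟨v.1, (pairGroupoid I M).mkAlgebroid v.1 ((v.2, 0) : E × E)
    (DFunLike.congr_fun (mfderiv_snd (I := I) (I' := I) (x := (v.1, v.1))) ((v.2, 0) : E × E))⟩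

theorem contMDiff_pairAnchorInv :
    ContMDiff I.tangent (I.prod 𝓘(ℝ, AlgebroidModel (E × E) E)) ∞
      (pairAnchorInv (I := I) (M := M)) := by
  intro v
  refine (pairGroupoid I M).contMDiffAt_of_totalIncl ?_
  have h : ContMDiff I.tangent (I.tangent.prod I.tangent) ∞
      (fun v : TangentBundle I M ↦ (v, (⟨v.1, 0⟩ : TangentBundle I M))) :=
    contMDiff_id.prodMk (isSmoothVectorField_zero.comp
      (contMDiff_proj (TangentSpace I : M → Type _)))
  exact (contMDiff_equivTangentBundleProd_symm.comp h).contMDiffAt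

variable (I M) in
/-- The anchor of the pair groupoid as a diffeomorphism onto the tangent bundle. -/
def pairAnchor : Diffeomorph (I.prod 𝓘(ℝ, AlgebroidModel (E × E) E)) I.tangent
    (TotalSpace (AlgebroidModel (E × E) E) (pairGroupoid I M).Algebroid) (TangentBundle I M) ∞ where
  toFun a := ⟨a.1, (pairGroupoid I M).anchor a.1 a.2⟩
  invFun := pairAnchorInv
  left_inv a := by
    refine congrArg (TotalSpace.mk a.1) ((pairGroupoid I M).incl_injective a.1 ?_)
    exact Prod.ext (x := (_ : E × E)) (y := (_ : E × E)) (pairGroupoid_anchor a.1 a.2)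
      (pairGroupoid_incl_snd a.1 a.2).symm
  right_inv v := congrArg (TotalSpace.mk v.1) (pairGroupoid_anchor v.1 (pairAnchorInv v).2)
  contMDiff_toFun := (pairGroupoid I M).contMDiff_anchor
  contMDiff_invFun := contMDiff_pairAnchorInv

/-- The anchor of the pair groupoid relates the lift of `x × x` to the complete lift of `x`. -/
theorem mfderiv_pairAnchor (hx : IsSmoothVectorField I x)
    {ξ' : ∀ a : TotalSpace (AlgebroidModel (E × E) E) (pairGroupoid I M).Algebroid,
      TangentSpace (I.prod 𝓘(ℝ, AlgebroidModel (E × E) E)) a}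
    (hξ' : (pairGroupoid I M).IsLieLift (pairField I x) ξ')
    (a : TotalSpace (AlgebroidModel (E × E) E) (pairGroupoid I M).Algebroid) :
    mfderiv (I.prod 𝓘(ℝ, AlgebroidModel (E × E) E)) I.tangent (pairAnchor I M) a (ξ' a) =
      completeLift x (pairAnchor I M a) := by
  have hξ := isMultiplicative_pairField hx
  have hΦ : MDifferentiableAt (I.prod 𝓘(ℝ, AlgebroidModel (E × E) E)) I.tangent
      (pairAnchor I M) a :=
    (pairAnchor I M).contMDiff.mdifferentiable (by simp) a
  have hΦ' : ∀ b, pairAnchor I M b =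
      tangentMap (I.prod I) I Prod.fst ((pairGroupoid I M).totalIncl b) :=
    (pairGroupoid I M).mk_anchor
  have hπ : MDifferentiableAt I.tangent I (π E (TangentSpace I)) (pairAnchor I M a) :=
    (contMDiff_proj (TangentSpace I : M → Type _) (n := ∞)).mdifferentiable (by simp) _
  set Z : TangentSpace I.tangent (pairAnchor I M a) :=
    mfderiv (I.prod 𝓘(ℝ, AlgebroidModel (E × E) E)) I.tangent (pairAnchor I M) a (ξ' a) with hZ
  have hfst : ∀ g : M × M, MDifferentiableAt (I.prod I) I Prod.fst g :=
    fun g ↦ mdifferentiableAt_fst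
  have h1 : (show E × E from Z).1 = x a.1 := by
    have e1 := (mfderiv_bundleChart (I := I) (pairAnchor I M a) Z).1
    have e2 := DFunLike.congr_fun (mfderiv_comp a hπ hΦ) (ξ' a)
    have e3 := (mfderiv_bundleChart (I := I) a (ξ' a)).1
    exact e1.symm.trans (e2.symm.trans (e3.trans (hξ'.fst_eq hξ a)))
  -- The vertical coordinate is the derivative of the chart differential. Pulled back by the anchor,
  -- that differential is d(χ ∘ pr₁) ∘ ι, with χ the chart, and the lift sends it to d((x × x)(χ ∘
  -- pr₁)) ∘ ι. This is d(xχ) composed with the anchor, since pr₁ relates x × x to x.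
  have h2 : (show E × E from Z).2 = completeLiftComponent x a.1 (pairAnchor I M a).2 := by
    have e1 := mfderiv_totalDifferential_extChartAt (pairAnchor I M a) Z
    have e2 := totalDifferential_comp (b := (⟨a, ξ' a⟩ : TangentBundle
      (I.prod 𝓘(ℝ, AlgebroidModel (E × E) E)) _)) ((contMDiffAt_totalDifferential_extChartAt
      (pairAnchor I M a)).mdifferentiableAt (by simp)) hΦ
    have hψ : ContMDiffAt (I.prod I) 𝓘(ℝ, E) ∞ (extChartAt I a.1 ∘ Prod.fst) (a.1, a.1) :=
      contMDiffAt_extChartAt.comp (I' := I) (a.1, a.1) contMDiffAt_fst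
    have e3 : totalDifferential I (extChartAt I a.1) ∘ pairAnchor I M =ᶠ[𝓝 a]
        totalDifferential (I.prod I) (extChartAt I a.1 ∘ Prod.fst) ∘
          (pairGroupoid I M).totalIncl := by
      filter_upwards [FiberBundle.eventually_proj_mem (a := a) (chartAt H a.1).open_source
        (mem_chart_source H a.1)] with b hb
      rw [comp_apply, hΦ']
      exact (totalDifferential_comp (b := (pairGroupoid I M).totalIncl b)
        (mdifferentiableAt_extChartAt (I := I) hb) (hfst (b.1, b.1))).symm
    have e4 := totalDifferential_congr (w := (⟨a, ξ' a⟩ : TangentBundle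
      (I.prod 𝓘(ℝ, AlgebroidModel (E × E) E)) _)) e3
    have e5 := hξ'.totalDifferential_eq hξ.smooth (a := a) hψ
    have e6 : (fun g ↦ totalDifferential (I.prod I) (extChartAt I a.1 ∘ Prod.fst)
        ⟨g, pairField I x g⟩) =ᶠ[𝓝 ((a.1, a.1) : M × M)]
        (fun q ↦ totalDifferential I (extChartAt I a.1) ⟨q, x q⟩) ∘ Prod.fst := by
      filter_upwards [(continuousAt_fst (p := ((a.1, a.1) : M × M))).eventually
        ((chartAt H a.1).open_source.mem_nhds (mem_chart_source H a.1))] with g hg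
      refine (totalDifferential_comp (b := (⟨g, pairField I x g⟩ :
        TangentBundle (I.prod I) (M × M)))
        (mdifferentiableAt_extChartAt (I := I) hg) (hfst g)).trans ?_
      exact congrArg (fun v : TangentSpace I g.1 ↦
        totalDifferential I (extChartAt I a.1) ⟨g.1, v⟩) (hξ.tgt g)
    have e7 := totalDifferential_congr (w := (pairGroupoid I M).totalIncl a) e6
    have e8 := totalDifferential_comp (b := (pairGroupoid I M).totalIncl a)
      ((contMDiffAt_totalDifferential_extChartAt_comp (hx a.1)).mdifferentiableAt (by simp))
      (hfst (a.1, a.1))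
    rw [← hΦ'] at e8
    exact e1.symm.trans (e2.symm.trans (e4.trans (e5.trans (e7.trans e8))))
  exact Prod.ext (x := (show E × E from Z)) h1 h2

end PairGroupoid

end

theorem mainTheorem2
    {EG : Type*} [NormedAddCommGroup EG] [NormedSpace ℝ EG] [FiniteDimensional ℝ EG]
    {HG : Type*} [TopologicalSpace HG] (IG : ModelWithCorners ℝ EG HG) [IG.Boundaryless]
    (G : Type*) [TopologicalSpace G] [ChartedSpace HG G] [IsManifold IG ∞ G] [T2Space G]
    {EM : Type*} [NormedAddCommGroup EM] [NormedSpace ℝ EM] [FiniteDimensional ℝ EM]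
    {HM : Type*} [TopologicalSpace HM] (IM : ModelWithCorners ℝ EM HM) [IM.Boundaryless]
    (M : Type*) [TopologicalSpace M] [ChartedSpace HM M] [IsManifold IM ∞ M] [T2Space M]
    (𝒢 : LieGroupoid IG G IM M) :
    (BijOn 𝒢.jMap univ 𝒢.tangentAlgebroid ∧
      ∀ (ξ : ∀ g : G, TangentSpace IG g) (x : ∀ m : M, TangentSpace IM m),
        𝒢.IsMultiplicative ξ x →
        (∀ a, 𝒢.lieFunctor ξ a ∈ 𝒢.tangentAlgebroid) ∧
        ∃ ξ' : ∀ a : TotalSpace (LieGroupoid.AlgebroidModel EG EM) 𝒢.Algebroid,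
            TangentSpace (IM.prod 𝓘(ℝ, LieGroupoid.AlgebroidModel EG EM)) a,
          𝒢.IsLieLift ξ ξ' ∧ IsLinearVectorField IM ξ' x ∧
          ∃ Dξ Dξ' : Cₛ^∞⟮IM; LieGroupoid.AlgebroidModel EG EM, 𝒢.Algebroid⟯ →
              Cₛ^∞⟮IM; LieGroupoid.AlgebroidModel EG EM, 𝒢.Algebroid⟯,
            (∀ D, 𝒢.IsBracketOperator ξ D ↔ D = Dξ) ∧
            (∀ D, IsOperatorOf IM ξ' x D ↔ D = Dξ') ∧
            IsCovariantDifferentialOperator IM x Dξ' ∧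
            Dξ' = Dξ) ∧
    (∀ x : ∀ m : M, TangentSpace IM m, IsSmoothVectorField IM x →
      (pairGroupoid IM M).IsMultiplicative (pairField IM x) x ∧
      ∃ ξ' : ∀ a : TotalSpace (LieGroupoid.AlgebroidModel (EM × EM) EM)
            (pairGroupoid IM M).Algebroid,
          TangentSpace (IM.prod 𝓘(ℝ, LieGroupoid.AlgebroidModel (EM × EM) EM)) a,
        (pairGroupoid IM M).IsLieLift (pairField IM x) ξ' ∧
        ∃ x' : ∀ v : TangentBundle IM M, TangentSpace IM.tangent v,
          IsCompleteLift IM x x' ∧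
          (∃ Φ : Diffeomorph (IM.prod 𝓘(ℝ, LieGroupoid.AlgebroidModel (EM × EM) EM)) IM.tangent
              (TotalSpace (LieGroupoid.AlgebroidModel (EM × EM) EM) (pairGroupoid IM M).Algebroid)
              (TangentBundle IM M) ∞,
            (∀ a, Φ a = ⟨a.1, (pairGroupoid IM M).anchor a.1 a.2⟩) ∧
            ∀ a, mfderiv (IM.prod 𝓘(ℝ, LieGroupoid.AlgebroidModel (EM × EM) EM)) IM.tangent Φ a
              (ξ' a) = x' (Φ a)) ∧
          IsLinearVectorField IM x' x ∧
          (∃ L : Cₛ^∞⟮IM; EM, (TangentSpace IM : M → Type _)⟯ →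
              Cₛ^∞⟮IM; EM, (TangentSpace IM : M → Type _)⟯,
            (∀ y m, L y m = mlieBracket IM x y m) ∧
            ∀ D, IsOperatorOf IM x' x D ↔ D = L) ∧
          ∀ D, (pairGroupoid IM M).IsBracketOperator (pairField IM x) D → ∀ X m,
            (pairGroupoid IM M).anchor m (D X m) =
              mlieBracket IM x (fun m' ↦ (pairGroupoid IM M).anchor m' (X m')) m) := by
  refine ⟨⟨𝒢.bijOn_jMap, fun ξ x hξ ↦ ?_⟩, fun x hx ↦ ?_⟩
  · obtain ⟨ξ', hξ'⟩ := LieGroupoid.exists_isLieLift hξ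
    -- One operator is the unique solution of both characterisations, so the final equality is
    -- reflexivity.
    exact ⟨LieGroupoid.lieFunctor_mem_tangentAlgebroid hξ, ξ', hξ', hξ'.isLinearVectorField hξ,
      hξ.bracketOperator, hξ.bracketOperator, hξ.isBracketOperator_iff, hξ'.isOperatorOf_iff hξ,
      hξ.isCovariantDifferentialOperator, rfl⟩
  · have hξ := isMultiplicative_pairField hx
    obtain ⟨ξ', hξ'⟩ := LieGroupoid.exists_isLieLift hξ
    exact ⟨hξ, ξ', hξ', completeLift x, isCompleteLift_completeLift hx,
      ⟨pairAnchor IM M, fun _ ↦ rfl, mfderiv_pairAnchor hx hξ'⟩,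
      isLinearVectorField_completeLift hx,
      ⟨lieDerivative hx, fun _ _ ↦ rfl, isOperatorOf_completeLift_iff hx⟩,
      fun _ hD ↦ hξ.anchor_bracketOperator hD⟩
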